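/- Let $X$ be a smooth manifold with boundary of dimension $n\ge 1$ (Hausdorff, second countable). For $x\in\partial X$ let $N_x=T_xX/T_x\partial X$ be the normal line of the boundary, with its inward pointing half-line. * The groupoid $\Gamma(X)$ is the disjoint union of $\mathring X\times\mathring X$ and of the set of all triples $(x,y,\alpha)$, where $x,y$ lie in the same connected component of $\partial X$ and $\alpha:N_y\to N_x$ is a linear isomorphism which maps inward pointing vectors to inward pointing vectors. (A choice of defining function identifies the second set with $\bigcup_C C\times C\times\mathbb R_+^*$, where $C$ runs through the components of $\partial X$.) Its smooth structure is given, for local coordinates $(x_1,x')$ and $(y_1,y')$ of $X$ with $x_1,y_1$ defining the boundary, by the local coordinates $(\lambda,x',y_1,y')$, where $\lambda=x_1/y_1$ on $\mathring X\times\mathring X$ and $\lambda$ is determined by $dx_1\circ\alpha=\lambda\,dy_1$ at $(x,y,\alpha)$. * The $b$-stretched product $X_b^2$ is obtained from $X\times X$ by replacing the union of the products $C\times C$, with $C$ a component of $\partial X$ (this is $(\partial X)^2$ if $\partial X$ is connected), by the inward pointing part of its spherical normal bundle, i.e. by the rays in $N_x\times N_y$ spanned by the non-zero pairs $(v,w)$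 of inward pointing (possibly zero) vectors. Its smooth structure (as a manifold with corners) is given by the local coordinates of $X\times X$ away from $\bigcup_C C\times C$ and by the projective coordinates $(x_1/y_1,x',y_1,y')$ and $(x_1,x',y_1/x_1,y')$. Let $\beta_b:X_b^2\to X^2$ be the blow-down map. * $\mathrm{lb}$ and $\mathrm{rb}$ are the closures in $X_b^2$ of $\beta_b^{-1}(\partial X\times\mathring X)$ and $\beta_b^{-1}(\mathring X\times\partial X)$. * A defining function of a component $C$ of $\partial X$ is a smooth function $\rho_C\ge 0$ on $X$ which vanishes exactly on $C$ and satisfies $d\rho_C\ne 0$ on $C$. Let $\tau_C:X_b^2\to\mathbb R$ be the function given by $\frac{\rho_C(x)-\rho_C(y)}{\rho_C(x)+\rho_C(y)}$ over each $(x,y)\notin C\times C$, and by $\frac{d\rho_C(v)-d\rho_C(w)}{d\rho_C(v)+d\rho_C(w)}$ at the ray of $(v,w)$ over $(x,y)\in C\times C$. Let $\varphi_C:\Gamma(X)\to\mathbb R$ be the function given by $\log\frac{\rho_C(x)}{\rho_C(y)}$ if the range $x$ and the source $y$ are not in $C$, and by $\log\lambda$, where $d\rho_C\circ\alpha=\lambda\,d\rho_C$,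 at $(x,y,\alpha)$ with $x,y\in C$. Consider the canonical map $\iota:\Gamma(X)\to X_b^2$, which is the identity on $\mathring X\times\mathring X$ and sends $(x,y,\alpha)$ to the ray of $(\alpha(v),v)$ for any non-zero inward pointing $v\in N_y$. Then: 1. $\iota$ is an open embedding and a local diffeomorphism, so it identifies $\Gamma(X)$ with an open submanifold of $X_b^2$. 2. $X_b^2\setminus\Gamma(X)=\mathrm{lb}\cup\mathrm{rb}$. 3. For every component $C$ of $\partial X$ and every defining function $\rho_C$ of $C$, the function $\tau_C$ is smooth on $X_b^2$, and $\tau_C=\tanh(\varphi_C/2)$ on $\Gamma(X)$. 4. For every choice of a defining function for each component of $\partial X$, $\Gamma(X)=\bigcap_C\tau_C^{-1}(\,]-1,1[\,)$; in particular $\Gamma(X)=\tau^{-1}(\,]-1,1[\,)$ if $\partial X$ is non-empty and connected. -/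

import Mathlib

open Set Filter Topology
open scoped Manifold ContDiff

set_option linter.unusedSectionVars false

namespace BStretch
universe u

theorem contDiffOn_integral_param {E : Type} [NormedAddCommGroup E] [NormedSpace ℝ E]
    {K : Set E} (hK : Convex ℝ K) (hKi : (interior K).Nonempty) (k : ℕ) :
    ∀ {F : Type} [NormedAddCommGroup F] [NormedSpace ℝ F] [CompleteSpace F] (h : ℝ × E → F),
      ContDiffOn ℝ k h (Icc (0 : ℝ) 1 ×ˢ K) →
      ContDiffOn ℝ k (fun x => ∫ s in (0 : ℝ)..1, h (s, x)) K := by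
  have hu : UniqueDiffOn ℝ K := uniqueDiffOn_convex hK hKi
  have hIK : UniqueDiffOn ℝ (Icc (0 : ℝ) 1 ×ˢ K) := (uniqueDiffOn_Icc one_pos).prod hu
  -- uniform closeness in the parameter
  have key : ∀ {F : Type} [NormedAddCommGroup F] (h : ℝ × E → F),
      ContinuousOn h (Icc (0 : ℝ) 1 ×ˢ K) → ∀ x ∈ K, ∀ ε > 0,
      ∀ᶠ y in 𝓝[K] x, ∀ s ∈ Icc (0 : ℝ) 1, ‖h (s, y) - h (s, x)‖ < ε := by
    intro F _ h hh x hx ε hε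
    have := isCompact_Icc.mem_uniformity_of_prod (f := fun y s => h (s, y)) (s := K)
      (k := Icc (0 : ℝ) 1) (q := x) (u := {p | dist p.1 p.2 < ε})
      (hh.comp (f := fun p : E × ℝ => (p.2, p.1)) (by fun_prop)
        (fun p hp => ⟨hp.2, hp.1⟩)) hx (Metric.dist_mem_uniformity hε)
    obtain ⟨v, hv, H⟩ := this
    filter_upwards [hv] with y hy s hs
    have := H y hy s hs
    rwa [← dist_eq_norm]
  have cont_s : ∀ {F : Type} [NormedAddCommGroup F] (h : ℝ × E → F),
      ContinuousOn h (Icc (0 : ℝ) 1 ×ˢ K) → ∀ x ∈ K,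
      ContinuousOn (fun s => h (s, x)) (uIcc (0 : ℝ) 1) := by
    intro F _ h hh x hx
    rw [uIcc_of_le zero_le_one]
    exact hh.comp (by fun_prop) (fun s hs => ⟨hs, hx⟩)
  induction k with
  | zero =>
    intro F _ _ _ h hh
    have hh := hh.continuousOn
    simp only [CharP.cast_eq_zero, contDiffOn_zero]
    intro x hx
    rw [ContinuousWithinAt, Metric.tendsto_nhds]
    intro ε hε
    filter_upwards [key h hh x hx (ε / 2) (by positivity), self_mem_nhdsWithin] with y hy hyK
    rw [dist_eq_norm, ← intervalIntegral.integral_sub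
      (cont_s h hh y hyK).intervalIntegrable (cont_s h hh x hx).intervalIntegrable]
    have := intervalIntegral.norm_integral_le_of_norm_le_const (a := (0 : ℝ)) (b := 1)
      (f := fun s => h (s, y) - h (s, x)) (C := ε / 2) (fun s hs => by
        rw [uIoc_of_le zero_le_one] at hs
        exact (hy s ⟨hs.1.le, hs.2⟩).le)
    simp only [sub_zero, abs_one, mul_one] at this
    linarith
  | succ k ih =>
    intro F _ _ _ h hh
    push_cast at hh ⊢
    have hh0 := hh.continuousOn
    set h' : ℝ × E → (E →L[ℝ] F) := fun p =>
      (fderivWithin ℝ h (Icc (0 : ℝ) 1 ×ˢ K) p).comp (ContinuousLinearMap.inr ℝ ℝ E) with hh'def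
    have hh' : ContDiffOn ℝ k h' (Icc (0 : ℝ) 1 ×ˢ K) :=
      ((contDiffOn_succ_iff_fderivWithin hIK).1 hh).2.2.clm_comp contDiffOn_const
    have hd : ∀ s ∈ Icc (0 : ℝ) 1, ∀ x ∈ K,
        HasFDerivWithinAt (fun x => h (s, x)) (h' (s, x)) K x := by
      intro s hs x hx
      have h1 := ((hh.differentiableOn (by simp)) (s, x) ⟨hs, hx⟩).hasFDerivWithinAt
      exact h1.comp (f := fun x => (s, x)) x (hasFDerivAt_prodMk_right s x).hasFDerivWithinAt
        (fun y hy => ⟨hs, hy⟩)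
    rw [contDiffOn_succ_iff_hasFDerivWithinAt_of_uniqueDiffOn hu]
    refine ⟨by simp, fun x => ∫ s in (0 : ℝ)..1, h' (s, x), ih h' hh', fun x hx => ?_⟩
    have hc' := hh'.continuousOn
    rw [hasFDerivWithinAt_iff_isLittleO, Asymptotics.isLittleO_iff]
    intro ε hε
    obtain ⟨r, hr, hball⟩ := Metric.mem_nhdsWithin_iff.1 (key h' hc' x hx ε hε)
    filter_upwards [self_mem_nhdsWithin, mem_nhdsWithin_of_mem_nhds (Metric.ball_mem_nhds x hr)]
      with y hyK hyr
    have hb : ∀ s ∈ Icc (0 : ℝ) 1, ‖h (s, y) - h (s, x) - h' (s, x) (y - x)‖ ≤ ε * ‖y - x‖ := by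
      intro s hs
      refine Convex.norm_image_sub_le_of_norm_hasFDerivWithin_le' (f := fun x => h (s, x))
        (f' := fun x => h' (s, x)) (s := Metric.ball x r ∩ K)
        (fun z hz => (hd s hs z hz.2).mono inter_subset_right)
        (fun z hz => (hball hz s hs).le) ((convex_ball x r).inter hK)
        ⟨Metric.mem_ball_self hr, hx⟩ ⟨hyr, hyK⟩
    have e1 : (∫ s in (0 : ℝ)..1, h' (s, x)) (y - x) = ∫ s in (0 : ℝ)..1, h' (s, x) (y - x) :=
      ContinuousLinearMap.intervalIntegral_apply (cont_s h' hc' x hx).intervalIntegrable _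
    have i3 : ContinuousOn (fun s => h' (s, x) (y - x)) (uIcc (0 : ℝ) 1) :=
      (cont_s h' hc' x hx).clm_apply continuousOn_const
    rw [e1, ← intervalIntegral.integral_sub
      (cont_s h hh0 y hyK).intervalIntegrable (cont_s h hh0 x hx).intervalIntegrable,
      ← intervalIntegral.integral_sub
      (f := fun s => h (s, y) - h (s, x))
      ((cont_s h hh0 y hyK).sub (cont_s h hh0 x hx)).intervalIntegrable i3.intervalIntegrable]
    have := intervalIntegral.norm_integral_le_of_norm_le_const (a := (0 : ℝ)) (b := 1)
      (f := fun s => h (s, y) - h (s, x) - h' (s, x) (y - x)) (C := ε * ‖y - x‖) (fun s hs => by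
        rw [uIoc_of_le zero_le_one] at hs
        exact hb s ⟨hs.1.le, hs.2⟩)
    simpa using this

/-- Division by the boundary coordinate in a half-space (Hadamard's lemma). -/
theorem exists_contDiffOn_quotient {n : ℕ} [NeZero n] {V : Set (EuclideanSpace ℝ (Fin n))}
    (hV : IsOpen V) {f : EuclideanSpace ℝ (Fin n) → ℝ}
    (hf : ContDiffOn ℝ ∞ f (V ∩ {x | 0 ≤ x 0})) (hf0 : ∀ x ∈ V, x 0 = 0 → f x = 0) :
    ∃ g : EuclideanSpace ℝ (Fin n) → ℝ, ContDiffOn ℝ ∞ g (V ∩ {x | 0 ≤ x 0}) ∧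
      ∀ x ∈ V, 0 ≤ x 0 → f x = g x * x 0 := by
  set Hs : Set (EuclideanSpace ℝ (Fin n)) := {x | 0 ≤ x 0} with hHs
  set e0 : EuclideanSpace ℝ (Fin n) := EuclideanSpace.single 0 1 with he0
  have hHc : Convex ℝ Hs := EuclideanHalfSpace.convex
  have hHu : UniqueDiffOn ℝ Hs := by
    refine uniqueDiffOn_convex hHc ⟨e0, ?_⟩
    rw [hHs, interior_halfSpace]; simp [he0]
  refine ⟨fun x => if x 0 = 0 then fderivWithin ℝ f (V ∩ Hs) x e0 else f x / x 0, ?_, ?_⟩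
  swap
  · intro x hx hx0
    by_cases h : x 0 = 0
    · simp [h, hf0 x hx h]
    · simp only [h, if_false]; field_simp
  rintro z ⟨hzV, hz⟩
  rcases (show (0:ℝ) ≤ z 0 from hz).eq_or_lt with hz0 | hz0
  swap
  · -- away from the boundary
    have h1 : ContDiffWithinAt ℝ ∞ (fun x => f x / x 0) (V ∩ Hs) z := by
      refine (hf z ⟨hzV, hz⟩).div ?_ hz0.ne'
      exact (EuclideanSpace.proj (𝕜 := ℝ) (0 : Fin n)).contDiff.contDiffWithinAt
    refine h1.congr_of_eventuallyEq ?_ (by simp [hz0.ne'])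
    have : ∀ᶠ x in 𝓝 z, 0 < x 0 :=
      ((EuclideanSpace.proj (𝕜 := ℝ) (0 : Fin n)).continuous.tendsto z).eventually
        (lt_mem_nhds hz0)
    filter_upwards [mem_nhdsWithin_of_mem_nhds this] with x hx
    simp [hx.ne']
  obtain ⟨r, hr, hball⟩ := Metric.isOpen_iff.1 hV z hzV
  set K : Set (EuclideanSpace ℝ (Fin n)) := Metric.ball z r ∩ Hs with hKdef
  have hKV : K ⊆ V ∩ Hs := inter_subset_inter_left _ hball
  have hK : Convex ℝ K := (convex_ball z r).inter hHc
  have hKi : (interior K).Nonempty := by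
    rw [hKdef, interior_inter, Metric.isOpen_ball.interior_eq, hHs, interior_halfSpace]
    refine ⟨z + (r / 2) • e0, ?_, ?_⟩
    · simp [he0, norm_smul, abs_of_pos hr]; linarith
    · simp [he0, ← hz0]; positivity
  set σ : ℝ → EuclideanSpace ℝ (Fin n) → EuclideanSpace ℝ (Fin n) :=
    fun s x => x + ((s - 1) * x 0) • e0 with hσ
  have hσ0 : ∀ s x, σ s x 0 = s * x 0 := by
    intro s x; simp [hσ, he0]; ring
  have hσK : ∀ s ∈ Icc (0 : ℝ) 1, ∀ x ∈ K, σ s x ∈ K := by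
    rintro s ⟨hs0, hs1⟩ x ⟨hxb, hx0⟩
    refine ⟨?_, ?_⟩
    · rw [Metric.mem_ball, EuclideanSpace.dist_eq] at hxb ⊢
      refine lt_of_le_of_lt (Real.sqrt_le_sqrt ?_) hxb
      refine Finset.sum_le_sum fun i _ => ?_
      by_cases hi : i = 0
      · subst hi
        rw [hσ0, ← hz0, Real.dist_eq, Real.dist_eq, sub_zero, sub_zero, sq_abs, sq_abs, mul_pow]
        exact mul_le_of_le_one_left (sq_nonneg _) (pow_le_one₀ hs0 hs1)
      · have : σ s x i = x i := by simp [hσ, he0, hi]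
        rw [this]
    · change 0 ≤ σ s x 0
      rw [hσ0]; exact mul_nonneg hs0 hx0
  have hVu : UniqueDiffOn ℝ (V ∩ Hs) := by rw [inter_comm]; exact hHu.inter hV
  set f' := fderivWithin ℝ f (V ∩ Hs) with hf'
  have hf's : ContDiffOn ℝ ∞ f' (V ∩ Hs) := hf.fderivWithin hVu (by simp)
  have hσs : ContDiff ℝ ∞ (fun p : ℝ × EuclideanSpace ℝ (Fin n) => σ p.1 p.2) := by
    have : ContDiff ℝ ∞ (fun p : ℝ × EuclideanSpace ℝ (Fin n) => p.2 0) :=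
      (EuclideanSpace.proj (𝕜 := ℝ) (0 : Fin n)).contDiff.comp contDiff_snd
    exact contDiff_snd.add (((contDiff_fst.sub contDiff_const).mul this).smul contDiff_const)
  have hint : ContDiffOn ℝ ∞ (fun x => ∫ s in (0 : ℝ)..1, f' (σ s x) e0) K := by
    rw [contDiffOn_infty]
    intro k
    refine contDiffOn_integral_param hK hKi k (fun p => f' (σ p.1 p.2) e0) ?_
    have : ContDiffOn ℝ ∞ (fun p : ℝ × EuclideanSpace ℝ (Fin n) => f' (σ p.1 p.2) e0)
        (Icc (0 : ℝ) 1 ×ˢ K) :=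
      (hf's.comp hσs.contDiffOn (fun p hp => hKV (hσK p.1 hp.1 p.2 hp.2))).clm_apply
        contDiffOn_const
    exact this.of_le (by exact_mod_cast le_top)
  have hzK : z ∈ K := ⟨Metric.mem_ball_self hr, hz⟩
  have heq : ∀ x ∈ K, (if x 0 = 0 then f' x e0 else f x / x 0)
      = ∫ s in (0 : ℝ)..1, f' (σ s x) e0 := by
    intro x hx
    have hcont : ContinuousOn (fun s => f' (σ s x)) (Icc (0 : ℝ) 1) :=
      hf's.continuousOn.comp (hσs.continuous.comp (by fun_prop : Continuous fun s : ℝ => (s, x))).continuousOn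
        (fun s hs => hKV (hσK s hs x hx))
    split_ifs with h0
    · have : ∀ s, σ s x = x := by intro s; simp [hσ, h0]
      simp [this]
    · have hd : ∀ s ∈ Ioo (0 : ℝ) 1, HasDerivAt (fun s => f (σ s x)) (x 0 * f' (σ s x) e0) s := by
        intro s hs
        have h1 : HasFDerivWithinAt f (f' (σ s x)) (V ∩ Hs) (σ s x) :=
          (hf.differentiableOn (by simp) _ (hKV (hσK s ⟨hs.1.le, hs.2.le⟩ x hx))).hasFDerivWithinAt
        have h2 : HasDerivWithinAt (fun s => σ s x) (x 0 • e0) (Icc (0 : ℝ) 1) s := by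
          have : HasDerivAt (fun s : ℝ => x + ((s - 1) * x 0) • e0) ((1 * x 0) • e0) s :=
            (((hasDerivAt_id s).sub_const 1).mul_const (x 0)).smul_const e0 |>.const_add x
          rw [one_mul] at this
          exact this.hasDerivWithinAt
        have h3 := h1.comp_hasDerivWithinAt s h2 (fun t ht => hKV (hσK t ht x hx))
        have h4 := h3.hasDerivAt (Icc_mem_nhds hs.1 hs.2)
        rw [map_smul, smul_eq_mul] at h4
        exact h4
      have hc2 : ContinuousOn (fun s => f (σ s x)) (Icc (0 : ℝ) 1) :=
        hf.continuousOn.comp (hσs.continuous.comp (by fun_prop : Continuous fun s : ℝ => (s, x))).continuousOn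
          (fun s hs => hKV (hσK s hs x hx))
      have hc3 : ContinuousOn (fun s => x 0 * f' (σ s x) e0) (Icc (0 : ℝ) 1) :=
        continuousOn_const.mul (hcont.clm_apply continuousOn_const)
      have hftc := intervalIntegral.integral_eq_sub_of_hasDerivAt_of_le zero_le_one hc2 hd
        (by rw [intervalIntegrable_iff_integrableOn_Icc_of_le zero_le_one]; exact hc3.integrableOn_Icc)
      rw [intervalIntegral.integral_const_mul] at hftc
      have e1 : σ 1 x = x := by simp [hσ]
      have e2 : f (σ 0 x) = 0 := hf0 _ (hKV (hσK 0 ⟨le_rfl, zero_le_one⟩ x hx)).1 (by simp [hσ0])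
      rw [e1, e2, sub_zero] at hftc
      rw [← hftc]; field_simp
  have h1 : ContDiffWithinAt ℝ ∞ (fun x => if x 0 = 0 then f' x e0 else f x / x 0) K z :=
    (hint z hzK).congr heq (heq z hzK)
  refine h1.mono_of_mem_nhdsWithin ?_
  exact inter_mem (mem_nhdsWithin_of_mem_nhds (Metric.ball_mem_nhds z hr))
    (mem_of_superset self_mem_nhdsWithin inter_subset_right)

section Boundary
variable (n : ℕ) [NeZero n] {X : Type*} [TopologicalSpace X]
  [ChartedSpace (EuclideanHalfSpace n) X]

/-- `x` and `y` lie in the same connected component of the boundary of `X`. -/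
def SameBoundaryComponent (x y : X) : Prop :=
  ∃ (hx : x ∈ (𝓡∂ n).boundary X) (hy : y ∈ (𝓡∂ n).boundary X),
    ConnectedComponents.mk (⟨x, hx⟩ : (𝓡∂ n).boundary X) = ConnectedComponents.mk ⟨y, hy⟩

/-- The function defining the boundary in a chart: the first coordinate. -/
noncomputable def boundaryCoord (e : OpenPartialHomeomorph X (EuclideanHalfSpace n)) (x : X) : ℝ :=
  (e x).1 0

/-- The differential at `x` of the first coordinate of the preferred chart at `x`. -/
noncomputable def boundaryForm (x : X) : TangentSpace (𝓡∂ n) x →L[ℝ] ℝ :=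
  mvfderiv (𝓡∂ n) (boundaryCoord n (chartAt (EuclideanHalfSpace n) x)) x

/-- The tangent space of the boundary at a boundary point `x`: the kernel of the differential of a
function defining the boundary near `x`. -/
noncomputable def boundaryTangent (x : X) : Submodule ℝ (TangentSpace (𝓡∂ n) x) :=
  LinearMap.ker (boundaryForm n x).toLinearMap

/-- The fibre at a boundary point `x` of the normal bundle of the boundary. -/
abbrev NormalSpace (x : X) : Type := TangentSpace (𝓡∂ n) x ⧸ boundaryTangent n x

/-- The coordinate of a normal vector in the preferred chart; inward pointing vectors are those
with nonnegative coordinate. -/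
noncomputable def normalCoord (x : X) : NormalSpace n x →ₗ[ℝ] ℝ :=
  (boundaryTangent n x).liftQ (boundaryForm n x).toLinearMap le_rfl

/-- The inward pointing unit normal vector in the preferred chart. -/
noncomputable def inwardUnit (x : X) : NormalSpace n x :=
  let v : TangentSpace (𝓡∂ n) x :=
    (EuclideanSpace.single (0 : Fin n) (1 : ℝ) : EuclideanSpace ℝ (Fin n))
  (boundaryTangent n x).mkQ v

open Classical in
/-- The linear form induced on the normal space by the differential at `x` of a function which is
constant along the boundary (`0` if the differential does not vanish along the boundary). -/
noncomputable def normalDeriv (ρ : X → ℝ) (x : X) : NormalSpace n x →ₗ[ℝ] ℝ :=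
  if h : boundaryTangent n x ≤ LinearMap.ker (mvfderiv (𝓡∂ n) ρ x).toLinearMap
  then (boundaryTangent n x).liftQ (mvfderiv (𝓡∂ n) ρ x).toLinearMap h
  else 0

open Classical in
/-- The leading coefficient of `ρ` at `x` in the normal direction `v`: the differential of `ρ`
applied to `v` if `ρ` vanishes at `x`, and the value of `ρ` at `x` otherwise. -/
noncomputable def leadingCoeff (ρ : X → ℝ) (x : X) (v : NormalSpace n x) : ℝ :=
  if ρ x = 0 then normalDeriv n ρ x v else ρ x

end Boundary

section Hadamard
variable {n : ℕ} [NeZero n] {X : Type*} [TopologicalSpace X]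
  [ChartedSpace (EuclideanHalfSpace n) X]

theorem boundaryCoord_nonneg (e : OpenPartialHomeomorph X (EuclideanHalfSpace n)) (x : X) :
    0 ≤ boundaryCoord n e x := (e x).2

variable [IsManifold (𝓡∂ n) ∞ X]

theorem mem_boundary_iff {e : OpenPartialHomeomorph X (EuclideanHalfSpace n)}
    (he : e ∈ atlas (EuclideanHalfSpace n) X) {x : X} (hx : x ∈ e.source) :
    x ∈ (𝓡∂ n).boundary X ↔ boundaryCoord n e x = 0 := by
  have h1 := (𝓡∂ n).isBoundaryPoint_iff_of_mem_atlas (n := ∞) (by simp) he hx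
  change (𝓡∂ n).IsBoundaryPoint x ↔ _
  rw [(𝓡∂ n).isBoundaryPoint_iff_not_isInteriorPoint,
    (𝓡∂ n).isInteriorPoint_iff_of_mem_atlas (n := ∞) (by simp) he hx]
  have h2 : e.extend (𝓡∂ n) x ∈ interior (e.extend (𝓡∂ n)).target ↔ 0 < (e x).1 0 := by
    rw [e.extend_target, interior_inter,
      (e.open_target.preimage (𝓡∂ n).continuous_symm).interior_eq,
      interior_range_modelWithCornersEuclideanHalfSpace]
    constructor
    · intro h; exact h.2
    · intro h
      refine ⟨?_, h⟩
      simp only [mem_preimage, e.extend_coe, Function.comp_apply, ModelWithCorners.left_inv]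
      exact e.map_source hx
  rw [h2, boundaryCoord]
  have := (e x).2
  constructor
  · intro h; exact le_antisymm (not_lt.1 h) this
  · intro h; rw [h]; exact lt_irrefl _

theorem contMDiffOn_boundaryCoord {e : OpenPartialHomeomorph X (EuclideanHalfSpace n)}
    (he : e ∈ atlas (EuclideanHalfSpace n) X) :
    ContMDiffOn (𝓡∂ n) 𝓘(ℝ, ℝ) ∞ (boundaryCoord n e) e.source := by
  have h1 : ContMDiffOn (𝓡∂ n) 𝓘(ℝ, EuclideanSpace ℝ (Fin n)) ∞ (e.extend (𝓡∂ n)) e.source :=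
    e.contMDiffOn_extend (IsManifold.subset_maximalAtlas he)
  have h2 : ContMDiff 𝓘(ℝ, EuclideanSpace ℝ (Fin n)) 𝓘(ℝ, ℝ) ∞
      (EuclideanSpace.proj (𝕜 := ℝ) (0 : Fin n)) := (ContinuousLinearMap.contDiff _).contMDiff
  exact h2.comp_contMDiffOn h1

/-- Hadamard's lemma on a manifold with boundary. -/
theorem exists_contMDiffOn_quotient {e : OpenPartialHomeomorph X (EuclideanHalfSpace n)}
    (he : e ∈ atlas (EuclideanHalfSpace n) X) {U : Set X} (hU : IsOpen U) (hUe : U ⊆ e.source)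
    {ρ : X → ℝ} (hρ : ContMDiffOn (𝓡∂ n) 𝓘(ℝ, ℝ) ∞ ρ U)
    (hρ0 : ∀ x ∈ U, x ∈ (𝓡∂ n).boundary X → ρ x = 0) :
    ∃ q : X → ℝ, ContMDiffOn (𝓡∂ n) 𝓘(ℝ, ℝ) ∞ q U ∧ ∀ x ∈ U, ρ x = q x * boundaryCoord n e x := by
  set V : Set (EuclideanSpace ℝ (Fin n)) := (𝓡∂ n).symm ⁻¹' (e.target ∩ e.symm ⁻¹' U) with hVd
  have hV : IsOpen V := (e.isOpen_inter_preimage_symm hU).preimage (𝓡∂ n).continuous_symm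
  have hval : ∀ {v : EuclideanSpace ℝ (Fin n)}, 0 ≤ v 0 → ((𝓡∂ n).symm v).1 = v := by
    intro v hv
    exact (𝓡∂ n).right_inv (by rw [range_modelWithCornersEuclideanHalfSpace]; exact hv)
  have hf : ContDiffOn ℝ ∞ (fun v => ρ (e.symm ((𝓡∂ n).symm v))) (V ∩ {x | 0 ≤ x 0}) := by
    rw [← contMDiffOn_iff_contDiffOn]
    have h1 : ContMDiffOn 𝓘(ℝ, EuclideanSpace ℝ (Fin n)) (𝓡∂ n) ∞ (𝓡∂ n).symm
        (V ∩ {x | 0 ≤ x 0}) := by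
      refine (𝓡∂ n).contMDiffOn_symm.mono ?_
      rw [range_modelWithCornersEuclideanHalfSpace]; exact inter_subset_right
    have h2 : ContMDiffOn (𝓡∂ n) (𝓡∂ n) ∞ e.symm (e.target ∩ e.symm ⁻¹' U) :=
      (contMDiffOn_symm_of_mem_maximalAtlas (IsManifold.subset_maximalAtlas he)).mono
        inter_subset_left
    exact (hρ.comp h2 (fun x hx => hx.2)).comp h1 (fun x hx => hx.1)
  obtain ⟨g, hg, hgf⟩ := exists_contDiffOn_quotient hV hf (by
    intro v hv hv0
    refine hρ0 _ hv.2 ?_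
    rw [mem_boundary_iff he (e.map_target hv.1), boundaryCoord, e.right_inv hv.1,
      hval hv0.ge, hv0])
  have hmaps : ∀ x ∈ U, (e x).1 ∈ V ∩ {x | 0 ≤ x 0} := by
    intro x hx
    refine ⟨?_, (e x).2⟩
    have : (𝓡∂ n).symm (e x).1 = e x := (𝓡∂ n).left_inv _
    simp only [hVd, mem_preimage, this, mem_inter_iff, e.left_inv (hUe hx)]
    exact ⟨e.map_source (hUe hx), hx⟩
  refine ⟨fun x => g (e x).1, ?_, fun x hx => ?_⟩
  · have h1 : ContMDiffOn (𝓡∂ n) 𝓘(ℝ, EuclideanSpace ℝ (Fin n)) ∞ (e.extend (𝓡∂ n)) U :=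
      (e.contMDiffOn_extend (IsManifold.subset_maximalAtlas he)).mono hUe
    exact hg.contMDiffOn.comp h1 hmaps
  · have := hgf _ (hmaps x hx).1 (hmaps x hx).2
    have h3 : (𝓡∂ n).symm (e x).1 = e x := (𝓡∂ n).left_inv _
    rw [h3, e.left_inv (hUe hx)] at this
    exact this

theorem mvfderiv_quotient {U : Set X} (hU : IsOpen U) {ρ c q : X → ℝ}
    (hq : ContMDiffOn (𝓡∂ n) 𝓘(ℝ, ℝ) ∞ q U) (hc : ContMDiffOn (𝓡∂ n) 𝓘(ℝ, ℝ) ∞ c U)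
    (h : ∀ x ∈ U, ρ x = q x * c x) {x : X} (hx : x ∈ U) (hc0 : c x = 0) :
    mvfderiv (𝓡∂ n) ρ x = q x • mvfderiv (𝓡∂ n) c x := by
  have h1 := (hq.contMDiffAt (hU.mem_nhds hx)).mdifferentiableAt (by simp)
  have h2 := (hc.contMDiffAt (hU.mem_nhds hx)).mdifferentiableAt (by simp)
  have h4 : ρ =ᶠ[𝓝 x] (q * c : X → ℝ) := by
    filter_upwards [hU.mem_nhds hx] with y hy using h y hy
  have h5 := mvfderiv_mul h1 h2
  rw [hc0, zero_smul, add_zero] at h5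
  rw [← h5]
  ext v
  simp only [mvfderiv, ContinuousLinearMap.comp_apply]
  rw [h4.mfderiv_eq]
  rfl

theorem boundaryForm_apply (x : X) (v : EuclideanSpace ℝ (Fin n)) :
    boundaryForm n x v = v 0 := by
  have h1 : MDifferentiableAt (𝓡∂ n) 𝓘(ℝ, ℝ)
      (boundaryCoord n (chartAt (EuclideanHalfSpace n) x)) x :=
    ((contMDiffOn_boundaryCoord (chart_mem_atlas _ x)).contMDiffAt
      (chart_source_mem_nhds _ x)).mdifferentiableAt (by simp)
  have h2 : fderivWithin ℝ (writtenInExtChartAt (𝓡∂ n) 𝓘(ℝ, ℝ) x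
      (boundaryCoord n (chartAt (EuclideanHalfSpace n) x))) (range (𝓡∂ n))
      (extChartAt (𝓡∂ n) x x) =
      (EuclideanSpace.proj (𝕜 := ℝ) (0 : Fin n) : EuclideanSpace ℝ (Fin n) →L[ℝ] ℝ) := by
    refine HasFDerivWithinAt.fderivWithin ?_ ((𝓡∂ n).uniqueDiffOn _ (mem_range_self _))
    refine (EuclideanSpace.proj (𝕜 := ℝ) (0 : Fin n) :
      EuclideanSpace ℝ (Fin n) →L[ℝ] ℝ).hasFDerivWithinAt.congr_of_eventuallyEq ?_ ?_
    swap
    · exact congrArg (fun z : EuclideanSpace ℝ (Fin n) => z 0)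
        ((extChartAt (𝓡∂ n) x).right_inv (mem_extChartAt_target x))
    filter_upwards [extChartAt_target_mem_nhdsWithin (I := 𝓡∂ n) x] with y hy
    have := (extChartAt (𝓡∂ n) x).right_inv hy
    exact congrArg (fun z : EuclideanSpace ℝ (Fin n) => z 0) this
  have h3 := h1.mvfderiv
  rw [h2] at h3
  exact congrArg (fun f => f v) h3

theorem normalCoord_injective (x : X) : Function.Injective (normalCoord n x) := by
  rw [← LinearMap.ker_eq_bot]
  exact Submodule.ker_liftQ_eq_bot _ _ _ le_rfl

theorem normalCoord_inwardUnit (x : X) : normalCoord n x (inwardUnit n x) = 1 := by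
  refine (boundaryForm_apply x _).trans ?_
  simp

theorem eq_smul_inwardUnit {x : X} (v : NormalSpace n x) :
    v = normalCoord n x v • inwardUnit n x := by
  apply normalCoord_injective
  rw [map_smul, normalCoord_inwardUnit, smul_eq_mul, mul_one]

/-- A function vanishing on the boundary near a boundary point induces on the normal space a
multiple of any coordinate form. -/
theorem normalDeriv_eq_smul {ρ : X → ℝ} {x : X} {k : ℝ}
    (h : mvfderiv (𝓡∂ n) ρ x = k • boundaryForm n x) :
    normalDeriv n ρ x = k • normalCoord n x := by
  have h' : boundaryTangent n x ≤ LinearMap.ker (mvfderiv (𝓡∂ n) ρ x).toLinearMap := by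
    intro v hv
    have hv : boundaryForm n x v = 0 := hv
    change mvfderiv (𝓡∂ n) ρ x v = 0
    rw [h, smul_apply, hv, smul_zero]
  rw [normalDeriv, dif_pos h']
  apply Submodule.linearMap_qext
  ext v
  change mvfderiv (𝓡∂ n) ρ x v = k • boundaryForm n x v
  rw [h]; rfl

/-- Points of the boundary are limits of interior points. -/
theorem exists_tendsto_interior {e : OpenPartialHomeomorph X (EuclideanHalfSpace n)}
    {x : X} (hx : x ∈ e.source) :
    ∃ γ : ℝ → X, Tendsto γ (𝓝[>] 0) (𝓝 x) ∧
      ∀ᶠ t in 𝓝[>] (0 : ℝ), γ t ∈ e.source ∧ 0 < boundaryCoord n e (γ t) := by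
  set c : ℝ → EuclideanHalfSpace n := fun t =>
    (𝓡∂ n).symm ((e x).1 + t • (EuclideanSpace.single (0 : Fin n) (1 : ℝ))) with hc
  have hcc : Continuous c := (𝓡∂ n).continuous_symm.comp (by fun_prop)
  have hc0 : c 0 = e x := by
    simp only [hc, zero_smul, add_zero]; exact (𝓡∂ n).left_inv _
  have hct : Tendsto c (𝓝[>] 0) (𝓝 (e x)) := by
    rw [← hc0]; exact (hcc.tendsto 0).mono_left nhdsWithin_le_nhds
  refine ⟨fun t => e.symm (c t), ?_, ?_⟩
  · have := (e.continuousAt_symm (e.map_source hx)).tendsto.comp hct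
    rwa [e.left_inv hx] at this
  · filter_upwards [hct.eventually (e.open_target.mem_nhds (e.map_source hx)),
      self_mem_nhdsWithin] with t ht ht0
    refine ⟨e.map_target ht, ?_⟩
    rw [boundaryCoord, e.right_inv ht]
    have h0 := (e x).2
    have ht0 : 0 < t := ht0
    have : 0 < (e x).1 0 + t := by linarith
    simpa [hc, modelWithCornersEuclideanHalfSpace_symm_apply] using this

/-- The ratio of the coordinate functions of the boundary in two charts is smooth and positive. -/
theorem exists_ratio {e e' : OpenPartialHomeomorph X (EuclideanHalfSpace n)}
    (he : e ∈ atlas (EuclideanHalfSpace n) X) (he' : e' ∈ atlas (EuclideanHalfSpace n) X) :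
    ∃ q : X → ℝ, ContMDiffOn (𝓡∂ n) 𝓘(ℝ, ℝ) ∞ q (e.source ∩ e'.source) ∧
      (∀ x ∈ e.source ∩ e'.source, 0 < q x ∧ boundaryCoord n e' x = q x * boundaryCoord n e x) ∧
      ∀ x ∈ e.source ∩ e'.source, x ∈ (𝓡∂ n).boundary X →
        mvfderiv (𝓡∂ n) (boundaryCoord n e') x =
          q x • mvfderiv (𝓡∂ n) (boundaryCoord n e) x := by
  have hU : IsOpen (e.source ∩ e'.source) := e.open_source.inter e'.open_source
  have main : ∀ {e e' : OpenPartialHomeomorph X (EuclideanHalfSpace n)},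
    e ∈ atlas (EuclideanHalfSpace n) X → e' ∈ atlas (EuclideanHalfSpace n) X →
    ∃ q : X → ℝ, ContMDiffOn (𝓡∂ n) 𝓘(ℝ, ℝ) ∞ q (e.source ∩ e'.source) ∧
      (∀ x ∈ e.source ∩ e'.source, boundaryCoord n e' x = q x * boundaryCoord n e x) ∧
      ∀ x ∈ e.source ∩ e'.source, x ∈ (𝓡∂ n).boundary X →
        mvfderiv (𝓡∂ n) (boundaryCoord n e') x =
          q x • mvfderiv (𝓡∂ n) (boundaryCoord n e) x := by
    intro e e' he he'
    have hU : IsOpen (e.source ∩ e'.source) := e.open_source.inter e'.open_source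
    obtain ⟨q, hq, h⟩ := exists_contMDiffOn_quotient he hU inter_subset_left
      ((contMDiffOn_boundaryCoord he').mono inter_subset_right)
      (fun x hx hb => (mem_boundary_iff he' hx.2).1 hb)
    exact ⟨q, hq, h, fun x hx hb => mvfderiv_quotient hU hq
      ((contMDiffOn_boundaryCoord he).mono inter_subset_left) h hx ((mem_boundary_iff he hx.1).1 hb)⟩
  obtain ⟨q, hq, h, hd⟩ := main he he'
  obtain ⟨q', hq', h', hd'⟩ := main he' he
  refine ⟨q, hq, fun x hx => ⟨?_, h x hx⟩, hd⟩
  have hx' : x ∈ e'.source ∩ e.source := hx.symm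
  rcases (boundaryCoord_nonneg e x).eq_or_lt with h0 | h0
  · -- boundary point
    have hb := (mem_boundary_iff he hx.1).2 h0.symm
    obtain ⟨q'', -, -, hd''⟩ := main he (chart_mem_atlas (EuclideanHalfSpace n) x)
    have e1 := hd'' x ⟨hx.1, mem_chart_source _ x⟩ hb
    have hne : mvfderiv (𝓡∂ n) (boundaryCoord n e) x ≠ 0 := by
      intro h0
      rw [h0, smul_zero] at e1
      have := boundaryForm_apply x (EuclideanSpace.single (0 : Fin n) (1 : ℝ))
      rw [boundaryForm, e1, PiLp.single_apply, if_pos rfl] at this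
      exact zero_ne_one this
    have e2 := hd' x hx' hb
    rw [hd x hx hb, smul_smul] at e2
    have e3 : q' x * q x = 1 := by
      have : (1 - q' x * q x) • mvfderiv (𝓡∂ n) (boundaryCoord n e) x = 0 := by
        rw [sub_smul, one_smul, ← e2, sub_self]
      rcases smul_eq_zero.1 this with h | h
      · linarith
      · exact absurd h hne
    have hq0 : q x ≠ 0 := by rintro h; rw [h, mul_zero] at e3; exact zero_ne_one e3
    refine lt_of_le_of_ne ?_ hq0.symm
    obtain ⟨γ, hγ, hγp⟩ := exists_tendsto_interior hx.1
    have hlim : Tendsto (fun t => q (γ t)) (𝓝[>] 0) (𝓝 (q x)) :=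
      ((hq.continuousOn.continuousAt (hU.mem_nhds hx)).tendsto.comp hγ)
    refine ge_of_tendsto hlim ?_
    filter_upwards [hγp, hγ.eventually (hU.mem_nhds hx)] with t ht ht'
    have e4 := h _ ht'
    have e5 := boundaryCoord_nonneg e' (γ t)
    rw [e4] at e5
    exact nonneg_of_mul_nonneg_left e5 ht.2
  · -- interior point
    have e4 := h x hx
    have hnb : boundaryCoord n e' x ≠ 0 := fun h1 =>
      h0.ne' ((mem_boundary_iff he hx.1).1 ((mem_boundary_iff he' hx.2).2 h1))
    have e5 := (boundaryCoord_nonneg e' x).lt_of_ne hnb.symm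
    rw [e4] at e5
    exact pos_of_mul_pos_left e5 h0.le

/-- In a chart, the normal coordinate is a positive multiple of the preferred one, and changes by
the ratio of the coordinate functions. -/
theorem normalDeriv_boundaryCoord {e : OpenPartialHomeomorph X (EuclideanHalfSpace n)}
    (he : e ∈ atlas (EuclideanHalfSpace n) X) {x : X} (hx : x ∈ e.source)
    (hb : x ∈ (𝓡∂ n).boundary X) :
    ∃ k : ℝ, 0 < k ∧ mvfderiv (𝓡∂ n) (boundaryCoord n e) x = k • boundaryForm n x ∧
      normalDeriv n (boundaryCoord n e) x = k • normalCoord n x := by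
  obtain ⟨q, -, h, hd⟩ := exists_ratio (chart_mem_atlas (EuclideanHalfSpace n) x) he
  have := hd x ⟨mem_chart_source _ x, hx⟩ hb
  exact ⟨q x, (h x ⟨mem_chart_source _ x, hx⟩).1, this, normalDeriv_eq_smul this⟩

end Hadamard

section Definitions
variable (n : ℕ) [NeZero n] (X : Type u) [TopologicalSpace X]
  [ChartedSpace (EuclideanHalfSpace n) X]

/-- The groupoid `Γ(X)` of a manifold with boundary: the pairs of interior points, together with
the inward preserving isomorphisms `N_y → N_x` of normal spaces, for `x` and `y` in the same
connected component of the boundary. -/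
inductive BGroupoid : Type u
  | interior (x y : X) (hx : x ∈ (𝓡∂ n).interior X) (hy : y ∈ (𝓡∂ n).interior X)
  | boundary (x y : X) (h : SameBoundaryComponent n x y)
      (α : NormalSpace n y ≃ₗ[ℝ] NormalSpace n x)
      (hα : ∀ v, 0 ≤ normalCoord n y v → 0 ≤ normalCoord n x (α v))

variable {X}

/-- The fibre at `(x, y)` of the inward pointing part of the spherical normal bundle of
`∂X × ∂X` in `X × X`: the rays of `N_x × N_y = T_{(x,y)}(X × X) / T_{(x,y)}(∂X × ∂X)` which consist
of pairs of inward pointing vectors. -/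
abbrev InwardRay (x y : X) : Type :=
  {R : Module.Ray ℝ (NormalSpace n x × NormalSpace n y) //
    ∃ (v : NormalSpace n x × NormalSpace n y) (hv : v ≠ 0),
      0 ≤ normalCoord n x v.1 ∧ 0 ≤ normalCoord n y v.2 ∧ R = rayOfNeZero ℝ v hv}

variable (X)

/-- The `b`-stretched product `X_b^2`: the products `C × C` of the boundary components `C` of `X`
are removed from `X × X` and replaced by the inward pointing part of their spherical normal
bundle. -/
inductive BStretchedProduct : Type u
  | off (x y : X) (h : ¬ SameBoundaryComponent n x y)
  | front (x y : X) (h : SameBoundaryComponent n x y) (R : InwardRay n x y)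

variable {n X}

/-- The range map. -/
def BGroupoid.r : BGroupoid n X → X
  | .interior x _ _ _ => x
  | .boundary x _ _ _ _ => x

/-- The source map. -/
def BGroupoid.s : BGroupoid n X → X
  | .interior _ y _ _ => y
  | .boundary _ y _ _ _ => y

/-- The dilation factor: `ρ₁(x) / ρ₂(y)` at a pair `(x, y)` of interior points, and for functions
vanishing at the boundary points `x` and `y`, the factor `λ` such that `dρ₁ ∘ α = λ dρ₂` at
`α : N_y → N_x`. For functions not vanishing at `x` and `y`, it is `ρ₁(x) / ρ₂(y)`. -/
noncomputable def BGroupoid.dilation (ρ₁ ρ₂ : X → ℝ) : BGroupoid n X → ℝ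
  | .interior x y _ _ => ρ₁ x / ρ₂ y
  | .boundary x y _ α _ =>
      leadingCoeff n ρ₁ x (α (inwardUnit n y)) / leadingCoeff n ρ₂ y (inwardUnit n y)

/-- The blow-down map `X_b^2 → X × X`. -/
def BStretchedProduct.blowDown : BStretchedProduct n X → X × X
  | .off x y _ => (x, y)
  | .front x y _ _ => (x, y)

/-- Homogeneous coordinates: `(ρ₁(x), ρ₂(y))` at a point `(x, y)` off the front face, and for
functions vanishing at the boundary points `x` and `y`, the pair `(dρ₁ v, dρ₂ w)` at the ray of
`(v, w)`; the latter is well defined up to a positive factor. For functions not vanishing at `x` and `y`, it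
is `(ρ₁(x), ρ₂(y))` everywhere. -/
noncomputable def BStretchedProduct.hom (ρ₁ ρ₂ : X → ℝ) : BStretchedProduct n X → ℝ × ℝ
  | .off x y _ => (ρ₁ x, ρ₂ y)
  | .front x y _ R =>
      (leadingCoeff n ρ₁ x R.1.someVector.1, leadingCoeff n ρ₂ y R.1.someVector.2)

theorem ray_boundary_ne_zero {x y : X} (α : NormalSpace n y ≃ₗ[ℝ] NormalSpace n x)
    {v : NormalSpace n y} (hv : v ≠ 0) : ((α v, v) : NormalSpace n x × NormalSpace n y) ≠ 0 :=
  fun h => hv (congrArg Prod.snd h)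

/-- The point of the half-space with the first coordinate of `a` replaced by `s`
(by `0` if `s` is negative). -/
noncomputable def setCoord (a : EuclideanHalfSpace n) (s : ℝ) : EuclideanHalfSpace n :=
  (𝓡∂ n).symm (a.1 + (s - a.1 0) • EuclideanSpace.single (0 : Fin n) (1 : ℝ))

/-- The three kinds of charts of `X_b^2`. -/
inductive ChartKind
  | product
  | left
  | right

/-- The coordinates of the blow-up in a pair of charts `e₁`, `e₂` of `X`, with `x₁` and `y₁` the
first coordinates of `x` in `e₁` and of `y` in `e₂`: the product coordinates, the projective
coordinates `x₁ / y₁`, `y₁` and the projective coordinates `x₁`, `y₁ / x₁`. The other coordinates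
are those of `x` and `y`. -/
noncomputable def BStretchedProduct.coords (k : ChartKind)
    (e₁ e₂ : OpenPartialHomeomorph X (EuclideanHalfSpace n)) (p : BStretchedProduct n X) :
    ModelProd (EuclideanHalfSpace n) (EuclideanHalfSpace n) :=
  let h := p.hom (boundaryCoord n e₁) (boundaryCoord n e₂)
  match k with
  | .product => (e₁ p.blowDown.1, e₂ p.blowDown.2)
  | .left => (setCoord (e₁ p.blowDown.1) (h.1 / h.2), e₂ p.blowDown.2)
  | .right => (e₁ p.blowDown.1, setCoord (e₂ p.blowDown.2) (h.2 / h.1))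

/-- The domain of the coordinates of the blow-up in a pair of charts. -/
def BStretchedProduct.chartSource (k : ChartKind)
    (e₁ e₂ : OpenPartialHomeomorph X (EuclideanHalfSpace n)) : Set (BStretchedProduct n X) :=
  {p | p.blowDown.1 ∈ e₁.source ∧ p.blowDown.2 ∈ e₂.source ∧
    let h := p.hom (boundaryCoord n e₁) (boundaryCoord n e₂)
    match k with
    | .product => ¬ SameBoundaryComponent n p.blowDown.1 p.blowDown.2
    | .left => 0 < h.2
    | .right => 0 < h.1}

/-- The coordinates of `Γ(X)` in a pair of charts `e₁`, `e₂` of `X`: the dilation factor, the first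
coordinate of the source, and the other coordinates of the range and of the source. -/
noncomputable def BGroupoid.coords (e₁ e₂ : OpenPartialHomeomorph X (EuclideanHalfSpace n))
    (γ : BGroupoid n X) : ModelProd (EuclideanHalfSpace n) (EuclideanHalfSpace n) :=
  (setCoord (e₁ γ.r) (γ.dilation (boundaryCoord n e₁) (boundaryCoord n e₂)), e₂ γ.s)

/-- The domain of the coordinates of `Γ(X)` in a pair of charts. -/
def BGroupoid.chartSource (e₁ e₂ : OpenPartialHomeomorph X (EuclideanHalfSpace n)) :
    Set (BGroupoid n X) := {γ | γ.r ∈ e₁.source ∧ γ.s ∈ e₂.source}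

end Definitions

section Lemmas
variable {n : ℕ} [NeZero n] {X : Type u} [TopologicalSpace X]
  [ChartedSpace (EuclideanHalfSpace n) X]

theorem SameBoundaryComponent.symm {x y : X} (h : SameBoundaryComponent n x y) :
    SameBoundaryComponent n y x := by
  obtain ⟨hx, hy, h⟩ := h
  exact ⟨hy, hx, h.symm⟩

theorem SameBoundaryComponent.trans {x y z : X} (h : SameBoundaryComponent n x y)
    (h' : SameBoundaryComponent n y z) : SameBoundaryComponent n x z := by
  obtain ⟨hx, hy, h⟩ := h
  obtain ⟨_, hz, h'⟩ := h'
  exact ⟨hx, hz, h.trans h'⟩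

theorem model_symm_val {v : EuclideanSpace ℝ (Fin n)} (hv : 0 ≤ v 0) : ((𝓡∂ n).symm v).1 = v :=
  (𝓡∂ n).right_inv (by rw [range_modelWithCornersEuclideanHalfSpace]; exact hv)

theorem setCoord_val (a : EuclideanHalfSpace n) {s : ℝ} (hs : 0 ≤ s) :
    (setCoord a s).1 = a.1 + (s - a.1 0) • EuclideanSpace.single (0 : Fin n) (1 : ℝ) :=
  model_symm_val (by simpa using hs)

theorem setCoord_zero (a : EuclideanHalfSpace n) {s : ℝ} (hs : 0 ≤ s) :
    (setCoord a s).1 0 = s := by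
  rw [setCoord_val a hs]; simp

theorem setCoord_setCoord (a : EuclideanHalfSpace n) {s t : ℝ} (hs : 0 ≤ s) :
    setCoord (setCoord a s) t = setCoord a t := by
  have h : (setCoord a s).1 + (t - (setCoord a s).1 0) • EuclideanSpace.single (0 : Fin n) (1 : ℝ) =
    a.1 + (t - a.1 0) • EuclideanSpace.single (0 : Fin n) (1 : ℝ) := by
    rw [setCoord_zero a hs, setCoord_val a hs, add_assoc, ← add_smul]; congr 2; ring
  rw [setCoord, h]; rfl

theorem setCoord_self (a : EuclideanHalfSpace n) : setCoord a (a.1 0) = a := by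
  rw [setCoord, sub_self, zero_smul, add_zero]
  exact (𝓡∂ n).left_inv a

theorem continuous_setCoord {Z : Type*} [TopologicalSpace Z] {f : Z → EuclideanHalfSpace n}
    {g : Z → ℝ} (hf : Continuous f) (hg : Continuous g) :
    Continuous fun z => setCoord (f z) (g z) := by
  have h1 : Continuous fun z => (f z).1 := continuous_subtype_val.comp hf
  have h2 : Continuous fun z => (f z).1 0 :=
    (EuclideanSpace.proj (𝕜 := ℝ) (0 : Fin n)).continuous.comp h1
  exact (𝓡∂ n).continuous_symm.comp (h1.add ((hg.sub h2).smul continuous_const))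

theorem someVector_eq {x y : X} (v : NormalSpace n x × NormalSpace n y) (hv : v ≠ 0) :
    ∃ t : ℝ, 0 < t ∧ (rayOfNeZero ℝ v hv).someVector = t • v := by
  have h := (rayOfNeZero ℝ v hv).someVector_ray
  rw [ray_eq_iff] at h
  obtain ⟨r₁, r₂, h1, h2, h3⟩ := h.exists_pos (Module.Ray.someVector_ne_zero _) hv
  refine ⟨r₁⁻¹ * r₂, by positivity, ?_⟩
  rw [mul_smul, ← h3, smul_smul, inv_mul_cancel₀ h1.ne', one_smul]

variable [IsManifold (𝓡∂ n) ∞ X]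

/-- Near a boundary point, the boundary is contained in the component of that point. -/
theorem eventually_sameBoundaryComponent {x : X} (hx : x ∈ (𝓡∂ n).boundary X) :
    ∀ᶠ z in 𝓝 x, z ∈ (𝓡∂ n).boundary X → SameBoundaryComponent n x z := by
  set e := chartAt (EuclideanHalfSpace n) x with hed
  have he : e ∈ atlas (EuclideanHalfSpace n) X := chart_mem_atlas _ x
  have hxe : x ∈ e.source := mem_chart_source _ x
  have hO : IsOpen ((𝓡∂ n).symm ⁻¹' e.target) := e.open_target.preimage (𝓡∂ n).continuous_symm
  have hin : ∀ z ∈ e.source, (e z).1 ∈ (𝓡∂ n).symm ⁻¹' e.target := by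
    intro z hz
    have : (𝓡∂ n).symm (e z).1 = e z := (𝓡∂ n).left_inv _
    rw [mem_preimage, this]; exact e.map_source hz
  obtain ⟨r, hr, hball⟩ := Metric.isOpen_iff.1 hO _ (hin x hxe)
  set S : Set (EuclideanSpace ℝ (Fin n)) := Metric.ball (e x).1 r ∩ {v | v 0 = 0} with hS
  have hconv : Convex ℝ S := by
    refine (convex_ball _ _).inter ?_
    exact (convex_singleton (0 : ℝ)).linear_preimage
      (EuclideanSpace.proj (𝕜 := ℝ) (0 : Fin n) : EuclideanSpace ℝ (Fin n) →L[ℝ] ℝ).toLinearMap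
  have hSb : ∀ v : S, e.symm ((𝓡∂ n).symm v.1) ∈ (𝓡∂ n).boundary X := by
    intro v
    have ht := hball v.2.1
    rw [mem_boundary_iff he (e.map_target ht), boundaryCoord, e.right_inv ht,
      model_symm_val (le_of_eq v.2.2.symm)]
    exact v.2.2
  set f : S → (𝓡∂ n).boundary X := fun v => ⟨e.symm ((𝓡∂ n).symm v.1), hSb v⟩ with hf
  have hfc : Continuous f := by
    refine Continuous.subtype_mk ?_ _
    have := e.continuousOn_symm.comp_continuous
      ((𝓡∂ n).continuous_symm.comp (continuous_subtype_val (p := fun v => v ∈ S)))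
      (fun v => hball v.2.1)
    exact this
  have : PreconnectedSpace S := isPreconnected_iff_preconnectedSpace.1 hconv.isPreconnected
  have hpre : IsPreconnected (range f) := isPreconnected_range hfc
  have hmem : ∀ z ∈ e.source, ∀ hz : z ∈ (𝓡∂ n).boundary X, dist (e z).1 (e x).1 < r →
      (⟨z, hz⟩ : (𝓡∂ n).boundary X) ∈ range f := by
    intro z hz hzb hd
    refine ⟨⟨(e z).1, hd, (mem_boundary_iff he hz).1 hzb⟩, ?_⟩
    refine Subtype.ext ?_
    have : (𝓡∂ n).symm (e z).1 = e z := (𝓡∂ n).left_inv _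
    simp only [hf, this]
    exact e.left_inv hz
  have hnear : ∀ᶠ z in 𝓝 x, dist (e z).1 (e x).1 < r := by
    have hc : ContinuousAt (fun z => (e z).1) x :=
      continuous_subtype_val.continuousAt.comp (e.continuousAt hxe)
    exact hc.eventually (Metric.ball_mem_nhds _ hr)
  filter_upwards [hnear, e.open_source.mem_nhds hxe] with z hz hze hzb
  refine ⟨hx, hzb, ?_⟩
  rw [ConnectedComponents.coe_eq_coe']
  exact hpre.subset_connectedComponent (hmem z hze hzb hz) (hmem x hxe hx (by simpa using hr))

/-- Not lying in a common boundary component is an open condition. -/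
theorem eventually_not_sameBoundaryComponent {x y : X} (h : ¬ SameBoundaryComponent n x y) :
    ∀ᶠ p : X × X in 𝓝 x ×ˢ 𝓝 y, ¬ SameBoundaryComponent n p.1 p.2 := by
  have hcl : IsClosed ((𝓡∂ n).boundary X) := (𝓡∂ n).isClosed_boundary (n := ∞) (by simp)
  by_cases hx : x ∈ (𝓡∂ n).boundary X
  · by_cases hy : y ∈ (𝓡∂ n).boundary X
    · filter_upwards [(eventually_sameBoundaryComponent hx).prod_mk
        (eventually_sameBoundaryComponent hy)] with p hp hs
      exact h (((hp.1 hs.1).trans hs).trans (hp.2 hs.2.1).symm)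
    · have := hcl.isOpen_compl.mem_nhds hy
      filter_upwards [tendsto_snd.eventually this] with p hp hs using hp hs.2.1
  · have := hcl.isOpen_compl.mem_nhds hx
    filter_upwards [tendsto_fst.eventually this] with p hp hs using hp hs.1

theorem SameBoundaryComponent.refl {x : X} (hx : x ∈ (𝓡∂ n).boundary X) :
    SameBoundaryComponent n x x := ⟨hx, hx, rfl⟩

end Lemmas

section Charts
variable {n : ℕ} [NeZero n] {X : Type u} [TopologicalSpace X]
  [ChartedSpace (EuclideanHalfSpace n) X]

/-- The homogeneous coordinates as a function of the coordinates. -/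
def ChartKind.homOf (k : ChartKind)
    (m : ModelProd (EuclideanHalfSpace n) (EuclideanHalfSpace n)) : ℝ × ℝ :=
  match k with
  | .product => (m.1.1 0, m.2.1 0)
  | .left => (m.1.1 0, 1)
  | .right => (1, m.2.1 0)

/-- The blow-down map in coordinates. -/
noncomputable def ChartKind.baseOf (k : ChartKind)
    (m : ModelProd (EuclideanHalfSpace n) (EuclideanHalfSpace n)) :
    EuclideanHalfSpace n × EuclideanHalfSpace n :=
  match k with
  | .product => (m.1, m.2)
  | .left => (setCoord m.1 (m.1.1 0 * m.2.1 0), m.2)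
  | .right => (m.1, setCoord m.2 (m.1.1 0 * m.2.1 0))

/-- The condition on the boundary components in coordinates. -/
def ChartKind.cond (k : ChartKind) (e₁ e₂ : OpenPartialHomeomorph X (EuclideanHalfSpace n))
    (m : ModelProd (EuclideanHalfSpace n) (EuclideanHalfSpace n)) : Prop :=
  let S := SameBoundaryComponent n (e₁.symm (k.baseOf m).1) (e₂.symm (k.baseOf m).2)
  match k with
  | .product => ¬ S
  | .left => m.2.1 0 = 0 → S
  | .right => m.1.1 0 = 0 → S

/-- The image under the coordinates of type `k` in `e₁`, `e₂` of the intersection of the domain with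
the domain of the coordinates of type `k'` in `e₁'`, `e₂'`. -/
def overlap (k k' : ChartKind) (e₁ e₂ e₁' e₂' : OpenPartialHomeomorph X (EuclideanHalfSpace n)) :
    Set (ModelProd (EuclideanHalfSpace n) (EuclideanHalfSpace n)) :=
  {m | ((k.baseOf m).1 ∈ e₁.target ∧ (k.baseOf m).2 ∈ e₂.target) ∧
    (e₁.symm (k.baseOf m).1 ∈ e₁'.source ∧ e₂.symm (k.baseOf m).2 ∈ e₂'.source) ∧
    k.cond e₁ e₂ m ∧
    match k' with
    | .product =>
        ¬ SameBoundaryComponent n (e₁.symm (k.baseOf m).1) (e₂.symm (k.baseOf m).2)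
    | .left => 0 < (k.homOf m).2
    | .right => 0 < (k.homOf m).1}

theorem continuous_baseOf (k : ChartKind) : Continuous (k.baseOf (n := n)) := by
  have p0 : Continuous fun a : EuclideanHalfSpace n => a.1 0 :=
    (EuclideanSpace.proj (𝕜 := ℝ) (0 : Fin n)).continuous.comp continuous_subtype_val
  cases k
  · exact continuous_id
  · exact (continuous_setCoord continuous_fst
      ((p0.comp continuous_fst).mul (p0.comp continuous_snd))).prodMk continuous_snd
  · exact continuous_fst.prodMk (continuous_setCoord continuous_snd
      ((p0.comp continuous_fst).mul (p0.comp continuous_snd)))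

theorem continuous_homOf (k : ChartKind) : Continuous (k.homOf (n := n)) := by
  have p0 : Continuous fun a : EuclideanHalfSpace n => a.1 0 :=
    (EuclideanSpace.proj (𝕜 := ℝ) (0 : Fin n)).continuous.comp continuous_subtype_val
  cases k
  · exact (p0.comp continuous_fst).prodMk (p0.comp continuous_snd)
  · exact (p0.comp continuous_fst).prodMk continuous_const
  · exact continuous_const.prodMk (p0.comp continuous_snd)

variable [IsManifold (𝓡∂ n) ∞ X]

theorem inwardUnit_ne_zero (x : X) : inwardUnit n x ≠ 0 := by
  intro h
  have := normalCoord_inwardUnit (n := n) x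
  rw [h, map_zero] at this
  exact zero_ne_one this

theorem leadingCoeff_boundaryCoord {e : OpenPartialHomeomorph X (EuclideanHalfSpace n)}
    (he : e ∈ atlas (EuclideanHalfSpace n) X) {x : X} (hx : x ∈ e.source)
    (hb : x ∈ (𝓡∂ n).boundary X) :
    ∃ k : ℝ, 0 < k ∧ ∀ v, leadingCoeff n (boundaryCoord n e) x v = k * normalCoord n x v := by
  obtain ⟨k, hk, -, h⟩ := normalDeriv_boundaryCoord he hx hb
  refine ⟨k, hk, fun v => ?_⟩
  rw [leadingCoeff, if_pos ((mem_boundary_iff he hx).1 hb), h]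
  rfl

theorem exists_leadingCoeff_ratio {e e' : OpenPartialHomeomorph X (EuclideanHalfSpace n)}
    (he : e ∈ atlas (EuclideanHalfSpace n) X) (he' : e' ∈ atlas (EuclideanHalfSpace n) X) :
    ∃ q : X → ℝ, ContMDiffOn (𝓡∂ n) 𝓘(ℝ, ℝ) ∞ q (e.source ∩ e'.source) ∧
      (∀ x ∈ e.source ∩ e'.source, 0 < q x ∧ boundaryCoord n e' x = q x * boundaryCoord n e x) ∧
      ∀ x ∈ e.source ∩ e'.source, x ∈ (𝓡∂ n).boundary X → ∀ v,
        leadingCoeff n (boundaryCoord n e') x v = q x * leadingCoeff n (boundaryCoord n e) x v := by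
  obtain ⟨q, hq, h, hd⟩ := exists_ratio he he'
  refine ⟨q, hq, h, fun x hx hb v => ?_⟩
  obtain ⟨k, -, hk, hk'⟩ := normalDeriv_boundaryCoord he hx.1 hb
  have h1 := hd x hx hb
  rw [hk, smul_smul] at h1
  rw [leadingCoeff, if_pos ((mem_boundary_iff he' hx.2).1 hb), leadingCoeff,
    if_pos ((mem_boundary_iff he hx.1).1 hb), hk', normalDeriv_eq_smul h1, mul_smul]
  rfl

variable {e₁ e₂ e₁' e₂' : OpenPartialHomeomorph X (EuclideanHalfSpace n)}

/-- Homogeneous coordinates are nonnegative and, off the removed corners, not both zero. -/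
theorem hom_front (he₁ : e₁ ∈ atlas (EuclideanHalfSpace n) X)
    (he₂ : e₂ ∈ atlas (EuclideanHalfSpace n) X) {x y : X} (h : SameBoundaryComponent n x y)
    (hx : x ∈ e₁.source) (hy : y ∈ e₂.source) (R : InwardRay n x y) :
    boundaryCoord n e₁ x = 0 ∧ boundaryCoord n e₂ y = 0 ∧
    ∃ k₁ k₂ : ℝ, 0 < k₁ ∧ 0 < k₂ ∧
      (∀ v, leadingCoeff n (boundaryCoord n e₁) x v = k₁ * normalCoord n x v) ∧
      (∀ v, leadingCoeff n (boundaryCoord n e₂) y v = k₂ * normalCoord n y v) ∧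
      0 ≤ normalCoord n x R.1.someVector.1 ∧ 0 ≤ normalCoord n y R.1.someVector.2 := by
  obtain ⟨hxb, hyb, -⟩ := h
  refine ⟨(mem_boundary_iff he₁ hx).1 hxb, (mem_boundary_iff he₂ hy).1 hyb, ?_⟩
  obtain ⟨k₁, hk₁, h1⟩ := leadingCoeff_boundaryCoord he₁ hx hxb
  obtain ⟨k₂, hk₂, h2⟩ := leadingCoeff_boundaryCoord he₂ hy hyb
  obtain ⟨R, v, hv, hv1, hv2, rfl⟩ := R
  obtain ⟨t, ht, h3⟩ := someVector_eq v hv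
  refine ⟨k₁, k₂, hk₁, hk₂, h1, h2, ?_, ?_⟩
  · change 0 ≤ normalCoord n x (rayOfNeZero ℝ v hv).someVector.1
    rw [h3, Prod.smul_fst, map_smul]; exact mul_nonneg ht.le hv1
  · change 0 ≤ normalCoord n y (rayOfNeZero ℝ v hv).someVector.2
    rw [h3, Prod.smul_snd, map_smul]; exact mul_nonneg ht.le hv2

theorem hom_nonneg (he₁ : e₁ ∈ atlas (EuclideanHalfSpace n) X)
    (he₂ : e₂ ∈ atlas (EuclideanHalfSpace n) X) (p : BStretchedProduct n X)
    (hx : p.blowDown.1 ∈ e₁.source) (hy : p.blowDown.2 ∈ e₂.source) :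
    0 ≤ (p.hom (boundaryCoord n e₁) (boundaryCoord n e₂)).1 ∧
    0 ≤ (p.hom (boundaryCoord n e₁) (boundaryCoord n e₂)).2 := by
  cases p with
  | off x y h => exact ⟨boundaryCoord_nonneg _ _, boundaryCoord_nonneg _ _⟩
  | front x y h R =>
    obtain ⟨-, -, k₁, k₂, hk₁, hk₂, h1, h2, h3, h4⟩ := hom_front he₁ he₂ h hx hy R
    refine ⟨?_, ?_⟩
    · change 0 ≤ leadingCoeff n _ x _
      rw [h1]; positivity
    · change 0 ≤ leadingCoeff n _ y _
      rw [h2]; positivity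

/-- Homogeneous coordinates are proportional to the boundary coordinates. -/
theorem hom_mul (he₁ : e₁ ∈ atlas (EuclideanHalfSpace n) X)
    (he₂ : e₂ ∈ atlas (EuclideanHalfSpace n) X) (p : BStretchedProduct n X)
    (hx : p.blowDown.1 ∈ e₁.source) (hy : p.blowDown.2 ∈ e₂.source) :
    (p.hom (boundaryCoord n e₁) (boundaryCoord n e₂)).1 * boundaryCoord n e₂ p.blowDown.2 =
    (p.hom (boundaryCoord n e₁) (boundaryCoord n e₂)).2 * boundaryCoord n e₁ p.blowDown.1 := by
  cases p with
  | off x y h => exact mul_comm _ _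
  | front x y h R =>
    obtain ⟨h1, h2, -⟩ := hom_front he₁ he₂ h hx hy R
    change _ * boundaryCoord n e₂ y = _ * boundaryCoord n e₁ x
    rw [h1, h2, mul_zero, mul_zero]

theorem hom_change (he₁ : e₁ ∈ atlas (EuclideanHalfSpace n) X)
    (he₂ : e₂ ∈ atlas (EuclideanHalfSpace n) X) (he₁' : e₁' ∈ atlas (EuclideanHalfSpace n) X)
    (he₂' : e₂' ∈ atlas (EuclideanHalfSpace n) X) :
    ∃ q₁ q₂ : X → ℝ, ContMDiffOn (𝓡∂ n) 𝓘(ℝ, ℝ) ∞ q₁ (e₁.source ∩ e₁'.source) ∧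
      ContMDiffOn (𝓡∂ n) 𝓘(ℝ, ℝ) ∞ q₂ (e₂.source ∩ e₂'.source) ∧
      (∀ x ∈ e₁.source ∩ e₁'.source, 0 < q₁ x) ∧ (∀ x ∈ e₂.source ∩ e₂'.source, 0 < q₂ x) ∧
      ∀ p : BStretchedProduct n X, p.blowDown.1 ∈ e₁.source ∩ e₁'.source →
        p.blowDown.2 ∈ e₂.source ∩ e₂'.source →
        p.hom (boundaryCoord n e₁') (boundaryCoord n e₂') =
          (q₁ p.blowDown.1 * (p.hom (boundaryCoord n e₁) (boundaryCoord n e₂)).1,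
           q₂ p.blowDown.2 * (p.hom (boundaryCoord n e₁) (boundaryCoord n e₂)).2) := by
  obtain ⟨q₁, hq₁, h1, h1'⟩ := exists_leadingCoeff_ratio he₁ he₁'
  obtain ⟨q₂, hq₂, h2, h2'⟩ := exists_leadingCoeff_ratio he₂ he₂'
  refine ⟨q₁, q₂, hq₁, hq₂, fun x hx => (h1 x hx).1, fun x hx => (h2 x hx).1, ?_⟩
  intro p hx hy
  cases p with
  | off x y h => exact Prod.ext (h1 x hx).2 (h2 y hy).2
  | front x y h R => exact Prod.ext (h1' x hx h.1 _) (h2' y hy h.2.1 _)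

/-- The coordinates of a point determine its projection, its homogeneous coordinates and the
condition on boundary components. -/
theorem coords_spec (he₁ : e₁ ∈ atlas (EuclideanHalfSpace n) X)
    (he₂ : e₂ ∈ atlas (EuclideanHalfSpace n) X) (k : ChartKind) (p : BStretchedProduct n X)
    (hp : p ∈ BStretchedProduct.chartSource k e₁ e₂) :
    k.baseOf (p.coords k e₁ e₂) = (e₁ p.blowDown.1, e₂ p.blowDown.2) ∧
    (∃ t : ℝ, 0 < t ∧
      p.hom (boundaryCoord n e₁) (boundaryCoord n e₂) = t • k.homOf (p.coords k e₁ e₂)) ∧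
    k.cond e₁ e₂ (p.coords k e₁ e₂) := by
  obtain ⟨hx, hy, hk⟩ := hp
  have h0 := hom_nonneg he₁ he₂ p hx hy
  have hm := hom_mul he₁ he₂ p hx hy
  set h := p.hom (boundaryCoord n e₁) (boundaryCoord n e₂) with hh
  have hbase : k.baseOf (p.coords k e₁ e₂) = (e₁ p.blowDown.1, e₂ p.blowDown.2) := by
    cases k with
    | product => rfl
    | left =>
      have hk : 0 < h.2 := hk
      have hq : 0 ≤ h.1 / h.2 := div_nonneg h0.1 h0.2
      refine Prod.ext ?_ rfl
      change setCoord (setCoord (e₁ p.blowDown.1) (h.1 / h.2))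
        ((setCoord (e₁ p.blowDown.1) (h.1 / h.2)).1 0 * (e₂ p.blowDown.2).1 0) = _
      rw [setCoord_setCoord _ hq, setCoord_zero _ hq]
      have : h.1 / h.2 * (e₂ p.blowDown.2).1 0 = (e₁ p.blowDown.1).1 0 := by
        change h.1 / h.2 * boundaryCoord n e₂ p.blowDown.2 = boundaryCoord n e₁ p.blowDown.1
        field_simp
        rw [hm]
      rw [this, setCoord_self]
    | right =>
      have hk : 0 < h.1 := hk
      have hq : 0 ≤ h.2 / h.1 := div_nonneg h0.2 h0.1
      refine Prod.ext rfl ?_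
      change setCoord (setCoord (e₂ p.blowDown.2) (h.2 / h.1))
        ((e₁ p.blowDown.1).1 0 * (setCoord (e₂ p.blowDown.2) (h.2 / h.1)).1 0) = _
      rw [setCoord_setCoord _ hq, setCoord_zero _ hq]
      have : (e₁ p.blowDown.1).1 0 * (h.2 / h.1) = (e₂ p.blowDown.2).1 0 := by
        change boundaryCoord n e₁ p.blowDown.1 * (h.2 / h.1) = boundaryCoord n e₂ p.blowDown.2
        field_simp
        rw [mul_comm, ← hm, mul_comm]
      rw [this, setCoord_self]
  refine ⟨hbase, ?_, ?_⟩
  · cases k with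
    | product =>
      refine ⟨1, one_pos, ?_⟩
      cases p with
      | off x y hn => rw [one_smul]; rfl
      | front x y hs R => exact absurd hs hk
    | left =>
      have hk : 0 < h.2 := hk
      have hq : 0 ≤ h.1 / h.2 := div_nonneg h0.1 h0.2
      refine ⟨h.2, hk, ?_⟩
      change h = h.2 • ((setCoord (e₁ p.blowDown.1) (h.1 / h.2)).1 0, (1 : ℝ))
      rw [setCoord_zero _ hq]
      refine Prod.ext ?_ ?_
      · change h.1 = h.2 * (h.1 / h.2); field_simp
      · change h.2 = h.2 * 1; ring
    | right =>
      have hk : 0 < h.1 := hk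
      have hq : 0 ≤ h.2 / h.1 := div_nonneg h0.2 h0.1
      refine ⟨h.1, hk, ?_⟩
      change h = h.1 • ((1 : ℝ), (setCoord (e₂ p.blowDown.2) (h.2 / h.1)).1 0)
      rw [setCoord_zero _ hq]
      refine Prod.ext ?_ ?_
      · change h.1 = h.1 * 1; ring
      · change h.2 = h.1 * (h.2 / h.1); field_simp
  · have hS : SameBoundaryComponent n (e₁.symm (k.baseOf (p.coords k e₁ e₂)).1)
        (e₂.symm (k.baseOf (p.coords k e₁ e₂)).2) ↔
        SameBoundaryComponent n p.blowDown.1 p.blowDown.2 := by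
      rw [hbase, e₁.left_inv hx, e₂.left_inv hy]
    cases k with
    | product => exact fun h' => hk (hS.1 h')
    | left =>
      intro h'
      have h' : boundaryCoord n e₂ p.blowDown.2 = 0 := h'
      refine hS.2 ?_
      cases p with
      | off x y hn => exact absurd h' hk.ne'
      | front x y hs R => exact hs
    | right =>
      intro h'
      have h' : boundaryCoord n e₁ p.blowDown.1 = 0 := h'
      refine hS.2 ?_
      cases p with
      | off x y hn => exact absurd h' hk.ne'
      | front x y hs R => exact hs

theorem coords_injOn (he₁ : e₁ ∈ atlas (EuclideanHalfSpace n) X)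
    (he₂ : e₂ ∈ atlas (EuclideanHalfSpace n) X) (k : ChartKind) :
    InjOn (BStretchedProduct.coords k e₁ e₂) (BStretchedProduct.chartSource k e₁ e₂) := by
  intro p hp p' hp' h
  obtain ⟨hb, ⟨t, ht, hh⟩, -⟩ := coords_spec he₁ he₂ k p hp
  obtain ⟨hb', ⟨t', ht', hh'⟩, -⟩ := coords_spec he₁ he₂ k p' hp'
  rw [← h, hb] at hb'
  rw [← h] at hh'
  have h1 : p.blowDown.1 = p'.blowDown.1 :=
    e₁.injOn hp.1 hp'.1 (congrArg Prod.fst hb')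
  have h2 : p.blowDown.2 = p'.blowDown.2 :=
    e₂.injOn hp.2.1 hp'.2.1 (congrArg Prod.snd hb')
  have hprop : p.hom (boundaryCoord n e₁) (boundaryCoord n e₂) =
      (t * t'⁻¹) • p'.hom (boundaryCoord n e₁) (boundaryCoord n e₂) := by
    rw [hh, hh', smul_smul, mul_assoc, inv_mul_cancel₀ ht'.ne', mul_one]
  cases p with
  | off x y hn =>
    cases p' with
    | off x' y' hn' =>
      have h1 : x = x' := h1
      have h2 : y = y' := h2
      subst h1; subst h2; rfl
    | front x' y' hs R =>
      have h1 : x = x' := h1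
      have h2 : y = y' := h2
      subst h1; subst h2; exact absurd hs hn
  | front x y hs R =>
    cases p' with
    | off x' y' hn' =>
      have h1 : x = x' := h1
      have h2 : y = y' := h2
      subst h1; subst h2; exact absurd hs hn'
    | front x' y' hs' R' =>
      obtain rfl : x = x' := h1
      obtain rfl : y = y' := h2
      congr 1
      obtain ⟨-, -, k₁, k₂, hk₁, hk₂, l1, l2, -⟩ := hom_front he₁ he₂ hs hp.1 hp.2.1 R
      refine Subtype.ext ?_
      rw [← R.1.someVector_ray, ← R'.1.someVector_ray, ray_eq_iff]
      have a1 := congrArg Prod.fst hprop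
      have a2 := congrArg Prod.snd hprop
      have b1 : normalCoord n x R.1.someVector.1 =
          (t * t'⁻¹) * normalCoord n x R'.1.someVector.1 := by
        change leadingCoeff n _ x _ = (t * t'⁻¹) * leadingCoeff n _ x _ at a1
        rw [l1, l1] at a1
        have : k₁ * (normalCoord n x R.1.someVector.1 -
          (t * t'⁻¹) * normalCoord n x R'.1.someVector.1) = 0 := by linarith
        rcases mul_eq_zero.1 this with h | h
        · exact absurd h hk₁.ne'
        · linarith
      have b2 : normalCoord n y R.1.someVector.2 =
          (t * t'⁻¹) * normalCoord n y R'.1.someVector.2 := by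
        change leadingCoeff n _ y _ = (t * t'⁻¹) * leadingCoeff n _ y _ at a2
        rw [l2, l2] at a2
        have : k₂ * (normalCoord n y R.1.someVector.2 -
          (t * t'⁻¹) * normalCoord n y R'.1.someVector.2) = 0 := by linarith
        rcases mul_eq_zero.1 this with h | h
        · exact absurd h hk₂.ne'
        · linarith
      have : R.1.someVector = (t * t'⁻¹) • R'.1.someVector := by
        refine Prod.ext ?_ ?_
        · apply normalCoord_injective
          rw [b1, Prod.smul_fst, map_smul]; rfl
        · apply normalCoord_injective
          rw [b2, Prod.smul_snd, map_smul]; rfl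
      rw [this]
      exact SameRay.sameRay_pos_smul_left _ (by positivity)

/-- A point of the front face with given normal coordinates. -/
theorem exists_front {x y : X} (h : SameBoundaryComponent n x y)
    (he₁ : e₁ ∈ atlas (EuclideanHalfSpace n) X)
    (he₂ : e₂ ∈ atlas (EuclideanHalfSpace n) X) (hx : x ∈ e₁.source) (hy : y ∈ e₂.source)
    {u v : ℝ} (hu : 0 ≤ u) (hv : 0 ≤ v) (huv : 0 < u ∨ 0 < v) :
    ∃ (R : InwardRay n x y) (t : ℝ), 0 < t ∧
      (BStretchedProduct.front x y h R).hom (boundaryCoord n e₁) (boundaryCoord n e₂)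
        = t • (u, v) := by
  obtain ⟨k₁, hk₁, h1⟩ := leadingCoeff_boundaryCoord he₁ hx h.1
  obtain ⟨k₂, hk₂, h2⟩ := leadingCoeff_boundaryCoord he₂ hy h.2.1
  set w : NormalSpace n x × NormalSpace n y :=
    ((u / k₁) • inwardUnit n x, (v / k₂) • inwardUnit n y) with hw
  have w1 : normalCoord n x w.1 = u / k₁ := by
    rw [hw, map_smul, normalCoord_inwardUnit, smul_eq_mul, mul_one]
  have w2 : normalCoord n y w.2 = v / k₂ := by
    rw [hw, map_smul, normalCoord_inwardUnit, smul_eq_mul, mul_one]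
  have hw0 : w ≠ 0 := by
    intro h0
    rw [h0] at w1 w2
    rcases huv with h | h
    · have : 0 < u / k₁ := by positivity
      rw [← w1] at this
      simp at this
    · have : 0 < v / k₂ := by positivity
      rw [← w2] at this
      simp at this
  obtain ⟨t, ht, hs⟩ := someVector_eq w hw0
  refine ⟨⟨rayOfNeZero ℝ w hw0, w, hw0, by rw [w1]; positivity, by rw [w2]; positivity, rfl⟩,
    t, ht, ?_⟩
  refine Prod.ext ?_ ?_
  · change leadingCoeff n _ x (rayOfNeZero ℝ w hw0).someVector.1 = t * u
    rw [h1, hs, Prod.smul_fst, map_smul, w1, smul_eq_mul]; field_simp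
  · change leadingCoeff n _ y (rayOfNeZero ℝ w hw0).someVector.2 = t * v
    rw [h2, hs, Prod.smul_snd, map_smul, w2, smul_eq_mul]; field_simp

theorem image_overlap (he₁ : e₁ ∈ atlas (EuclideanHalfSpace n) X)
    (he₂ : e₂ ∈ atlas (EuclideanHalfSpace n) X) (he₁' : e₁' ∈ atlas (EuclideanHalfSpace n) X)
    (he₂' : e₂' ∈ atlas (EuclideanHalfSpace n) X) (k k' : ChartKind) :
    BStretchedProduct.coords k e₁ e₂ '' (BStretchedProduct.chartSource k e₁ e₂ ∩
      BStretchedProduct.chartSource k' e₁' e₂') = overlap k k' e₁ e₂ e₁' e₂' := by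
  obtain ⟨q₁, q₂, -, -, hq₁, hq₂, hq⟩ := hom_change he₁ he₂ he₁' he₂'
  -- the condition of the second chart in terms of the first
  have hcond : ∀ p ∈ BStretchedProduct.chartSource k e₁ e₂,
      p.blowDown.1 ∈ e₁'.source → p.blowDown.2 ∈ e₂'.source →
      (p ∈ BStretchedProduct.chartSource k' e₁' e₂' ↔
        match k' with
        | .product => ¬ SameBoundaryComponent n (e₁.symm (k.baseOf (p.coords k e₁ e₂)).1)
            (e₂.symm (k.baseOf (p.coords k e₁ e₂)).2)
        | .left => 0 < (k.homOf (p.coords k e₁ e₂)).2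
        | .right => 0 < (k.homOf (p.coords k e₁ e₂)).1) := by
    intro p hp hx' hy'
    obtain ⟨hb, ⟨t, ht, hh⟩, -⟩ := coords_spec he₁ he₂ k p hp
    have hc := hq p ⟨hp.1, hx'⟩ ⟨hp.2.1, hy'⟩
    have p1 := hq₁ _ ⟨hp.1, hx'⟩
    have p2 := hq₂ _ ⟨hp.2.1, hy'⟩
    rw [hh] at hc
    cases k' with
    | product =>
      rw [hb, e₁.left_inv hp.1, e₂.left_inv hp.2.1]
      exact ⟨fun h => h.2.2, fun h => ⟨hx', hy', h⟩⟩
    | left =>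
      have : p ∈ BStretchedProduct.chartSource .left e₁' e₂' ↔
        0 < (p.hom (boundaryCoord n e₁') (boundaryCoord n e₂')).2 :=
        ⟨fun h => h.2.2, fun h => ⟨hx', hy', h⟩⟩
      rw [this, hc]
      change 0 < q₂ _ * (t * _) ↔ _
      rw [mul_pos_iff_of_pos_left p2, mul_pos_iff_of_pos_left ht]
    | right =>
      have : p ∈ BStretchedProduct.chartSource .right e₁' e₂' ↔
        0 < (p.hom (boundaryCoord n e₁') (boundaryCoord n e₂')).1 :=
        ⟨fun h => h.2.2, fun h => ⟨hx', hy', h⟩⟩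
      rw [this, hc]
      change 0 < q₁ _ * (t * _) ↔ _
      rw [mul_pos_iff_of_pos_left p1, mul_pos_iff_of_pos_left ht]
  apply Subset.antisymm
  · rintro _ ⟨p, ⟨hp, hp'⟩, rfl⟩
    obtain ⟨hb, -, hc⟩ := coords_spec he₁ he₂ k p hp
    refine ⟨?_, ?_, hc, (hcond p hp hp'.1 hp'.2.1).1 hp'⟩
    · rw [hb]; exact ⟨e₁.map_source hp.1, e₂.map_source hp.2.1⟩
    · rw [hb, e₁.left_inv hp.1, e₂.left_inv hp.2.1]; exact ⟨hp'.1, hp'.2.1⟩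
  · rintro m ⟨⟨ht1, ht2⟩, ⟨hs1, hs2⟩, hc, hk'⟩
    set x := e₁.symm (k.baseOf m).1 with hx
    set y := e₂.symm (k.baseOf m).2 with hy
    have hxs : x ∈ e₁.source := e₁.map_target ht1
    have hys : y ∈ e₂.source := e₂.map_target ht2
    have hex : e₁ x = (k.baseOf m).1 := e₁.right_inv ht1
    have hey : e₂ y = (k.baseOf m).2 := e₂.right_inv ht2
    have ha := m.1.2
    have hb := m.2.2
    have hab : 0 ≤ m.1.1 0 * m.2.1 0 := mul_nonneg ha hb
    -- it suffices to find a point in the first domain with the given coordinates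
    suffices H : ∃ p ∈ BStretchedProduct.chartSource k e₁ e₂, p.blowDown = (x, y) ∧
        p.coords k e₁ e₂ = m by
      obtain ⟨p, hp, hpb, hpm⟩ := H
      refine ⟨p, ⟨hp, ?_⟩, hpm⟩
      rw [hcond p hp (by rw [hpb]; exact hs1) (by rw [hpb]; exact hs2), hpm]
      exact hk'
    cases k with
    | product => exact ⟨.off x y hc, ⟨hxs, hys, hc⟩, rfl, Prod.ext hex hey⟩
    | left =>
      have fin : ∀ p : BStretchedProduct n X, p.blowDown = (x, y) →
          (∃ t : ℝ, 0 < t ∧ p.hom (boundaryCoord n e₁) (boundaryCoord n e₂) =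
            t • (m.1.1 0, (1 : ℝ))) →
          ∃ p ∈ BStretchedProduct.chartSource .left e₁ e₂, p.blowDown = (x, y) ∧
            p.coords .left e₁ e₂ = m := by
        rintro p hpb ⟨t, ht, hh⟩
        refine ⟨p, ⟨by rw [hpb]; exact hxs, by rw [hpb]; exact hys, ?_⟩, hpb, ?_⟩
        · change 0 < (p.hom _ _).2
          rw [hh]; change 0 < t * 1; linarith
        · change (setCoord (e₁ p.blowDown.1) ((p.hom _ _).1 / (p.hom _ _).2), e₂ p.blowDown.2) = m
          rw [hh, hpb]
          refine Prod.ext ?_ hey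
          change setCoord (e₁ x) (t * m.1.1 0 / (t * 1)) = m.1
          have : t * m.1.1 0 / (t * 1) = m.1.1 0 := by field_simp
          rw [hex, this]
          change setCoord (setCoord m.1 _) _ = _
          rw [setCoord_setCoord _ hab, setCoord_self]
      by_cases hS : SameBoundaryComponent n x y
      · obtain ⟨R, t, ht, hh⟩ := exists_front hS he₁ he₂ hxs hys ha zero_le_one (Or.inr one_pos)
        exact fin (.front x y hS R) rfl ⟨t, ht, hh⟩
      · have hb0 : m.2.1 0 ≠ 0 := fun h => hS (hc h)
        refine fin (.off x y hS) rfl ⟨m.2.1 0, lt_of_le_of_ne hb hb0.symm, ?_⟩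
        refine Prod.ext ?_ ?_
        · change (e₁ x).1 0 = m.2.1 0 * m.1.1 0
          rw [hex]
          change (setCoord m.1 _).1 0 = _
          rw [setCoord_zero _ hab, mul_comm]
        · change (e₂ y).1 0 = m.2.1 0 * 1
          rw [hey, mul_one]; rfl
    | right =>
      have fin : ∀ p : BStretchedProduct n X, p.blowDown = (x, y) →
          (∃ t : ℝ, 0 < t ∧ p.hom (boundaryCoord n e₁) (boundaryCoord n e₂) =
            t • ((1 : ℝ), m.2.1 0)) →
          ∃ p ∈ BStretchedProduct.chartSource .right e₁ e₂, p.blowDown = (x, y) ∧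
            p.coords .right e₁ e₂ = m := by
        rintro p hpb ⟨t, ht, hh⟩
        refine ⟨p, ⟨by rw [hpb]; exact hxs, by rw [hpb]; exact hys, ?_⟩, hpb, ?_⟩
        · change 0 < (p.hom _ _).1
          rw [hh]; change 0 < t * 1; linarith
        · change (e₁ p.blowDown.1, setCoord (e₂ p.blowDown.2) ((p.hom _ _).2 / (p.hom _ _).1)) = m
          rw [hh, hpb]
          refine Prod.ext hex ?_
          change setCoord (e₂ y) (t * m.2.1 0 / (t * 1)) = m.2
          have : t * m.2.1 0 / (t * 1) = m.2.1 0 := by field_simp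
          rw [hey, this]
          change setCoord (setCoord m.2 _) _ = _
          rw [setCoord_setCoord _ hab, setCoord_self]
      by_cases hS : SameBoundaryComponent n x y
      · obtain ⟨R, t, ht, hh⟩ := exists_front hS he₁ he₂ hxs hys zero_le_one hb (Or.inl one_pos)
        exact fin (.front x y hS R) rfl ⟨t, ht, hh⟩
      · have ha0 : m.1.1 0 ≠ 0 := fun h => hS (hc h)
        refine fin (.off x y hS) rfl ⟨m.1.1 0, lt_of_le_of_ne ha ha0.symm, ?_⟩
        refine Prod.ext ?_ ?_
        · change (e₁ x).1 0 = m.1.1 0 * 1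
          rw [hex, mul_one]; rfl
        · change (e₂ y).1 0 = m.1.1 0 * m.2.1 0
          rw [hey]
          change (setCoord m.2 _).1 0 = _
          rw [setCoord_zero _ hab]

theorem isOpen_overlap (he₁ : e₁ ∈ atlas (EuclideanHalfSpace n) X)
    (he₂ : e₂ ∈ atlas (EuclideanHalfSpace n) X) (k k' : ChartKind) :
    IsOpen (overlap k k' e₁ e₂ e₁' e₂') := by
  rw [isOpen_iff_mem_nhds]
  rintro m ⟨⟨ht1, ht2⟩, ⟨hs1, hs2⟩, hc, hk'⟩
  have hb := (continuous_baseOf (n := n) k).continuousAt (x := m)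
  have hb1 : ContinuousAt (fun m => (k.baseOf m).1) m := hb.fst
  have hb2 : ContinuousAt (fun m => (k.baseOf m).2) m := hb.snd
  have hx : ContinuousAt (fun m => e₁.symm (k.baseOf m).1) m :=
    ContinuousAt.comp (g := e₁.symm) (f := fun m => (k.baseOf m).1) (e₁.continuousAt_symm ht1) hb1
  have hy : ContinuousAt (fun m => e₂.symm (k.baseOf m).2) m :=
    ContinuousAt.comp (g := e₂.symm) (f := fun m => (k.baseOf m).2) (e₂.continuousAt_symm ht2) hb2
  have T1 := hb1.eventually (e₁.open_target.mem_nhds ht1)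
  have T2 := hb2.eventually (e₂.open_target.mem_nhds ht2)
  have S1 := hx.eventually (e₁'.open_source.mem_nhds hs1)
  have S2 := hy.eventually (e₂'.open_source.mem_nhds hs2)
  have hn : ¬ SameBoundaryComponent n (e₁.symm (k.baseOf m).1) (e₂.symm (k.baseOf m).2) →
      ∀ᶠ m' in 𝓝 m, ¬ SameBoundaryComponent n (e₁.symm (k.baseOf m').1)
        (e₂.symm (k.baseOf m').2) := by
    intro h
    exact (hx.tendsto.prodMk hy.tendsto).eventually (eventually_not_sameBoundaryComponent h)
  have hyes : SameBoundaryComponent n (e₁.symm (k.baseOf m).1) (e₂.symm (k.baseOf m).2) →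
      ∀ᶠ m' in 𝓝 m, e₁.symm (k.baseOf m').1 ∈ (𝓡∂ n).boundary X →
        e₂.symm (k.baseOf m').2 ∈ (𝓡∂ n).boundary X →
        SameBoundaryComponent n (e₁.symm (k.baseOf m').1) (e₂.symm (k.baseOf m').2) := by
    intro h
    filter_upwards [hx.tendsto.eventually (eventually_sameBoundaryComponent h.1),
      hy.tendsto.eventually (eventually_sameBoundaryComponent h.2.1)] with m' h1 h2 b1 b2
    exact (h1 b1).symm.trans (h.trans (h2 b2))
  have p0 : Continuous fun a : EuclideanHalfSpace n => a.1 0 :=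
    (EuclideanSpace.proj (𝕜 := ℝ) (0 : Fin n)).continuous.comp continuous_subtype_val
  have C1 : ∀ᶠ m' in 𝓝 m, k.cond e₁ e₂ m' := by
    cases k with
    | product => exact hn hc
    | left =>
      by_cases h0 : m.2.1 0 = 0
      · filter_upwards [hyes (hc h0), T1, T2] with m' h t1 t2 h0'
        refine h ?_ ?_
        · rw [mem_boundary_iff he₁ (e₁.map_target t1), boundaryCoord, e₁.right_inv t1]
          change (setCoord m'.1 (m'.1.1 0 * m'.2.1 0)).1 0 = 0
          rw [h0', mul_zero, setCoord_zero _ le_rfl]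
        · rw [mem_boundary_iff he₂ (e₂.map_target t2), boundaryCoord, e₂.right_inv t2]
          exact h0'
      · have : Continuous fun m : ModelProd (EuclideanHalfSpace n) (EuclideanHalfSpace n) =>
          m.2.1 0 := p0.comp continuous_snd
        filter_upwards [this.continuousAt.eventually_ne h0] with m' hm' h'
        exact absurd h' hm'
    | right =>
      by_cases h0 : m.1.1 0 = 0
      · filter_upwards [hyes (hc h0), T1, T2] with m' h t1 t2 h0'
        refine h ?_ ?_
        · rw [mem_boundary_iff he₁ (e₁.map_target t1), boundaryCoord, e₁.right_inv t1]
          exact h0'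
        · rw [mem_boundary_iff he₂ (e₂.map_target t2), boundaryCoord, e₂.right_inv t2]
          change (setCoord m'.2 (m'.1.1 0 * m'.2.1 0)).1 0 = 0
          rw [h0', zero_mul, setCoord_zero _ le_rfl]
      · have : Continuous fun m : ModelProd (EuclideanHalfSpace n) (EuclideanHalfSpace n) =>
          m.1.1 0 := p0.comp continuous_fst
        filter_upwards [this.continuousAt.eventually_ne h0] with m' hm' h'
        exact absurd h' hm'
  have C2 : ∀ᶠ m' in 𝓝 m, match k' with
      | .product => ¬ SameBoundaryComponent n (e₁.symm (k.baseOf m').1) (e₂.symm (k.baseOf m').2)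
      | .left => 0 < (k.homOf m').2
      | .right => 0 < (k.homOf m').1 := by
    cases k' with
    | product => exact hn hk'
    | left => exact (continuous_homOf k).snd.continuousAt.eventually (lt_mem_nhds hk')
    | right => exact (continuous_homOf k).fst.continuousAt.eventually (lt_mem_nhds hk')
  filter_upwards [T1, T2, S1, S2, C1, C2] with m' t1 t2 s1 s2 c1 c2
  exact ⟨⟨t1, t2⟩, ⟨s1, s2⟩, c1, c2⟩

end Charts

section Transitions
variable {n : ℕ} [NeZero n] {X : Type u} [TopologicalSpace X]
  [ChartedSpace (EuclideanHalfSpace n) X] [IsManifold (𝓡∂ n) ∞ X]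
  {e₁ e₂ e₁' e₂' : OpenPartialHomeomorph X (EuclideanHalfSpace n)}

/-- Changes of coordinates of the blow-up are smooth. -/
theorem exists_transition (he₁ : e₁ ∈ atlas (EuclideanHalfSpace n) X)
    (he₂ : e₂ ∈ atlas (EuclideanHalfSpace n) X) (he₁' : e₁' ∈ atlas (EuclideanHalfSpace n) X)
    (he₂' : e₂' ∈ atlas (EuclideanHalfSpace n) X) (k k' : ChartKind) :
    ∃ F : EuclideanSpace ℝ (Fin n) × EuclideanSpace ℝ (Fin n) →
        EuclideanSpace ℝ (Fin n) × EuclideanSpace ℝ (Fin n),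
      ContDiffOn ℝ ∞ F (((𝓡∂ n).prod (𝓡∂ n)).symm ⁻¹' overlap k k' e₁ e₂ e₁' e₂' ∩
        range ((𝓡∂ n).prod (𝓡∂ n))) ∧
      ∀ p ∈ BStretchedProduct.chartSource k e₁ e₂ ∩ BStretchedProduct.chartSource k' e₁' e₂',
        (𝓡∂ n).prod (𝓡∂ n) (p.coords k' e₁' e₂') = F ((𝓡∂ n).prod (𝓡∂ n) (p.coords k e₁ e₂)) := by
  obtain ⟨q₁, q₂, hq₁s, hq₂s, hq₁, hq₂, hq⟩ := hom_change he₁ he₂ he₁' he₂'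
  set e0 : EuclideanSpace ℝ (Fin n) := EuclideanSpace.single (0 : Fin n) (1 : ℝ) with he0
  let W := EuclideanSpace ℝ (Fin n) × EuclideanSpace ℝ (Fin n)
  have pr : ContDiff ℝ ∞ (fun v : EuclideanSpace ℝ (Fin n) => v 0) :=
    (EuclideanSpace.proj (𝕜 := ℝ) (0 : Fin n)).contDiff
  have pr1 : ContDiff ℝ ∞ (fun w : W => w.1 0) := pr.comp contDiff_fst
  have pr2 : ContDiff ℝ ∞ (fun w : W => w.2 0) := pr.comp contDiff_snd
  set D : Set W := ((𝓡∂ n).prod (𝓡∂ n)).symm ⁻¹' overlap k k' e₁ e₂ e₁' e₂' ∩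
        range ((𝓡∂ n).prod (𝓡∂ n)) with hD
  -- the blow-down map and the homogeneous coordinates on the vector space
  obtain ⟨bE, hbEs, hbE⟩ : ∃ bE : W → W, ContDiff ℝ ∞ bE ∧
      ∀ m : ModelProd (EuclideanHalfSpace n) (EuclideanHalfSpace n),
        bE (m.1.1, m.2.1) = ((k.baseOf m).1.1, (k.baseOf m).2.1) := by
    cases k with
    | product => exact ⟨id, contDiff_id, fun m => rfl⟩
    | left =>
      refine ⟨fun w => (w.1 + (w.1 0 * w.2 0 - w.1 0) • e0, w.2), ?_, fun m => ?_⟩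
      · exact (contDiff_fst.add (((pr1.mul pr2).sub pr1).smul contDiff_const)).prodMk contDiff_snd
      · refine Prod.ext ?_ rfl
        exact (setCoord_val m.1 (mul_nonneg m.1.2 m.2.2)).symm
    | right =>
      refine ⟨fun w => (w.1, w.2 + (w.1 0 * w.2 0 - w.2 0) • e0), ?_, fun m => ?_⟩
      · exact contDiff_fst.prodMk
          (contDiff_snd.add (((pr1.mul pr2).sub pr2).smul contDiff_const))
      · refine Prod.ext rfl ?_
        exact (setCoord_val m.2 (mul_nonneg m.1.2 m.2.2)).symm
  obtain ⟨hE, hhEs, hhE⟩ : ∃ hE : W → ℝ × ℝ, ContDiff ℝ ∞ hE ∧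
      ∀ m : ModelProd (EuclideanHalfSpace n) (EuclideanHalfSpace n),
        hE (m.1.1, m.2.1) = k.homOf m := by
    cases k with
    | product => exact ⟨fun w => (w.1 0, w.2 0), pr1.prodMk pr2, fun m => rfl⟩
    | left => exact ⟨fun w => (w.1 0, 1), pr1.prodMk contDiff_const, fun m => rfl⟩
    | right => exact ⟨fun w => (1, w.2 0), contDiff_const.prodMk pr2, fun m => rfl⟩
  set x : W → X := fun w => e₁.symm ((𝓡∂ n).symm (bE w).1) with hx
  set y : W → X := fun w => e₂.symm ((𝓡∂ n).symm (bE w).2) with hy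
  have hsv : ∀ a : EuclideanHalfSpace n, (𝓡∂ n).symm a.1 = a := fun a => (𝓡∂ n).left_inv a
  have hDm : ∀ w ∈ D, ∃ m ∈ overlap k k' e₁ e₂ e₁' e₂', w = (m.1.1, m.2.1) := by
    rintro w ⟨h1, m, rfl⟩
    rw [mem_preimage, ModelWithCorners.left_inv] at h1
    exact ⟨m, h1, rfl⟩
  have hxm : ∀ m : ModelProd (EuclideanHalfSpace n) (EuclideanHalfSpace n),
      x (m.1.1, m.2.1) = e₁.symm (k.baseOf m).1 := by
    intro m; simp only [hx, hbE, hsv]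
  have hym : ∀ m : ModelProd (EuclideanHalfSpace n) (EuclideanHalfSpace n),
      y (m.1.1, m.2.1) = e₂.symm (k.baseOf m).2 := by
    intro m; simp only [hy, hbE, hsv]
  have hrange : ∀ a : EuclideanHalfSpace n, a.1 ∈ range (𝓡∂ n) := fun a => mem_range_self a
  have hxs : ContMDiffOn 𝓘(ℝ, W) (𝓡∂ n) ∞ x D := by
    have h1 : ContMDiffOn 𝓘(ℝ, W) (𝓡∂ n) ∞ (fun w => (𝓡∂ n).symm (bE w).1) D := by
      refine (𝓡∂ n).contMDiffOn_symm.comp (contDiff_fst.comp hbEs).contMDiff.contMDiffOn ?_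
      intro w hw
      obtain ⟨m, hm, rfl⟩ := hDm w hw
      simp only [mem_preimage, hbE]; exact hrange _
    refine (contMDiffOn_symm_of_mem_maximalAtlas (IsManifold.subset_maximalAtlas he₁)).comp h1 ?_
    intro w hw
    obtain ⟨m, hm, rfl⟩ := hDm w hw
    rw [mem_preimage, hbE, hsv]; exact hm.1.1
  have hys : ContMDiffOn 𝓘(ℝ, W) (𝓡∂ n) ∞ y D := by
    have h1 : ContMDiffOn 𝓘(ℝ, W) (𝓡∂ n) ∞ (fun w => (𝓡∂ n).symm (bE w).2) D := by
      refine (𝓡∂ n).contMDiffOn_symm.comp (contDiff_snd.comp hbEs).contMDiff.contMDiffOn ?_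
      intro w hw
      obtain ⟨m, hm, rfl⟩ := hDm w hw
      simp only [mem_preimage, hbE]; exact hrange _
    refine (contMDiffOn_symm_of_mem_maximalAtlas (IsManifold.subset_maximalAtlas he₂)).comp h1 ?_
    intro w hw
    obtain ⟨m, hm, rfl⟩ := hDm w hw
    rw [mem_preimage, hbE, hsv]; exact hm.1.2
  have hx1 : ∀ w ∈ D, x w ∈ e₁.source ∩ e₁'.source := by
    intro w hw
    obtain ⟨m, hm, rfl⟩ := hDm w hw
    rw [hxm]; exact ⟨e₁.map_target hm.1.1, hm.2.1.1⟩
  have hy1 : ∀ w ∈ D, y w ∈ e₂.source ∩ e₂'.source := by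
    intro w hw
    obtain ⟨m, hm, rfl⟩ := hDm w hw
    rw [hym]; exact ⟨e₂.map_target hm.1.2, hm.2.1.2⟩
  have E1 : ContDiffOn ℝ ∞ (fun w => (e₁' (x w)).1) D := by
    rw [← contMDiffOn_iff_contDiffOn]
    exact (e₁'.contMDiffOn_extend (IsManifold.subset_maximalAtlas he₁')).comp hxs
      (fun w hw => (hx1 w hw).2)
  have E2 : ContDiffOn ℝ ∞ (fun w => (e₂' (y w)).1) D := by
    rw [← contMDiffOn_iff_contDiffOn]
    exact (e₂'.contMDiffOn_extend (IsManifold.subset_maximalAtlas he₂')).comp hys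
      (fun w hw => (hy1 w hw).2)
  have U : ContDiffOn ℝ ∞ (fun w => q₁ (x w) * (hE w).1) D := by
    refine ContDiffOn.mul ?_ (contDiff_fst.comp hhEs).contDiffOn
    rw [← contMDiffOn_iff_contDiffOn]
    exact hq₁s.comp hxs hx1
  have V : ContDiffOn ℝ ∞ (fun w => q₂ (y w) * (hE w).2) D := by
    refine ContDiffOn.mul ?_ (contDiff_snd.comp hhEs).contDiffOn
    rw [← contMDiffOn_iff_contDiffOn]
    exact hq₂s.comp hys hy1
  have c1 : ContDiffOn ℝ ∞ (fun w => (e₁' (x w)).1 0) D := pr.comp_contDiffOn E1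
  have c2 : ContDiffOn ℝ ∞ (fun w => (e₂' (y w)).1 0) D := pr.comp_contDiffOn E2
  -- the values at a point
  have hval : ∀ p ∈ BStretchedProduct.chartSource k e₁ e₂ ∩
      BStretchedProduct.chartSource k' e₁' e₂', ∃ t : ℝ, 0 < t ∧
      x ((𝓡∂ n).prod (𝓡∂ n) (p.coords k e₁ e₂)) = p.blowDown.1 ∧
      y ((𝓡∂ n).prod (𝓡∂ n) (p.coords k e₁ e₂)) = p.blowDown.2 ∧
      (p.hom (boundaryCoord n e₁') (boundaryCoord n e₂')).1 =
        t * (q₁ p.blowDown.1 * (hE ((𝓡∂ n).prod (𝓡∂ n) (p.coords k e₁ e₂))).1) ∧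
      (p.hom (boundaryCoord n e₁') (boundaryCoord n e₂')).2 =
        t * (q₂ p.blowDown.2 * (hE ((𝓡∂ n).prod (𝓡∂ n) (p.coords k e₁ e₂))).2) := by
    rintro p ⟨hp, hp'⟩
    obtain ⟨hb, ⟨t, ht, hh⟩, -⟩ := coords_spec he₁ he₂ k p hp
    have hc := hq p ⟨hp.1, hp'.1⟩ ⟨hp.2.1, hp'.2.1⟩
    refine ⟨t, ht, ?_, ?_, ?_, ?_⟩
    · refine (hxm _).trans ?_
      rw [hb, e₁.left_inv hp.1]
    · refine (hym _).trans ?_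
      rw [hb, e₂.left_inv hp.2.1]
    · rw [hc, hh]
      change q₁ _ * (t * _) = t * (q₁ _ * (hE ((p.coords k e₁ e₂).1.1, (p.coords k e₁ e₂).2.1)).1)
      rw [hhE]; ring
    · rw [hc, hh]
      change q₂ _ * (t * _) = t * (q₂ _ * (hE ((p.coords k e₁ e₂).1.1, (p.coords k e₁ e₂).2.1)).2)
      rw [hhE]; ring
  cases k' with
  | product =>
    refine ⟨fun w => ((e₁' (x w)).1, (e₂' (y w)).1), E1.prodMk E2, fun p hp => ?_⟩
    obtain ⟨t, ht, h1, h2, -, -⟩ := hval p hp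
    simp only [h1, h2]; rfl
  | left =>
    refine ⟨fun w => ((e₁' (x w)).1 + ((q₁ (x w) * (hE w).1) / (q₂ (y w) * (hE w).2) -
      (e₁' (x w)).1 0) • e0, (e₂' (y w)).1), ?_, fun p hp => ?_⟩
    · refine (E1.add (ContDiffOn.smul ((U.div V ?_).sub c1) contDiffOn_const)).prodMk E2
      intro w hw
      have := hq₂ _ (hy1 w hw)
      obtain ⟨m, hm, rfl⟩ := hDm w hw
      have h3 : 0 < (k.homOf m).2 := hm.2.2.2
      rw [hhE]; positivity
    · obtain ⟨t, ht, h1, h2, h3, h4⟩ := hval p hp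
      have hnn := hom_nonneg he₁' he₂' p hp.2.1 hp.2.2.1
      refine Prod.ext ?_ ?_
      · change (setCoord (e₁' p.blowDown.1) ((p.hom _ _).1 / (p.hom _ _).2)).1 = _
        rw [setCoord_val _ (div_nonneg hnn.1 hnn.2), h3, h4, mul_div_mul_left _ _ ht.ne']
        simp only [h1, h2, he0]
      · change (e₂' p.blowDown.2).1 = _
        simp only [h2]
  | right =>
    refine ⟨fun w => ((e₁' (x w)).1, (e₂' (y w)).1 + ((q₂ (y w) * (hE w).2) /
      (q₁ (x w) * (hE w).1) - (e₂' (y w)).1 0) • e0), ?_, fun p hp => ?_⟩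
    · refine E1.prodMk (E2.add (ContDiffOn.smul ((V.div U ?_).sub c2) contDiffOn_const))
      intro w hw
      have := hq₁ _ (hx1 w hw)
      obtain ⟨m, hm, rfl⟩ := hDm w hw
      have h3 : 0 < (k.homOf m).1 := hm.2.2.2
      rw [hhE]; positivity
    · obtain ⟨t, ht, h1, h2, h3, h4⟩ := hval p hp
      have hnn := hom_nonneg he₁' he₂' p hp.2.1 hp.2.2.1
      refine Prod.ext ?_ ?_
      · change (e₁' p.blowDown.1).1 = _
        simp only [h1]
      · change (setCoord (e₂' p.blowDown.2) ((p.hom _ _).2 / (p.hom _ _).1)).1 = _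
        rw [setCoord_val _ (div_nonneg hnn.2 hnn.1), h3, h4, mul_div_mul_left _ _ ht.ne']
        simp only [h1, h2, he0]

end Transitions

section Abstract
variable {n : ℕ} [NeZero n] {M : Type u}

theorem trans_source_eq {H : Type*} {c c' : PartialEquiv M H} :
    (c.symm.trans c').source = c '' (c.source ∩ c'.source) := by
  rw [PartialEquiv.trans_source, PartialEquiv.symm_source, c.image_source_inter_eq']

/-- A change of coordinates which is smooth on the model vector space is smooth. -/
theorem contDiffOn_trans {c c' : PartialEquiv M (ModelProd (EuclideanHalfSpace n) (EuclideanHalfSpace n))}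
    {T : Set (ModelProd (EuclideanHalfSpace n) (EuclideanHalfSpace n))}
    (hT : c '' (c.source ∩ c'.source) ⊆ T)
    {F : EuclideanSpace ℝ (Fin n) × EuclideanSpace ℝ (Fin n) →
        EuclideanSpace ℝ (Fin n) × EuclideanSpace ℝ (Fin n)}
    (hF : ContDiffOn ℝ ∞ F (((𝓡∂ n).prod (𝓡∂ n)).symm ⁻¹' T ∩ range ((𝓡∂ n).prod (𝓡∂ n))))
    (h : ∀ p ∈ c.source ∩ c'.source,
      (𝓡∂ n).prod (𝓡∂ n) (c' p) = F ((𝓡∂ n).prod (𝓡∂ n) (c p))) :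
    ContDiffOn ℝ ∞ ((𝓡∂ n).prod (𝓡∂ n) ∘ c.symm.trans c' ∘ ((𝓡∂ n).prod (𝓡∂ n)).symm)
      (((𝓡∂ n).prod (𝓡∂ n)).symm ⁻¹' (c.symm.trans c').source ∩
        range ((𝓡∂ n).prod (𝓡∂ n))) := by
  rw [trans_source_eq]
  refine (hF.mono (inter_subset_inter_left _ (preimage_mono hT))).congr ?_
  rintro w ⟨hw, m, rfl⟩
  rw [mem_preimage, ModelWithCorners.left_inv] at hw
  obtain ⟨p, hp, rfl⟩ := hw
  rw [Function.comp_apply, Function.comp_apply, ModelWithCorners.left_inv, ← h p hp,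
    PartialEquiv.coe_trans, Function.comp_apply, c.left_inv hp.1]

theorem continuousOn_of_contDiffOn {f : ModelProd (EuclideanHalfSpace n) (EuclideanHalfSpace n) →
      ModelProd (EuclideanHalfSpace n) (EuclideanHalfSpace n)}
    {T : Set (ModelProd (EuclideanHalfSpace n) (EuclideanHalfSpace n))}
    (hf : ContDiffOn ℝ ∞ ((𝓡∂ n).prod (𝓡∂ n) ∘ f ∘ ((𝓡∂ n).prod (𝓡∂ n)).symm)
      (((𝓡∂ n).prod (𝓡∂ n)).symm ⁻¹' T ∩ range ((𝓡∂ n).prod (𝓡∂ n)))) :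
    ContinuousOn f T := by
  have h1 := ((𝓡∂ n).prod (𝓡∂ n)).continuous_symm.comp_continuousOn
    (hf.continuousOn.comp ((𝓡∂ n).prod (𝓡∂ n)).continuous.continuousOn (s := T) (by
      intro m hm
      refine ⟨?_, mem_range_self _⟩
      rw [mem_preimage, ModelWithCorners.left_inv]; exact hm))
  refine h1.congr fun m hm => ?_
  simp only [Function.comp_apply, ModelWithCorners.left_inv]

end Abstract

section Manifold
variable (n : ℕ) [NeZero n] (X : Type u) [TopologicalSpace X]
  [ChartedSpace (EuclideanHalfSpace n) X] [IsManifold (𝓡∂ n) ∞ X]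

open Classical in
/-- The kind of the preferred chart at a point. -/
noncomputable def BStretchedProduct.kindAt {n : ℕ} [NeZero n] {X : Type u} [TopologicalSpace X]
    [ChartedSpace (EuclideanHalfSpace n) X] (p : BStretchedProduct n X) : ChartKind :=
  if SameBoundaryComponent n p.blowDown.1 p.blowDown.2 then
    if 0 < (p.hom (boundaryCoord n (chartAt (EuclideanHalfSpace n) p.blowDown.1))
      (boundaryCoord n (chartAt (EuclideanHalfSpace n) p.blowDown.2))).2 then .left else .right
  else .product

theorem BStretchedProduct.mem_chartSource_kindAt {n : ℕ} [NeZero n] {X : Type u}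
    [TopologicalSpace X] [ChartedSpace (EuclideanHalfSpace n) X] [IsManifold (𝓡∂ n) ∞ X]
    (p : BStretchedProduct n X) :
    p ∈ BStretchedProduct.chartSource p.kindAt (chartAt (EuclideanHalfSpace n) p.blowDown.1)
      (chartAt (EuclideanHalfSpace n) p.blowDown.2) := by
  refine ⟨mem_chart_source _ _, mem_chart_source _ _, ?_⟩
  rw [BStretchedProduct.kindAt]
  split_ifs with h1 h2
  · exact h2
  · cases p with
    | off x y hn => exact absurd h1 hn
    | front x y hs R =>
      obtain ⟨-, -, k₁, k₂, hk₁, hk₂, l1, l2, l3, l4⟩ := hom_front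
        (chart_mem_atlas (EuclideanHalfSpace n) x) (chart_mem_atlas (EuclideanHalfSpace n) y) hs
        (mem_chart_source _ _) (mem_chart_source _ _) R
      change ¬ 0 < leadingCoeff n (boundaryCoord n (chartAt (EuclideanHalfSpace n) y)) y _ at h2
      change 0 < leadingCoeff n (boundaryCoord n (chartAt (EuclideanHalfSpace n) x)) x _
      rw [l2] at h2
      rw [l1]
      have h4 : normalCoord n y R.1.someVector.2 = 0 := by
        by_contra h
        exact h2 (mul_pos hk₂ (lt_of_le_of_ne l4 (Ne.symm h)))
      refine mul_pos hk₁ (lt_of_le_of_ne l3 fun h => R.1.someVector_ne_zero ?_)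
      refine Prod.ext ?_ ?_
      · apply normalCoord_injective; rw [← h]; exact (map_zero _).symm
      · apply normalCoord_injective; rw [h4]; exact (map_zero _).symm
  · exact h1

/-- The atlas of `X_b^2`: all the coordinates of the blow-up in pairs of charts of `X`. -/
noncomputable def BStretchedProduct.core : ChartedSpaceCore
    (ModelProd (EuclideanHalfSpace n) (EuclideanHalfSpace n)) (BStretchedProduct n X) where
  atlas := {c | ∃ k : ChartKind, ∃ e₁ ∈ atlas (EuclideanHalfSpace n) X,
    ∃ e₂ ∈ atlas (EuclideanHalfSpace n) X,
      c.source = BStretchedProduct.chartSource k e₁ e₂ ∧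
      ∀ p, c p = BStretchedProduct.coords k e₁ e₂ p}
  chartAt p :=
    haveI : Nonempty (BStretchedProduct n X) := ⟨p⟩
    (coords_injOn (chart_mem_atlas (EuclideanHalfSpace n) p.blowDown.1)
      (chart_mem_atlas (EuclideanHalfSpace n) p.blowDown.2) p.kindAt).toPartialEquiv _ _
  mem_chart_source p := p.mem_chartSource_kindAt
  chart_mem_atlas p := ⟨p.kindAt, _, chart_mem_atlas _ _, _, chart_mem_atlas _ _, rfl, fun _ => rfl⟩
  open_source := by
    rintro c c' ⟨k, e₁, he₁, e₂, he₂, hs, hc⟩ ⟨k', e₁', he₁', e₂', he₂', hs', hc'⟩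
    rw [trans_source_eq, hs, hs', image_congr (fun p _ => hc p),
      image_overlap he₁ he₂ he₁' he₂']
    exact isOpen_overlap he₁ he₂ k k'
  continuousOn_toFun := by
    rintro c c' ⟨k, e₁, he₁, e₂, he₂, hs, hc⟩ ⟨k', e₁', he₁', e₂', he₂', hs', hc'⟩
    obtain ⟨F, hF, h⟩ := exists_transition he₁ he₂ he₁' he₂' k k'
    refine continuousOn_of_contDiffOn (contDiffOn_trans (T := overlap k k' e₁ e₂ e₁' e₂') ?_ hF ?_)
    · rw [hs, hs', image_congr (fun p _ => hc p), image_overlap he₁ he₂ he₁' he₂']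
    · rw [hs, hs']
      intro p hp
      rw [hc, hc', h p hp]

noncomputable instance : TopologicalSpace (BStretchedProduct n X) :=
  (BStretchedProduct.core n X).toTopologicalSpace

noncomputable instance : ChartedSpace (ModelProd (EuclideanHalfSpace n) (EuclideanHalfSpace n))
    (BStretchedProduct n X) :=
  (BStretchedProduct.core n X).toChartedSpace

/-- The `b`-stretched product is a smooth manifold with corners. -/
instance : IsManifold ((𝓡∂ n).prod (𝓡∂ n)) ∞ (BStretchedProduct n X) := by
  refine isManifold_of_contDiffOn _ _ _ ?_
  intro c c' hc hc'
  change c ∈ ⋃ (e : PartialEquiv _ _) (he : e ∈ (BStretchedProduct.core n X).atlas), {_} at hc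
  change c' ∈ ⋃ (e : PartialEquiv _ _) (he : e ∈ (BStretchedProduct.core n X).atlas), {_} at hc'
  simp only [mem_iUnion, mem_singleton_iff] at hc hc'
  obtain ⟨d, hd, rfl⟩ := hc
  obtain ⟨d', hd', rfl⟩ := hc'
  obtain ⟨k, e₁, he₁, e₂, he₂, hs, hc⟩ := hd
  obtain ⟨k', e₁', he₁', e₂', he₂', hs', hc'⟩ := hd'
  obtain ⟨F, hF, h⟩ := exists_transition he₁ he₂ he₁' he₂' k k'
  refine contDiffOn_trans (c := d) (c' := d') (T := overlap k k' e₁ e₂ e₁' e₂') ?_ hF ?_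
  · rw [hs, hs', image_congr (fun p _ => hc p), image_overlap he₁ he₂ he₁' he₂']
  · rw [hs, hs']
    intro p hp
    rw [hc, hc', h p hp]

end Manifold

section Inclusion
variable {n : ℕ} [NeZero n] {X : Type u} [TopologicalSpace X]
  [ChartedSpace (EuclideanHalfSpace n) X] [IsManifold (𝓡∂ n) ∞ X]

theorem not_sameBoundaryComponent {x y : X} (hx : x ∈ (𝓡∂ n).interior X) :
    ¬ SameBoundaryComponent n x y := fun h => by
  have h1 := h.1
  rw [← (𝓡∂ n).compl_interior] at h1
  exact h1 hx

/-- The canonical map `Γ(X) → X_b^2`: the identity on pairs of interior points; an isomorphism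
`α : N_y → N_x` is sent to the inward pointing ray of its graph, spanned by `(α v, v)` for an inward
pointing vector `v`. -/
noncomputable def BGroupoid.toStretched : BGroupoid n X → BStretchedProduct n X
  | .interior x y hx _ => .off x y (not_sameBoundaryComponent hx)
  | .boundary x y h α hα => .front x y h
      ⟨rayOfNeZero ℝ (α (inwardUnit n y), inwardUnit n y)
          (ray_boundary_ne_zero α (inwardUnit_ne_zero y)),
        _, ray_boundary_ne_zero α (inwardUnit_ne_zero y),
        hα _ (by rw [normalCoord_inwardUnit]; exact zero_le_one),
        by rw [normalCoord_inwardUnit]; exact zero_le_one, rfl⟩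

theorem BGroupoid.blowDown_toStretched (γ : BGroupoid n X) :
    γ.toStretched.blowDown = (γ.r, γ.s) := by
  cases γ <;> rfl

theorem normalCoord_equiv_pos {x y : X} (α : NormalSpace n y ≃ₗ[ℝ] NormalSpace n x)
    (hα : ∀ v, 0 ≤ normalCoord n y v → 0 ≤ normalCoord n x (α v)) :
    0 < normalCoord n x (α (inwardUnit n y)) := by
  refine lt_of_le_of_ne (hα _ (by rw [normalCoord_inwardUnit]; exact zero_le_one)) fun h => ?_
  have h1 : α (inwardUnit n y) = 0 := by
    apply normalCoord_injective; rw [← h]; exact (map_zero _).symm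
  exact inwardUnit_ne_zero y (α.map_eq_zero_iff.1 h1)

theorem BGroupoid.toStretched_injective :
    Function.Injective (BGroupoid.toStretched : BGroupoid n X → BStretchedProduct n X) := by
  intro γ γ' h
  have hb : (γ.r, γ.s) = (γ'.r, γ'.s) := by
    rw [← γ.blowDown_toStretched, ← γ'.blowDown_toStretched, h]
  cases γ with
  | interior x y hx hy =>
    cases γ' with
    | interior x' y' hx' hy' =>
      obtain rfl : x = x' := congrArg Prod.fst hb
      obtain rfl : y = y' := congrArg Prod.snd hb
      rfl
    | boundary x' y' hs' α' hα' => exact absurd h (by rintro ⟨⟩)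
  | boundary x y hs α hα =>
    cases γ' with
    | interior x' y' hx' hy' => exact absurd h (by rintro ⟨⟩)
    | boundary x' y' hs' α' hα' =>
      obtain rfl : x = x' := congrArg Prod.fst hb
      obtain rfl : y = y' := congrArg Prod.snd hb
      congr 1
      have h1 := congrArg Subtype.val (eq_of_heq (BStretchedProduct.front.inj h).2.2)
      change rayOfNeZero ℝ _ _ = rayOfNeZero ℝ _ _ at h1
      rw [ray_eq_iff] at h1
      obtain ⟨r₁, r₂, p1, p2, h2⟩ := h1.exists_pos
        (ray_boundary_ne_zero α (inwardUnit_ne_zero y))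
        (ray_boundary_ne_zero α' (inwardUnit_ne_zero y))
      have h3 := congrArg (fun v => normalCoord n y v.2) h2
      simp only [Prod.smul_snd, map_smul, normalCoord_inwardUnit, smul_eq_mul, mul_one] at h3
      have h4 := congrArg Prod.fst h2
      simp only [Prod.smul_fst] at h4
      rw [h3] at h4
      have h5 := smul_right_injective _ p2.ne' h4
      ext v
      rw [eq_smul_inwardUnit v, map_smul, map_smul, h5]

variable {e₁ e₂ e₁' e₂' : OpenPartialHomeomorph X (EuclideanHalfSpace n)}

/-- The homogeneous coordinates of a point of `Γ(X)` are positive, and the dilation factor is their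
quotient. -/
theorem hom_toStretched (he₁ : e₁ ∈ atlas (EuclideanHalfSpace n) X)
    (he₂ : e₂ ∈ atlas (EuclideanHalfSpace n) X) (γ : BGroupoid n X)
    (hx : γ.r ∈ e₁.source) (hy : γ.s ∈ e₂.source) :
    0 < (γ.toStretched.hom (boundaryCoord n e₁) (boundaryCoord n e₂)).1 ∧
    0 < (γ.toStretched.hom (boundaryCoord n e₁) (boundaryCoord n e₂)).2 ∧
    γ.dilation (boundaryCoord n e₁) (boundaryCoord n e₂) =
      (γ.toStretched.hom (boundaryCoord n e₁) (boundaryCoord n e₂)).1 /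
      (γ.toStretched.hom (boundaryCoord n e₁) (boundaryCoord n e₂)).2 := by
  cases γ with
  | interior x y hx' hy' =>
    rw [← (𝓡∂ n).compl_boundary] at hx' hy'
    exact ⟨lt_of_le_of_ne (boundaryCoord_nonneg _ _) fun h => hx' ((mem_boundary_iff he₁ hx).2 h.symm),
      lt_of_le_of_ne (boundaryCoord_nonneg _ _) fun h => hy' ((mem_boundary_iff he₂ hy).2 h.symm),
      rfl⟩
  | boundary x y hs α hα =>
    have hx : x ∈ e₁.source := hx
    have hy : y ∈ e₂.source := hy
    obtain ⟨k₁, hk₁, l1⟩ := leadingCoeff_boundaryCoord he₁ hx hs.1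
    obtain ⟨k₂, hk₂, l2⟩ := leadingCoeff_boundaryCoord he₂ hy hs.2.1
    obtain ⟨t, ht, h⟩ := someVector_eq _ (ray_boundary_ne_zero α (inwardUnit_ne_zero y))
    have hp := normalCoord_equiv_pos α hα
    have e1 : ((BGroupoid.boundary x y hs α hα).toStretched.hom
        (boundaryCoord n e₁) (boundaryCoord n e₂)).1 =
        k₁ * (t * normalCoord n x (α (inwardUnit n y))) := by
      change leadingCoeff n _ x (rayOfNeZero ℝ ((α (inwardUnit n y), inwardUnit n y) :
        NormalSpace n x × NormalSpace n y) (ray_boundary_ne_zero α (inwardUnit_ne_zero y))).someVector.1 = _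
      rw [h, Prod.smul_fst]
      refine (l1 _).trans ?_
      rw [map_smul, smul_eq_mul]
    have e2 : ((BGroupoid.boundary x y hs α hα).toStretched.hom
        (boundaryCoord n e₁) (boundaryCoord n e₂)).2 = k₂ * t := by
      change leadingCoeff n _ y (rayOfNeZero ℝ ((α (inwardUnit n y), inwardUnit n y) :
        NormalSpace n x × NormalSpace n y) (ray_boundary_ne_zero α (inwardUnit_ne_zero y))).someVector.2 = _
      rw [h, Prod.smul_snd]
      refine (l2 _).trans ?_
      rw [map_smul, smul_eq_mul, normalCoord_inwardUnit, mul_one]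
    rw [e1, e2]
    refine ⟨by positivity, by positivity, ?_⟩
    change leadingCoeff n _ x (α (inwardUnit n y)) / leadingCoeff n _ y (inwardUnit n y) = _
    have l1' := l1 (α (inwardUnit n y))
    have l2' := l2 (inwardUnit n y)
    change leadingCoeff n (boundaryCoord n e₁) x (α (inwardUnit n y)) /
      leadingCoeff n (boundaryCoord n e₂) y (inwardUnit n y) = _
    rw [l1', l2', normalCoord_inwardUnit]
    field_simp

theorem coords_toStretched (he₁ : e₁ ∈ atlas (EuclideanHalfSpace n) X)
    (he₂ : e₂ ∈ atlas (EuclideanHalfSpace n) X) (γ : BGroupoid n X)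
    (hγ : γ ∈ BGroupoid.chartSource e₁ e₂) :
    γ.coords e₁ e₂ = γ.toStretched.coords .left e₁ e₂ := by
  have h := (hom_toStretched he₁ he₂ γ hγ.1 hγ.2).2.2
  rw [BGroupoid.coords, h]
  simp only [BStretchedProduct.coords, γ.blowDown_toStretched]

theorem image_toStretched (he₁ : e₁ ∈ atlas (EuclideanHalfSpace n) X)
    (he₂ : e₂ ∈ atlas (EuclideanHalfSpace n) X) :
    BGroupoid.toStretched '' BGroupoid.chartSource e₁ e₂ =
      BStretchedProduct.chartSource .left e₁ e₂ ∩ BStretchedProduct.chartSource .right e₁ e₂ := by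
  apply Subset.antisymm
  · rintro _ ⟨γ, hγ, rfl⟩
    obtain ⟨h1, h2, -⟩ := hom_toStretched he₁ he₂ γ hγ.1 hγ.2
    have hb := γ.blowDown_toStretched
    refine ⟨⟨?_, ?_, h2⟩, ⟨?_, ?_, h1⟩⟩ <;> rw [hb]
    exacts [hγ.1, hγ.2, hγ.1, hγ.2]
  · rintro p ⟨⟨hx, hy, h2⟩, ⟨-, -, h1⟩⟩
    cases p with
    | off x y hn =>
      refine ⟨.interior x y ?_ ?_, ⟨hx, hy⟩, rfl⟩
      · rw [← (𝓡∂ n).compl_boundary]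
        exact fun h => (show 0 < boundaryCoord n e₁ x from h1).ne' ((mem_boundary_iff he₁ hx).1 h)
      · rw [← (𝓡∂ n).compl_boundary]
        exact fun h => (show 0 < boundaryCoord n e₂ y from h2).ne' ((mem_boundary_iff he₂ hy).1 h)
    | front x y hs R =>
      have hx : x ∈ e₁.source := hx
      have hy : y ∈ e₂.source := hy
      obtain ⟨k₁, hk₁, l1⟩ := leadingCoeff_boundaryCoord he₁ hx hs.1
      obtain ⟨k₂, hk₂, l2⟩ := leadingCoeff_boundaryCoord he₂ hy hs.2.1
      have h1 : 0 < leadingCoeff n (boundaryCoord n e₁) x R.1.someVector.1 := h1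
      have h2 : 0 < leadingCoeff n (boundaryCoord n e₂) y R.1.someVector.2 := h2
      rw [l1, mul_pos_iff_of_pos_left hk₁] at h1
      rw [l2, mul_pos_iff_of_pos_left hk₂] at h2
      set a := normalCoord n x R.1.someVector.1 with ha
      set b := normalCoord n y R.1.someVector.2 with hb
      let N : ∀ z : X, NormalSpace n z ≃ₗ[ℝ] ℝ := fun z =>
        LinearEquiv.ofBijective (normalCoord n z) ⟨normalCoord_injective z, fun s =>
          ⟨s • inwardUnit n z, by rw [map_smul, normalCoord_inwardUnit, smul_eq_mul, mul_one]⟩⟩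
      have hab : a / b ≠ 0 := (div_pos h1 h2).ne'
      let α : NormalSpace n y ≃ₗ[ℝ] NormalSpace n x :=
        ((N y).trans (LinearEquiv.smulOfNeZero ℝ ℝ (a / b) hab)).trans (N x).symm
      have hα : ∀ v, normalCoord n x (α v) = a / b * normalCoord n y v := by
        intro v
        exact (N x).apply_symm_apply _
      refine ⟨.boundary x y hs α fun v hv => ?_, ⟨hx, hy⟩, ?_⟩
      · rw [hα]; exact mul_nonneg (div_pos h1 h2).le hv
      · change BStretchedProduct.front x y hs _ = _
        congr 1
        refine Subtype.ext ?_
        change rayOfNeZero ℝ _ _ = _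
        rw [← R.1.someVector_ray, ray_eq_iff]
        have : R.1.someVector = b • ((α (inwardUnit n y), inwardUnit n y) :
            NormalSpace n x × NormalSpace n y) := by
          refine Prod.ext ?_ ?_
          · apply normalCoord_injective
            rw [Prod.smul_fst, map_smul, hα, normalCoord_inwardUnit, ← ha, smul_eq_mul]
            field_simp
          · apply normalCoord_injective
            rw [Prod.smul_snd, map_smul, normalCoord_inwardUnit, ← hb, smul_eq_mul, mul_one]
        rw [this]
        exact SameRay.sameRay_pos_smul_right _ h2

theorem BGroupoid.coords_injOn (he₁ : e₁ ∈ atlas (EuclideanHalfSpace n) X)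
    (he₂ : e₂ ∈ atlas (EuclideanHalfSpace n) X) :
    InjOn (BGroupoid.coords e₁ e₂) (BGroupoid.chartSource (X := X) e₁ e₂) := by
  intro γ hγ γ' hγ' h
  rw [coords_toStretched he₁ he₂ γ hγ, coords_toStretched he₁ he₂ γ' hγ'] at h
  have h1 : ∀ δ ∈ BGroupoid.chartSource (X := X) e₁ e₂,
      δ.toStretched ∈ BStretchedProduct.chartSource .left e₁ e₂ := fun δ hδ =>
    ((image_toStretched he₁ he₂).subset (mem_image_of_mem _ hδ)).1
  exact BGroupoid.toStretched_injective
    (BStretch.coords_injOn he₁ he₂ .left (h1 γ hγ) (h1 γ' hγ') h)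

theorem BGroupoid.image_overlap (he₁ : e₁ ∈ atlas (EuclideanHalfSpace n) X)
    (he₂ : e₂ ∈ atlas (EuclideanHalfSpace n) X) (he₁' : e₁' ∈ atlas (EuclideanHalfSpace n) X)
    (he₂' : e₂' ∈ atlas (EuclideanHalfSpace n) X) :
    BGroupoid.coords e₁ e₂ '' (BGroupoid.chartSource e₁ e₂ ∩ BGroupoid.chartSource e₁' e₂') =
      overlap .left .right e₁ e₂ e₁' e₂' := by
  rw [← BStretch.image_overlap he₁ he₂ he₁' he₂']
  have h1 : BGroupoid.coords e₁ e₂ ''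
      (BGroupoid.chartSource e₁ e₂ ∩ BGroupoid.chartSource e₁' e₂') =
      BStretchedProduct.coords .left e₁ e₂ '' (BGroupoid.toStretched ''
        (BGroupoid.chartSource e₁ e₂ ∩ BGroupoid.chartSource e₁' e₂')) := by
    rw [image_image]
    exact image_congr fun γ hγ => coords_toStretched he₁ he₂ γ hγ.1
  rw [h1, image_inter BGroupoid.toStretched_injective, image_toStretched he₁ he₂,
    image_toStretched he₁' he₂']
  congr 1
  obtain ⟨q₁, q₂, -, -, hq₁, hq₂, hq⟩ := hom_change he₁ he₂ he₁' he₂'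
  ext p
  constructor
  · rintro ⟨⟨h1, -⟩, ⟨-, h2⟩⟩; exact ⟨h1, h2⟩
  · rintro ⟨h1, h2⟩
    have hc := hq p ⟨h1.1, h2.1⟩ ⟨h1.2.1, h2.2.1⟩
    have p1 := hq₁ _ ⟨h1.1, h2.1⟩
    have p2 := hq₂ _ ⟨h1.2.1, h2.2.1⟩
    have a1 : 0 < (p.hom (boundaryCoord n e₁) (boundaryCoord n e₂)).2 := h1.2.2
    have a2 : 0 < (p.hom (boundaryCoord n e₁') (boundaryCoord n e₂')).1 := h2.2.2
    refine ⟨⟨h1, h1.1, h1.2.1, ?_⟩, ⟨h2.1, h2.2.1, ?_⟩, h2⟩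
    · change 0 < (p.hom (boundaryCoord n e₁) (boundaryCoord n e₂)).1
      rw [hc] at a2
      exact (mul_pos_iff_of_pos_left p1).1 a2
    · change 0 < (p.hom (boundaryCoord n e₁') (boundaryCoord n e₂')).2
      rw [hc]
      exact mul_pos p2 a1

theorem BGroupoid.exists_transition (he₁ : e₁ ∈ atlas (EuclideanHalfSpace n) X)
    (he₂ : e₂ ∈ atlas (EuclideanHalfSpace n) X) (he₁' : e₁' ∈ atlas (EuclideanHalfSpace n) X)
    (he₂' : e₂' ∈ atlas (EuclideanHalfSpace n) X) :
    ∃ F : EuclideanSpace ℝ (Fin n) × EuclideanSpace ℝ (Fin n) →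
        EuclideanSpace ℝ (Fin n) × EuclideanSpace ℝ (Fin n),
      ContDiffOn ℝ ∞ F (((𝓡∂ n).prod (𝓡∂ n)).symm ⁻¹' overlap .left .right e₁ e₂ e₁' e₂' ∩
        range ((𝓡∂ n).prod (𝓡∂ n))) ∧
      ∀ γ ∈ BGroupoid.chartSource e₁ e₂ ∩ BGroupoid.chartSource e₁' e₂',
        (𝓡∂ n).prod (𝓡∂ n) (γ.coords e₁' e₂') = F ((𝓡∂ n).prod (𝓡∂ n) (γ.coords e₁ e₂)) := by
  obtain ⟨F, hF, h⟩ := BStretch.exists_transition he₁ he₂ he₁' he₂' .left .left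
  refine ⟨F, hF.mono (inter_subset_inter_left _ (preimage_mono ?_)), ?_⟩
  · rintro m ⟨a, b, c, -⟩
    exact ⟨a, b, c, (zero_lt_one : (0 : ℝ) < 1)⟩
  · rintro γ ⟨hγ, hγ'⟩
    rw [coords_toStretched he₁ he₂ γ hγ, coords_toStretched he₁' he₂' γ hγ']
    exact h _ ⟨((image_toStretched he₁ he₂).subset (mem_image_of_mem _ hγ)).1,
      ((image_toStretched he₁' he₂').subset (mem_image_of_mem _ hγ')).1⟩

end Inclusion

section GroupoidManifold
variable (n : ℕ) [NeZero n] (X : Type u) [TopologicalSpace X]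
  [ChartedSpace (EuclideanHalfSpace n) X] [IsManifold (𝓡∂ n) ∞ X]

/-- The atlas of `Γ(X)`: all its coordinates in pairs of charts of `X`. -/
noncomputable def BGroupoid.core : ChartedSpaceCore
    (ModelProd (EuclideanHalfSpace n) (EuclideanHalfSpace n)) (BGroupoid n X) where
  atlas := {c | ∃ e₁ ∈ atlas (EuclideanHalfSpace n) X, ∃ e₂ ∈ atlas (EuclideanHalfSpace n) X,
      c.source = BGroupoid.chartSource e₁ e₂ ∧ ∀ γ, c γ = BGroupoid.coords e₁ e₂ γ}
  chartAt γ :=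
    haveI : Nonempty (BGroupoid n X) := ⟨γ⟩
    (BGroupoid.coords_injOn (chart_mem_atlas (EuclideanHalfSpace n) γ.r)
      (chart_mem_atlas (EuclideanHalfSpace n) γ.s)).toPartialEquiv _ _
  mem_chart_source γ := ⟨mem_chart_source _ _, mem_chart_source _ _⟩
  chart_mem_atlas γ := ⟨_, chart_mem_atlas _ _, _, chart_mem_atlas _ _, rfl, fun _ => rfl⟩
  open_source := by
    rintro c c' ⟨e₁, he₁, e₂, he₂, hs, hc⟩ ⟨e₁', he₁', e₂', he₂', hs', hc'⟩
    rw [trans_source_eq, hs, hs', image_congr (fun p _ => hc p),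
      BGroupoid.image_overlap he₁ he₂ he₁' he₂']
    exact isOpen_overlap he₁ he₂ .left .right
  continuousOn_toFun := by
    rintro c c' ⟨e₁, he₁, e₂, he₂, hs, hc⟩ ⟨e₁', he₁', e₂', he₂', hs', hc'⟩
    obtain ⟨F, hF, h⟩ := BGroupoid.exists_transition he₁ he₂ he₁' he₂'
    refine continuousOn_of_contDiffOn
      (contDiffOn_trans (T := overlap .left .right e₁ e₂ e₁' e₂') ?_ hF ?_)
    · rw [hs, hs', image_congr (fun p _ => hc p), BGroupoid.image_overlap he₁ he₂ he₁' he₂']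
    · rw [hs, hs']
      intro p hp
      rw [hc, hc', h p hp]

noncomputable instance : TopologicalSpace (BGroupoid n X) :=
  (BGroupoid.core n X).toTopologicalSpace

noncomputable instance : ChartedSpace (ModelProd (EuclideanHalfSpace n) (EuclideanHalfSpace n))
    (BGroupoid n X) :=
  (BGroupoid.core n X).toChartedSpace

/-- `Γ(X)` is a smooth manifold (with boundary). -/
instance : IsManifold ((𝓡∂ n).prod (𝓡∂ n)) ∞ (BGroupoid n X) := by
  refine isManifold_of_contDiffOn _ _ _ ?_
  intro c c' hc hc'
  change c ∈ ⋃ (e : PartialEquiv _ _) (he : e ∈ (BGroupoid.core n X).atlas), {_} at hc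
  change c' ∈ ⋃ (e : PartialEquiv _ _) (he : e ∈ (BGroupoid.core n X).atlas), {_} at hc'
  simp only [mem_iUnion, mem_singleton_iff] at hc hc'
  obtain ⟨d, hd, rfl⟩ := hc
  obtain ⟨d', hd', rfl⟩ := hc'
  obtain ⟨e₁, he₁, e₂, he₂, hs, hc⟩ := hd
  obtain ⟨e₁', he₁', e₂', he₂', hs', hc'⟩ := hd'
  obtain ⟨F, hF, h⟩ := BGroupoid.exists_transition he₁ he₂ he₁' he₂'
  refine contDiffOn_trans (c := d) (c' := d') (T := overlap .left .right e₁ e₂ e₁' e₂') ?_ hF ?_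
  · rw [hs, hs', image_congr (fun p _ => hc p), BGroupoid.image_overlap he₁ he₂ he₁' he₂']
  · rw [hs, hs']
    intro p hp
    rw [hc, hc', h p hp]

end GroupoidManifold

section Statement
variable {n : ℕ} [NeZero n] {X : Type u} [TopologicalSpace X]
  [ChartedSpace (EuclideanHalfSpace n) X]

variable (n X) in
/-- The connected components of the boundary of `X`. -/
abbrev BoundaryComponents : Type u := ConnectedComponents ((𝓡∂ n).boundary X)

/-- A connected component of the boundary, as a subset of `X`. -/
def boundaryComponent (C : BoundaryComponents n X) : Set X :=
  Subtype.val '' (ConnectedComponents.mk ⁻¹' {C} : Set ((𝓡∂ n).boundary X))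

variable (n) in
/-- `ρ` is a defining function of the union `S` of boundary components: a nonnegative smooth
function which vanishes exactly on `S` and whose differential does not vanish at the points
of `S`. -/
structure IsDefiningFunction (ρ : X → ℝ) (S : Set X) : Prop where
  contMDiff : ContMDiff (𝓡∂ n) 𝓘(ℝ, ℝ) ∞ ρ
  nonneg : ∀ x, 0 ≤ ρ x
  eq_zero_iff : ∀ x, ρ x = 0 ↔ x ∈ S
  mvfderiv_ne_zero : ∀ x ∈ S, mvfderiv (𝓡∂ n) ρ x ≠ 0

/-- The function `φ` on `Γ(X)`: `log (ρ(x) / ρ(y))` at a pair `(x, y)` of interior points and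
`log λ` at an isomorphism with dilation factor `λ` between normal spaces of the component on which
`ρ` vanishes. -/
noncomputable def BGroupoid.phi (ρ : X → ℝ) (γ : BGroupoid n X) : ℝ := Real.log (γ.dilation ρ ρ)

/-- The extension to `X_b^2` of the function `τ = (ρ(x) - ρ(y)) / (ρ(x) + ρ(y))`; at the ray of
`(v, w)` it is `(dρ v - dρ w) / (dρ v + dρ w)`, over the component on which `ρ` vanishes. -/
noncomputable def BStretchedProduct.tau (ρ : X → ℝ) (p : BStretchedProduct n X) : ℝ :=
  ((p.hom ρ ρ).1 - (p.hom ρ ρ).2) / ((p.hom ρ ρ).1 + (p.hom ρ ρ).2)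

variable (n X) [IsManifold (𝓡∂ n) ∞ X]

/-- The left boundary of `X_b^2`: the closure of the preimage of `∂X × int X`. -/
def leftBoundary : Set (BStretchedProduct n X) :=
  closure (BStretchedProduct.blowDown ⁻¹' ((𝓡∂ n).boundary X ×ˢ (𝓡∂ n).interior X))

/-- The right boundary of `X_b^2`: the closure of the preimage of `int X × ∂X`. -/
def rightBoundary : Set (BStretchedProduct n X) :=
  closure (BStretchedProduct.blowDown ⁻¹' ((𝓡∂ n).interior X ×ˢ (𝓡∂ n).boundary X))

end Statement

end BStretch

/-! In a pair of charts of `X`, a point of `X_b^2` has homogeneous coordinates (h₁, h₂), given by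
`hom`: the values (x₁, y₁) of the boundary coordinates off the front face, and (dx₁ v, dy₁ w) for a
chosen vector (v, w) of the ray on the front face. They are nonnegative; on the front face they are
not both zero and matter only up to a common positive factor. The whole theorem concerns their signs
and their ratio.

Γ(X) is the locus where h₁ and h₂ are both positive (`mem_range_toStretched_iff`): over the front
face a ray with two positive components is the graph of an inward preserving isomorphism N_y → N_x,
and off it positivity says that both ends are interior. On this locus λ = h₁ / h₂, so the
coordinates of Γ(X) are the left projective coordinates of `X_b^2`. In charts ι is thus the
identity, and an injective local diffeomorphism is an open embedding.

Outside Γ(X) one of h₁, h₂ vanishes. In the product and projective charts this is the vanishing of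
one model coordinate, and pushing the other model coordinate inward approximates the point by points
over ∂X × int X or int X × ∂X. Conversely Γ(X) is open, and its points have both ends interior or
both ends on the boundary, so it misses these two preimages and hence their closures.

For a defining function ρ of C, Hadamard's lemma gives ρ = q x₁ near a point of C, with q smooth.
There q is positive: it is nonzero because dρ ≠ 0, and nonnegative by approach from the interior.
Hence the homogeneous coordinates of ρ are (q₁ h₁, q₂ h₂). As τ is homogeneous of degree zero, (h₁,
h₂) may be replaced by the smooth representative `homOf` of the chart, for which the denominator is
positive; away from C × C the denominator ρ(x) + ρ(y) does not vanish. On Γ(X) both coordinates a, b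
of ρ are positive and φ = log (a / b), so τ = tanh (φ / 2) is the identity (t - 1) / (t + 1) = tanh
(log t / 2) at t = a / b.

Finally, for a, b ≥ 0 not both zero, (a - b) / (a + b) lies in ]-1, 1[ exactly when a and b are both
positive. On the front face the condition for the component below the point suffices. Off the front
face the conditions for all C together keep x and y out of every component, that is, in the
interior. -/

namespace BStretch
universe u

/-! ### The inclusion of Γ(X) in the b-stretched product -/

section LocalDiffeomorphism
variable {n : ℕ} [NeZero n] {X : Type u} [TopologicalSpace X]
  [ChartedSpace (EuclideanHalfSpace n) X] [IsManifold (𝓡∂ n) ∞ X]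
  {e₁ e₂ : OpenPartialHomeomorph X (EuclideanHalfSpace n)}

/-- The coordinates of any type in a pair of charts of `X` are a chart of `X_b^2`. -/
theorem BStretchedProduct.exists_chart (he₁ : e₁ ∈ atlas (EuclideanHalfSpace n) X)
    (he₂ : e₂ ∈ atlas (EuclideanHalfSpace n) X) (k : ChartKind) (p : BStretchedProduct n X) :
    ∃ d ∈ IsManifold.maximalAtlas ((𝓡∂ n).prod (𝓡∂ n)) ∞ (BStretchedProduct n X),
      d.source = chartSource k e₁ e₂ ∧ ∀ q, d q = coords k e₁ e₂ q := by
  have : Nonempty (BStretchedProduct n X) := ⟨p⟩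
  have hc : (coords_injOn he₁ he₂ k).toPartialEquiv _ _ ∈ (core n X).atlas :=
    ⟨k, e₁, he₁, e₂, he₂, rfl, fun _ => rfl⟩
  refine ⟨(core n X).openPartialHomeomorph _ hc, IsManifold.subset_maximalAtlas ?_,
    rfl, fun _ => rfl⟩
  exact mem_iUnion₂.2 ⟨_, hc, rfl⟩

/-- The coordinates in a pair of charts of `X` are a chart of `Γ(X)`. -/
theorem BGroupoid.exists_chart (he₁ : e₁ ∈ atlas (EuclideanHalfSpace n) X)
    (he₂ : e₂ ∈ atlas (EuclideanHalfSpace n) X) (γ : BGroupoid n X) :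
    ∃ d ∈ IsManifold.maximalAtlas ((𝓡∂ n).prod (𝓡∂ n)) ∞ (BGroupoid n X),
      d.source = chartSource e₁ e₂ ∧ ∀ δ, d δ = coords e₁ e₂ δ := by
  have : Nonempty (BGroupoid n X) := ⟨γ⟩
  have hc : (BGroupoid.coords_injOn he₁ he₂).toPartialEquiv _ _ ∈ (core n X).atlas :=
    ⟨e₁, he₁, e₂, he₂, rfl, fun _ => rfl⟩
  refine ⟨(core n X).openPartialHomeomorph _ hc, IsManifold.subset_maximalAtlas ?_,
    rfl, fun _ => rfl⟩
  exact mem_iUnion₂.2 ⟨_, hc, rfl⟩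

/-- The dilation factor is the quotient of the homogeneous coordinates of the image, so the
coordinates of a point of Γ(X) are the left projective coordinates of its image. In these charts ι
is the identity. -/
theorem BGroupoid.isLocalDiffeomorph_toStretched :
    IsLocalDiffeomorph ((𝓡∂ n).prod (𝓡∂ n)) ((𝓡∂ n).prod (𝓡∂ n)) ∞
      (BGroupoid.toStretched : BGroupoid n X → BStretchedProduct n X) := by
  intro γ
  have he₁ := chart_mem_atlas (EuclideanHalfSpace n) γ.r
  have he₂ := chart_mem_atlas (EuclideanHalfSpace n) γ.s
  obtain ⟨c, hc, hcs, hcv⟩ := BGroupoid.exists_chart he₁ he₂ γ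
  obtain ⟨d, hd, hds, hdv⟩ := BStretchedProduct.exists_chart he₁ he₂ .left γ.toStretched
  have hmem : ∀ δ ∈ c.source, δ.toStretched ∈ d.source := fun δ hδ => by
    rw [hcs] at hδ
    rw [hds]
    exact ((image_toStretched he₁ he₂).subset (mem_image_of_mem _ hδ)).1
  have hval : ∀ δ ∈ c.source, c δ = d δ.toStretched := fun δ hδ => by
    rw [hcv, hdv]
    exact coords_toStretched he₁ he₂ δ (hcs ▸ hδ)
  have hγ : γ ∈ c.source := by
    rw [hcs]; exact ⟨mem_chart_source _ _, mem_chart_source _ _⟩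
  -- Since c = d ∘ ι on the domain of c, the local diffeomorphism that represents ι near γ is d⁻¹ ∘
  -- c.
  refine ⟨⟨(c.trans d.symm).toPartialEquiv, (c.trans d.symm).open_source,
    (c.trans d.symm).open_target, ?_, ?_⟩, ?_, ?_⟩
  · exact (contMDiffOn_symm_of_mem_maximalAtlas hd).comp
      ((contMDiffOn_of_mem_maximalAtlas hc).mono inter_subset_left) (fun δ hδ => hδ.2)
  · exact (contMDiffOn_symm_of_mem_maximalAtlas hc).comp
      ((contMDiffOn_of_mem_maximalAtlas hd).mono inter_subset_left) (fun δ hδ => hδ.2)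
  · refine ⟨hγ, ?_⟩
    change c γ ∈ d.target
    rw [hval γ hγ]
    exact d.map_source (hmem γ hγ)
  · intro δ hδ
    change δ.toStretched = d.symm (c δ)
    rw [hval δ hδ.1, d.left_inv (hmem δ hδ.1)]

/-- A local homeomorphism which is injective is an open embedding. -/
theorem BGroupoid.isOpenEmbedding_toStretched :
    IsOpenEmbedding (BGroupoid.toStretched : BGroupoid n X → BStretchedProduct n X) :=
  isLocalDiffeomorph_toStretched.isLocalHomeomorph.isOpenEmbedding_of_injective
    toStretched_injective

/-- A point of `X_b^2` lies in `Γ(X)` if and only if its homogeneous coordinates are positive. -/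
theorem mem_range_toStretched_iff (he₁ : e₁ ∈ atlas (EuclideanHalfSpace n) X)
    (he₂ : e₂ ∈ atlas (EuclideanHalfSpace n) X) (p : BStretchedProduct n X)
    (hx : p.blowDown.1 ∈ e₁.source) (hy : p.blowDown.2 ∈ e₂.source) :
    p ∈ range (BGroupoid.toStretched : BGroupoid n X → BStretchedProduct n X) ↔
      0 < (p.hom (boundaryCoord n e₁) (boundaryCoord n e₂)).1 ∧
      0 < (p.hom (boundaryCoord n e₁) (boundaryCoord n e₂)).2 := by
  constructor
  · rintro ⟨γ, rfl⟩
    rw [γ.blowDown_toStretched] at hx hy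
    obtain ⟨h1, h2, -⟩ := hom_toStretched he₁ he₂ γ hx hy
    exact ⟨h1, h2⟩
  · rintro ⟨h1, h2⟩
    -- Positivity of h₂ and of h₁ are the conditions defining the left and the right projective
    -- domain, and Γ(X) fills the intersection of the two.
    obtain ⟨γ, -, h⟩ := (image_toStretched he₁ he₂).superset
      (show p ∈ BStretchedProduct.chartSource .left e₁ e₂ ∩
        BStretchedProduct.chartSource .right e₁ e₂ from ⟨⟨hx, hy, h2⟩, ⟨hx, hy, h1⟩⟩)
    exact ⟨γ, h⟩

end LocalDiffeomorphism

/-! ### Smoothness of the coordinates and of the blow-down map -/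

section Coordinates
variable {n : ℕ} [NeZero n] {X : Type u} [TopologicalSpace X]
  [ChartedSpace (EuclideanHalfSpace n) X] [IsManifold (𝓡∂ n) ∞ X]
  {e₁ e₂ : OpenPartialHomeomorph X (EuclideanHalfSpace n)}

theorem contMDiffOn_coords (he₁ : e₁ ∈ atlas (EuclideanHalfSpace n) X)
    (he₂ : e₂ ∈ atlas (EuclideanHalfSpace n) X) (k : ChartKind) :
    ContMDiffOn ((𝓡∂ n).prod (𝓡∂ n)) 𝓘(ℝ, EuclideanSpace ℝ (Fin n) × EuclideanSpace ℝ (Fin n)) ∞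
      (fun p : BStretchedProduct n X => ((p.coords k e₁ e₂).1.1, (p.coords k e₁ e₂).2.1))
      (BStretchedProduct.chartSource k e₁ e₂) := by
  intro p hp
  obtain ⟨d, hd, hds, hdv⟩ := BStretchedProduct.exists_chart he₁ he₂ k p
  rw [← hds] at hp ⊢
  refine (d.contMDiffOn_extend hd).congr (fun q _ => ?_) p hp
  rw [← hdv]; rfl

theorem BStretchedProduct.isOpen_chartSource (he₁ : e₁ ∈ atlas (EuclideanHalfSpace n) X)
    (he₂ : e₂ ∈ atlas (EuclideanHalfSpace n) X) (k : ChartKind) :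
    IsOpen (chartSource (X := X) k e₁ e₂) := by
  rw [isOpen_iff_mem_nhds]
  intro p hp
  obtain ⟨d, -, hds, -⟩ := exists_chart he₁ he₂ k p
  rw [← hds] at hp ⊢
  exact d.open_source.mem_nhds hp

/-- The homogeneous coordinates are smooth functions of the coordinates. -/
theorem contMDiffOn_homOf_coords (he₁ : e₁ ∈ atlas (EuclideanHalfSpace n) X)
    (he₂ : e₂ ∈ atlas (EuclideanHalfSpace n) X) (k : ChartKind) :
    ContMDiffOn ((𝓡∂ n).prod (𝓡∂ n)) 𝓘(ℝ, ℝ) ∞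
      (fun p : BStretchedProduct n X => (k.homOf (p.coords k e₁ e₂)).1)
      (BStretchedProduct.chartSource k e₁ e₂) ∧
    ContMDiffOn ((𝓡∂ n).prod (𝓡∂ n)) 𝓘(ℝ, ℝ) ∞
      (fun p : BStretchedProduct n X => (k.homOf (p.coords k e₁ e₂)).2)
      (BStretchedProduct.chartSource k e₁ e₂) := by
  have h := contMDiffOn_coords (X := X) he₁ he₂ k
  have pr : ContDiff ℝ ∞ (fun v : EuclideanSpace ℝ (Fin n) => v 0) :=
    (EuclideanSpace.proj (𝕜 := ℝ) (0 : Fin n)).contDiff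
  have h1 := (pr.comp (contDiff_fst (𝕜 := ℝ) (F := EuclideanSpace ℝ (Fin n)))).contMDiff
    |>.comp_contMDiffOn h
  have h2 := (pr.comp (contDiff_snd (𝕜 := ℝ) (E := EuclideanSpace ℝ (Fin n)))).contMDiff
    |>.comp_contMDiffOn h
  cases k with
  | product => exact ⟨h1, h2⟩
  | left => exact ⟨h1, contMDiffOn_const⟩
  | right => exact ⟨contMDiffOn_const, h2⟩

/-- The blow-down map in coordinates is smooth. -/
theorem contMDiffOn_baseOf_coords (he₁ : e₁ ∈ atlas (EuclideanHalfSpace n) X)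
    (he₂ : e₂ ∈ atlas (EuclideanHalfSpace n) X) (k : ChartKind) :
    ContMDiffOn ((𝓡∂ n).prod (𝓡∂ n)) 𝓘(ℝ, EuclideanSpace ℝ (Fin n)) ∞
      (fun p : BStretchedProduct n X => (k.baseOf (p.coords k e₁ e₂)).1.1)
      (BStretchedProduct.chartSource k e₁ e₂) ∧
    ContMDiffOn ((𝓡∂ n).prod (𝓡∂ n)) 𝓘(ℝ, EuclideanSpace ℝ (Fin n)) ∞
      (fun p : BStretchedProduct n X => (k.baseOf (p.coords k e₁ e₂)).2.1)
      (BStretchedProduct.chartSource k e₁ e₂) := by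
  have h := contMDiffOn_coords (X := X) he₁ he₂ k
  let W := EuclideanSpace ℝ (Fin n) × EuclideanSpace ℝ (Fin n)
  let e0 : EuclideanSpace ℝ (Fin n) := EuclideanSpace.single (0 : Fin n) (1 : ℝ)
  have pr : ContDiff ℝ ∞ (fun v : EuclideanSpace ℝ (Fin n) => v 0) :=
    (EuclideanSpace.proj (𝕜 := ℝ) (0 : Fin n)).contDiff
  have pr1 : ContDiff ℝ ∞ (fun w : W => w.1 0) := pr.comp contDiff_fst
  have pr2 : ContDiff ℝ ∞ (fun w : W => w.2 0) := pr.comp contDiff_snd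
  have h1 := (contDiff_fst (𝕜 := ℝ) (E := EuclideanSpace ℝ (Fin n))
    (F := EuclideanSpace ℝ (Fin n))).contMDiff.comp_contMDiffOn h
  have h2 := (contDiff_snd (𝕜 := ℝ) (E := EuclideanSpace ℝ (Fin n))
    (F := EuclideanSpace ℝ (Fin n))).contMDiff.comp_contMDiffOn h
  cases k with
  | product => exact ⟨h1, h2⟩
  | left =>
    refine ⟨?_, h2⟩
    -- Here x₁ = λ y₁ is recovered by a polynomial formula on the vector space. It agrees with
    -- `setCoord` because λ y₁ is a product of nonnegative numbers, so nothing is truncated.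
    have h3 : ContDiff ℝ ∞ fun w : W => w.1 + (w.1 0 * w.2 0 - w.1 0) • e0 :=
      contDiff_fst.add (((pr1.mul pr2).sub pr1).smul contDiff_const)
    exact (h3.contMDiff.comp_contMDiffOn h).congr fun p _ =>
      setCoord_val _ (mul_nonneg (p.coords .left e₁ e₂).1.2 (p.coords .left e₁ e₂).2.2)
  | right =>
    refine ⟨h1, ?_⟩
    have h3 : ContDiff ℝ ∞ fun w : W => w.2 + (w.1 0 * w.2 0 - w.2 0) • e0 :=
      contDiff_snd.add (((pr1.mul pr2).sub pr2).smul contDiff_const)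
    exact (h3.contMDiff.comp_contMDiffOn h).congr fun p _ =>
      setCoord_val _ (mul_nonneg (p.coords .right e₁ e₂).1.2 (p.coords .right e₁ e₂).2.2)

/-- The map is recovered from its coordinate expression by composing with the inverse of the
half-space model and with `e.symm`, both smooth. Continuity of `f` therefore need not be known
beforehand. -/
theorem contMDiffOn_of_chart {e : OpenPartialHomeomorph X (EuclideanHalfSpace n)}
    (he : e ∈ atlas (EuclideanHalfSpace n) X) {S : Set (BStretchedProduct n X)}
    {f : BStretchedProduct n X → X} (hf : ∀ p ∈ S, f p ∈ e.source)
    (h : ContMDiffOn ((𝓡∂ n).prod (𝓡∂ n)) 𝓘(ℝ, EuclideanSpace ℝ (Fin n)) ∞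
      (fun p => (e (f p)).1) S) :
    ContMDiffOn ((𝓡∂ n).prod (𝓡∂ n)) (𝓡∂ n) ∞ f S := by
  have h1 := (𝓡∂ n).contMDiffOn_symm (n := ∞).comp h fun p _ => mem_range_self (f := 𝓡∂ n) (e (f p))
  have hs : ∀ p, (𝓡∂ n).symm (e (f p)).1 = e (f p) := fun p => (𝓡∂ n).left_inv _
  have h2 := (contMDiffOn_symm_of_mem_maximalAtlas (I := 𝓡∂ n) (n := ∞)
    (IsManifold.subset_maximalAtlas he)).comp h1 fun p hp => by
      rw [mem_preimage, Function.comp_apply, hs]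
      exact e.map_source (hf p hp)
  refine h2.congr fun p hp => ?_
  rw [Function.comp_apply, Function.comp_apply, hs, e.left_inv (hf p hp)]

/-- The blow-down map is smooth. -/
theorem contMDiff_blowDown :
    ContMDiff ((𝓡∂ n).prod (𝓡∂ n)) (𝓡∂ n) ∞ (fun p : BStretchedProduct n X => p.blowDown.1) ∧
    ContMDiff ((𝓡∂ n).prod (𝓡∂ n)) (𝓡∂ n) ∞ (fun p : BStretchedProduct n X => p.blowDown.2) := by
  have key : ∀ p : BStretchedProduct n X,
      ContMDiffAt ((𝓡∂ n).prod (𝓡∂ n)) (𝓡∂ n) ∞ (fun p : BStretchedProduct n X => p.blowDown.1) p ∧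
      ContMDiffAt ((𝓡∂ n).prod (𝓡∂ n)) (𝓡∂ n) ∞
        (fun p : BStretchedProduct n X => p.blowDown.2) p := by
    intro p
    have he₁ := chart_mem_atlas (EuclideanHalfSpace n) p.blowDown.1
    have he₂ := chart_mem_atlas (EuclideanHalfSpace n) p.blowDown.2
    have hn := (BStretchedProduct.isOpen_chartSource he₁ he₂ p.kindAt).mem_nhds
      p.mem_chartSource_kindAt
    -- By `coords_spec`, `baseOf` of the coordinates of a point is the pair of chart images of its
    -- two projections, so its smoothness gives that of both projections.
    obtain ⟨h1, h2⟩ := contMDiffOn_baseOf_coords (X := X) he₁ he₂ p.kindAt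
    refine ⟨(contMDiffOn_of_chart he₁ (fun q hq => hq.1) (h1.congr fun q hq => ?_)).contMDiffAt hn,
      (contMDiffOn_of_chart he₂ (fun q hq => hq.2.1) (h2.congr fun q hq => ?_)).contMDiffAt hn⟩
    · rw [(coords_spec he₁ he₂ _ q hq).1]
    · rw [(coords_spec he₁ he₂ _ q hq).1]
  exact ⟨fun p => (key p).1, fun p => (key p).2⟩

end Coordinates

/-! ### The complement of Γ(X) is the union of the left and right boundaries -/

section Boundaries
variable (n : ℕ) [NeZero n] (X : Type u) [TopologicalSpace X]
  [ChartedSpace (EuclideanHalfSpace n) X] [IsManifold (𝓡∂ n) ∞ X]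

/-- A point outside Γ(X) has a vanishing homogeneous coordinate. In its preferred chart this is a
vanishing model coordinate, and the other one can be moved inward while this one stays zero. The
reverse inclusion holds because Γ(X) is open and never has one end on the boundary and the other in
the interior. -/
theorem compl_range_toStretched :
    (range (BGroupoid.toStretched : BGroupoid n X → BStretchedProduct n X))ᶜ =
      leftBoundary n X ∪ rightBoundary n X := by
  have hbi : ∀ {x : X}, x ∈ (𝓡∂ n).boundary X → x ∈ (𝓡∂ n).interior X → False := by
    intro x hb hi
    rw [← (𝓡∂ n).compl_boundary] at hi
    exact hi hb
  apply Subset.antisymm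
  · intro p hp
    set e₁ := chartAt (EuclideanHalfSpace n) p.blowDown.1
    set e₂ := chartAt (EuclideanHalfSpace n) p.blowDown.2
    have he₁ : e₁ ∈ atlas (EuclideanHalfSpace n) X := chart_mem_atlas _ _
    have he₂ : e₂ ∈ atlas (EuclideanHalfSpace n) X := chart_mem_atlas _ _
    set k := p.kindAt
    have hps : p ∈ BStretchedProduct.chartSource k e₁ e₂ := p.mem_chartSource_kindAt
    obtain ⟨d, -, hds, hdv⟩ := BStretchedProduct.exists_chart he₁ he₂ k p
    have hpd : p ∈ d.source := hds ▸ hps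
    set m := p.coords k e₁ e₂ with hm
    have hdp : d p = m := hdv p
    -- moving one of the boundary coordinates inward
    have key : ∀ (c : ℝ → ModelProd (EuclideanHalfSpace n) (EuclideanHalfSpace n))
        (T : Set (X × X)), Tendsto c (𝓝[>] 0) (𝓝 m) →
        (∀ t > 0, ∀ q ∈ BStretchedProduct.chartSource k e₁ e₂, q.coords k e₁ e₂ = c t →
          q.blowDown ∈ T) → p ∈ closure (BStretchedProduct.blowDown ⁻¹' T) := by
      intro c T hc hT
      have h1 : Tendsto (fun t => d.symm (c t)) (𝓝[>] 0) (𝓝 p) := by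
        have := (d.continuousAt_symm (d.map_source hpd)).tendsto
        rw [d.left_inv hpd, hdp] at this
        exact this.comp hc
      have h2 : ∀ᶠ t in 𝓝[>] 0, c t ∈ d.target :=
        hc.eventually (d.open_target.mem_nhds (hdp ▸ d.map_source hpd))
      refine mem_closure_of_tendsto h1 ?_
      filter_upwards [h2, self_mem_nhdsWithin] with t ht ht0
      refine hT t ht0 _ (hds ▸ d.map_target ht) ?_
      rw [← hdv, d.right_inv ht]
    -- The curve that increases only the first coordinate of a by t; for t > 0 it lies in the open
    -- half-space.
    have hshift : ∀ a : EuclideanHalfSpace n,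
        Tendsto (fun t => setCoord a (a.1 0 + t)) (𝓝[>] (0 : ℝ)) (𝓝 a) := by
      intro a
      have h1 : Continuous fun t : ℝ => setCoord a (a.1 0 + t) :=
        continuous_setCoord continuous_const (continuous_const.add continuous_id)
      have h2 := h1.tendsto 0
      rw [add_zero, setCoord_self] at h2
      exact h2.mono_left nhdsWithin_le_nhds
    have hshift0 : ∀ (a : EuclideanHalfSpace n) (t : ℝ), 0 < t →
        0 < (setCoord a (a.1 0 + t)).1 0 := by
      intro a t ht
      have := a.2
      rw [setCoord_zero _ (by positivity)]
      positivity
    have hbase : ∀ q ∈ BStretchedProduct.chartSource k e₁ e₂,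
        ((k.baseOf (q.coords k e₁ e₂)).1.1 0 = 0 → q.blowDown.1 ∈ (𝓡∂ n).boundary X) ∧
        (0 < (k.baseOf (q.coords k e₁ e₂)).1.1 0 → q.blowDown.1 ∈ (𝓡∂ n).interior X) ∧
        ((k.baseOf (q.coords k e₁ e₂)).2.1 0 = 0 → q.blowDown.2 ∈ (𝓡∂ n).boundary X) ∧
        (0 < (k.baseOf (q.coords k e₁ e₂)).2.1 0 → q.blowDown.2 ∈ (𝓡∂ n).interior X) := by
      intro q hq
      rw [(coords_spec he₁ he₂ k q hq).1, ← (𝓡∂ n).compl_boundary, mem_compl_iff, mem_compl_iff,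
        mem_boundary_iff he₁ hq.1, mem_boundary_iff he₂ hq.2.1]
      exact ⟨id, fun h => h.ne', id, fun h => h.ne'⟩
    obtain ⟨-, ⟨s, hs, hh⟩, -⟩ := coords_spec he₁ he₂ k p hps
    -- `hom` is a positive multiple s of `homOf m`, so being outside Γ(X) means that one entry of
    -- `homOf m` is at most zero.
    rw [mem_compl_iff, mem_range_toStretched_iff he₁ he₂ p hps.1 hps.2.1, hh, Prod.smul_fst,
      Prod.smul_snd, smul_eq_mul, smul_eq_mul, mul_pos_iff_of_pos_left hs,
      mul_pos_iff_of_pos_left hs, not_and_or, not_lt, not_lt, ← hm] at hp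
    -- In the right projective chart the first model coordinate is x₁ itself and its vanishing
    -- describes the front face, hence the exclusion. In the other two charts y₁ is a model
    -- coordinate and can be made positive independently.
    have hleft : k ≠ .right → m.1.1 0 = 0 → p ∈ leftBoundary n X := by
      intro hk h0
      refine key (fun t => (m.1, setCoord m.2 (m.2.1 0 + t))) _
        (tendsto_const_nhds.prodMk_nhds (hshift m.2)) fun t ht q hq hqt => ?_
      have hb := hbase q hq
      rw [hqt] at hb
      cases hkk : k with
      | product => rw [hkk] at hb; exact ⟨hb.1 h0, hb.2.2.2 (hshift0 _ t ht)⟩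
      | left =>
        rw [hkk] at hb
        refine ⟨hb.1 ?_, hb.2.2.2 (hshift0 _ t ht)⟩
        -- In the left chart x₁ = λ y₁, so λ = 0 keeps x on the boundary while y₁ moves.
        change (setCoord m.1 (m.1.1 0 * _)).1 0 = 0
        rw [h0, zero_mul, setCoord_zero _ le_rfl]
      | right => exact absurd hkk hk
    have hright : k ≠ .left → m.2.1 0 = 0 → p ∈ rightBoundary n X := by
      intro hk h0
      refine key (fun t => (setCoord m.1 (m.1.1 0 + t), m.2)) _
        ((hshift m.1).prodMk_nhds tendsto_const_nhds) fun t ht q hq hqt => ?_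
      have hb := hbase q hq
      rw [hqt] at hb
      cases hkk : k with
      | product => rw [hkk] at hb; exact ⟨hb.2.1 (hshift0 _ t ht), hb.2.2.1 h0⟩
      | left => exact absurd hkk hk
      | right =>
        rw [hkk] at hb
        refine ⟨hb.2.1 (hshift0 _ t ht), hb.2.2.1 ?_⟩
        change (setCoord m.2 (_ * m.2.1 0)).1 0 = 0
        rw [h0, mul_zero, setCoord_zero _ le_rfl]
    have n1 : 0 ≤ m.1.1 0 := m.1.2
    have n2 : 0 ≤ m.2.1 0 := m.2.2
    -- In a projective chart one homogeneous coordinate is normalised to 1, so only the other can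
    -- vanish. In the product chart either can; a point over two different components has both zero
    -- and either alternative would do.
    cases hkk : k with
    | product =>
      rw [hkk] at hp
      rcases hp with h | h
      · exact Or.inl (hleft (by simp [hkk]) (le_antisymm h n1))
      · exact Or.inr (hright (by simp [hkk]) (le_antisymm h n2))
    | left =>
      rw [hkk] at hp
      rcases hp with h | h
      · exact Or.inl (hleft (by simp [hkk]) (le_antisymm h n1))
      · exact absurd h (not_le.2 one_pos)
    | right =>
      rw [hkk] at hp
      rcases hp with h | h
      · exact absurd h (not_le.2 one_pos)
      · exact Or.inr (hright (by simp [hkk]) (le_antisymm h n2))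
  · have hcl : IsClosed (range (BGroupoid.toStretched :
        BGroupoid n X → BStretchedProduct n X))ᶜ :=
      BGroupoid.isOpenEmbedding_toStretched.isOpen_range.isClosed_compl
    -- The two ends of an element of Γ(X) are of the same nature, whereas the sets whose closures
    -- are taken mix a boundary end with an interior end.
    have hr : ∀ γ : BGroupoid n X,
        (γ.r ∈ (𝓡∂ n).interior X ∧ γ.s ∈ (𝓡∂ n).interior X) ∨
        (γ.r ∈ (𝓡∂ n).boundary X ∧ γ.s ∈ (𝓡∂ n).boundary X) := by
      intro γ
      cases γ with
      | interior x y hx hy => exact Or.inl ⟨hx, hy⟩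
      | boundary x y h α hα => exact Or.inr ⟨h.1, h.2.1⟩
    refine union_subset (closure_minimal ?_ hcl) (closure_minimal ?_ hcl)
    · rintro _ hp ⟨γ, rfl⟩
      rw [mem_preimage, γ.blowDown_toStretched] at hp
      rcases hr γ with h | h
      · exact hbi hp.1 h.1
      · exact hbi h.2 hp.2
    · rintro _ hp ⟨γ, rfl⟩
      rw [mem_preimage, γ.blowDown_toStretched] at hp
      rcases hr γ with h | h
      · exact hbi hp.2 h.2
      · exact hbi h.1 hp.1

end Boundaries

/-! ### Boundary components and their defining functions -/

section DefiningFunctions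
variable {n : ℕ} [NeZero n] {X : Type u} [TopologicalSpace X]
  [ChartedSpace (EuclideanHalfSpace n) X] {C : BoundaryComponents n X} {ρ : X → ℝ}

theorem mem_boundaryComponent_iff {x : X} : x ∈ boundaryComponent C ↔
    ∃ hx : x ∈ (𝓡∂ n).boundary X, ConnectedComponents.mk ⟨x, hx⟩ = C := by
  constructor
  · rintro ⟨⟨x, hx⟩, h, rfl⟩
    exact ⟨hx, h⟩
  · rintro ⟨hx, h⟩
    exact ⟨⟨x, hx⟩, h, rfl⟩

theorem SameBoundaryComponent.mem_iff {x y : X} (h : SameBoundaryComponent n x y) :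
    x ∈ boundaryComponent C ↔ y ∈ boundaryComponent C := by
  obtain ⟨hx, hy, h⟩ := h
  simp only [mem_boundaryComponent_iff, hx, hy, exists_true_left, h]

theorem sameBoundaryComponent_of_mem {x y : X} (hx : x ∈ boundaryComponent C)
    (hy : y ∈ boundaryComponent C) : SameBoundaryComponent n x y := by
  obtain ⟨hx, h⟩ := mem_boundaryComponent_iff.1 hx
  obtain ⟨hy, h'⟩ := mem_boundaryComponent_iff.1 hy
  exact ⟨hx, hy, h.trans h'.symm⟩

theorem boundary_of_mem_boundaryComponent {x : X} (hx : x ∈ boundaryComponent C) :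
    x ∈ (𝓡∂ n).boundary X := (mem_boundaryComponent_iff.1 hx).1

theorem leadingCoeff_of_ne {x : X} (h : ρ x ≠ 0) (v : NormalSpace n x) :
    leadingCoeff n ρ x v = ρ x := if_neg h

/-- Away from the product of the component with itself, the homogeneous coordinates given by a
defining function are its values. -/
theorem IsDefiningFunction.hom_eq (hρ : IsDefiningFunction n ρ (boundaryComponent C))
    (p : BStretchedProduct n X) (h : ρ p.blowDown.1 + ρ p.blowDown.2 ≠ 0) :
    p.hom ρ ρ = (ρ p.blowDown.1, ρ p.blowDown.2) := by
  cases p with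
  | off x y hs => rfl
  | front x y hs R =>
    -- On the front face x and y share a component, so either both lie in C or neither does; a
    -- nonzero sum leaves only the second case, where `leadingCoeff` is the value of ρ.
    have hxy : ρ x = 0 ↔ ρ y = 0 := by
      rw [hρ.eq_zero_iff, hρ.eq_zero_iff, hs.mem_iff]
    have h : ρ x + ρ y ≠ 0 := h
    have hx : ρ x ≠ 0 := fun h0 => h (by rw [h0, hxy.1 h0, add_zero])
    exact Prod.ext (leadingCoeff_of_ne hx _) (leadingCoeff_of_ne (fun h0 => hx (hxy.2 h0)) _)

variable [IsManifold (𝓡∂ n) ∞ X]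

/-- Near a point of a component of the boundary, a defining function of the component is a positive
multiple of the first coordinate of any chart. -/
theorem IsDefiningFunction.exists_quotient (hρ : IsDefiningFunction n ρ (boundaryComponent C))
    {e : OpenPartialHomeomorph X (EuclideanHalfSpace n)}
    (he : e ∈ atlas (EuclideanHalfSpace n) X) {x₀ : X} (hx₀ : x₀ ∈ boundaryComponent C)
    (hxe : x₀ ∈ e.source) :
    ∃ U : Set X, IsOpen U ∧ x₀ ∈ U ∧ U ⊆ e.source ∧ ∃ q : X → ℝ,
      ContMDiffOn (𝓡∂ n) 𝓘(ℝ, ℝ) ∞ q U ∧ (∀ x ∈ U, 0 < q x) ∧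
      (∀ x ∈ U, ρ x = q x * boundaryCoord n e x) ∧
      ∀ x ∈ U, x ∈ (𝓡∂ n).boundary X → ∀ v,
        leadingCoeff n ρ x v = q x * leadingCoeff n (boundaryCoord n e) x v := by
  have hb₀ := boundary_of_mem_boundaryComponent hx₀
  -- Hadamard's lemma needs ρ to vanish on all of ∂X nearby, but ρ vanishes only on C. On V the
  -- boundary is contained in C.
  obtain ⟨V, hVs, hV, hxV⟩ := eventually_nhds_iff.1 (eventually_sameBoundaryComponent hb₀)
  have hU : IsOpen (V ∩ e.source) := hV.inter e.open_source
  have hzero : ∀ x ∈ V ∩ e.source, x ∈ (𝓡∂ n).boundary X → ρ x = 0 := fun x hx hb =>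
    (hρ.eq_zero_iff x).2 ((hVs x hx.1 hb).mem_iff.1 hx₀)
  obtain ⟨q, hq, hqe⟩ := exists_contMDiffOn_quotient he hU inter_subset_right
    hρ.contMDiff.contMDiffOn hzero
  have hc := (contMDiffOn_boundaryCoord he).mono (inter_subset_right (s := V))
  have hxU : x₀ ∈ V ∩ e.source := ⟨hxV, hxe⟩
  have hqc : ContinuousOn q (V ∩ e.source) := hq.continuousOn
  -- Where x₁ = 0 the product rule leaves dρ = q dx₁, so q(x₀) = 0 would contradict dρ ≠ 0 on C.
  have hne : q x₀ ≠ 0 := fun h0 => by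
    have h1 := mvfderiv_quotient hU hq hc hqe hxU ((mem_boundary_iff he hxe).1 hb₀)
    rw [h0, zero_smul] at h1
    exact hρ.mvfderiv_ne_zero x₀ hx₀ h1
  -- The sign is read off in the interior, where q = ρ / x₁ with ρ ≥ 0 and x₁ > 0, and passes to the
  -- limit along a curve ending at x₀.
  have hnn : 0 ≤ q x₀ := by
    obtain ⟨γ, hγ, hγp⟩ := exists_tendsto_interior hxe
    refine ge_of_tendsto ((hqc.continuousAt (hU.mem_nhds hxU)).tendsto.comp hγ) ?_
    filter_upwards [hγp, hγ.eventually (hU.mem_nhds hxU)] with t ht ht'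
    have h1 := hρ.nonneg (γ t)
    rw [hqe _ ht'] at h1
    exact nonneg_of_mul_nonneg_left h1 ht.2
  -- Positivity at x₀ only gives positivity nearby, so the neighbourhood is shrunk to the locus q >
  -- 0.
  refine ⟨(V ∩ e.source) ∩ q ⁻¹' Ioi 0, hqc.isOpen_inter_preimage hU isOpen_Ioi,
    ⟨hxU, lt_of_le_of_ne hnn hne.symm⟩, fun x hx => hx.1.2, q, hq.mono inter_subset_left,
    fun x hx => hx.2, fun x hx => hqe x hx.1, fun x hx hb v => ?_⟩
  -- At a boundary point of this neighbourhood both ρ and x₁ vanish, so both leading coefficients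
  -- are normal derivatives, and dρ = q dx₁ compares them.
  have h0 := (mem_boundary_iff he hx.1.2).1 hb
  obtain ⟨k, -, hk, hk'⟩ := normalDeriv_boundaryCoord he hx.1.2 hb
  have h1 := mvfderiv_quotient hU hq hc hqe hx.1 h0
  rw [hk, smul_smul] at h1
  rw [leadingCoeff, if_pos (hzero x hx.1 hb), leadingCoeff, if_pos h0, hk',
    normalDeriv_eq_smul h1, mul_smul]
  rfl

/-- Over a component of the boundary, the homogeneous coordinates given by a defining function are
positive multiples of those of any pair of charts. -/
theorem IsDefiningFunction.exists_hom_eq (hρ : IsDefiningFunction n ρ (boundaryComponent C))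
    {e₁ e₂ : OpenPartialHomeomorph X (EuclideanHalfSpace n)}
    (he₁ : e₁ ∈ atlas (EuclideanHalfSpace n) X) (he₂ : e₂ ∈ atlas (EuclideanHalfSpace n) X)
    {x₀ y₀ : X} (hx₀ : x₀ ∈ boundaryComponent C) (hxe : x₀ ∈ e₁.source)
    (hy₀ : y₀ ∈ boundaryComponent C) (hye : y₀ ∈ e₂.source) :
    ∃ U₁ U₂ : Set X, (IsOpen U₁ ∧ x₀ ∈ U₁) ∧ (IsOpen U₂ ∧ y₀ ∈ U₂) ∧ ∃ q₁ q₂ : X → ℝ,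
      (ContMDiffOn (𝓡∂ n) 𝓘(ℝ, ℝ) ∞ q₁ U₁ ∧ ∀ x ∈ U₁, 0 < q₁ x) ∧
      (ContMDiffOn (𝓡∂ n) 𝓘(ℝ, ℝ) ∞ q₂ U₂ ∧ ∀ y ∈ U₂, 0 < q₂ y) ∧
      (∀ p : BStretchedProduct n X, p.blowDown.1 ∈ U₁ → p.blowDown.2 ∈ U₂ →
        p.hom ρ ρ = (q₁ p.blowDown.1 * (p.hom (boundaryCoord n e₁) (boundaryCoord n e₂)).1,
          q₂ p.blowDown.2 * (p.hom (boundaryCoord n e₁) (boundaryCoord n e₂)).2)) ∧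
      ∀ γ : BGroupoid n X, γ.r ∈ U₁ → γ.s ∈ U₂ →
        γ.dilation ρ ρ =
          q₁ γ.r / q₂ γ.s * γ.dilation (boundaryCoord n e₁) (boundaryCoord n e₂) := by
  obtain ⟨U₁, hU₁, h₁, -, q₁, hs₁, hp₁, hv₁, hl₁⟩ := hρ.exists_quotient he₁ hx₀ hxe
  obtain ⟨U₂, hU₂, h₂, -, q₂, hs₂, hp₂, hv₂, hl₂⟩ := hρ.exists_quotient he₂ hy₀ hye
  refine ⟨U₁, U₂, ⟨hU₁, h₁⟩, ⟨hU₂, h₂⟩, q₁, q₂, ⟨hs₁, hp₁⟩, ⟨hs₂, hp₂⟩, fun p hx hy => ?_,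
    fun γ hx hy => ?_⟩
  -- Off the front face the homogeneous coordinates are values and ρ = q x₁ applies; on it they are
  -- leading coefficients of the same ray vector, which scale by the same q.
  · cases p with
    | off x y h => exact Prod.ext (hv₁ x hx) (hv₂ y hy)
    | front x y h R => exact Prod.ext (hl₁ x hx h.1 _) (hl₂ y hy h.2.1 _)
  · cases γ with
    | interior x y hxi hyi =>
      change ρ x / ρ y = q₁ x / q₂ y * (boundaryCoord n e₁ x / boundaryCoord n e₂ y)
      rw [hv₁ x hx, hv₂ y hy, div_mul_div_comm]
    | boundary x y h α hα =>
      change leadingCoeff n ρ x _ / leadingCoeff n ρ y _ = q₁ x / q₂ y *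
        (leadingCoeff n _ x _ / leadingCoeff n _ y _)
      rw [hl₁ x hx h.1, hl₂ y hy h.2.1, div_mul_div_comm]

/-! ### The function τ and its restriction to Γ(X) -/

/-- The quotient ρ(x) - ρ(y) over ρ(x) + ρ(y) is singular only over C × C. There the homogeneous
coordinates of ρ are q₁ and q₂ times those of the charts, and dividing out a common positive factor
turns τ into a quotient of smooth functions with nonzero denominator. -/
theorem IsDefiningFunction.contMDiff_tau (hρ : IsDefiningFunction n ρ (boundaryComponent C)) :
    ContMDiff ((𝓡∂ n).prod (𝓡∂ n)) 𝓘(ℝ, ℝ) ∞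
      (BStretchedProduct.tau ρ : BStretchedProduct n X → ℝ) := by
  intro p
  obtain ⟨hb₁, hb₂⟩ := contMDiff_blowDown (n := n) (X := X)
  -- As ρ ≥ 0, the sum vanishes exactly when both projections lie in C.
  by_cases h0 : ρ p.blowDown.1 + ρ p.blowDown.2 = 0
  · have hx : p.blowDown.1 ∈ boundaryComponent C := (hρ.eq_zero_iff _).1
      (by linarith [hρ.nonneg p.blowDown.1, hρ.nonneg p.blowDown.2])
    have hy : p.blowDown.2 ∈ boundaryComponent C := (hρ.eq_zero_iff _).1
      (by linarith [hρ.nonneg p.blowDown.1, hρ.nonneg p.blowDown.2])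
    have he₁ := chart_mem_atlas (EuclideanHalfSpace n) p.blowDown.1
    have he₂ := chart_mem_atlas (EuclideanHalfSpace n) p.blowDown.2
    have hps := p.mem_chartSource_kindAt
    set k := p.kindAt
    obtain ⟨U₁, U₂, ⟨hU₁, h₁⟩, ⟨hU₂, h₂⟩, q₁, q₂, ⟨hs₁, hp₁⟩, ⟨hs₂, hp₂⟩, hhom, -⟩ :=
      hρ.exists_hom_eq he₁ he₂ hx hps.1 hy hps.2.1
    set e₁ := chartAt (EuclideanHalfSpace n) p.blowDown.1
    set e₂ := chartAt (EuclideanHalfSpace n) p.blowDown.2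
    have hn := (BStretchedProduct.isOpen_chartSource he₁ he₂ k).mem_nhds hps
    obtain ⟨c₁, c₂⟩ := contMDiffOn_homOf_coords (X := X) he₁ he₂ k
    have d₁ : ContMDiffAt ((𝓡∂ n).prod (𝓡∂ n)) 𝓘(ℝ, ℝ) ∞
        (fun p : BStretchedProduct n X => q₁ p.blowDown.1) p :=
      ContMDiffAt.comp (g := q₁) p (hs₁.contMDiffAt (hU₁.mem_nhds h₁)) hb₁.contMDiffAt
    have d₂ : ContMDiffAt ((𝓡∂ n).prod (𝓡∂ n)) 𝓘(ℝ, ℝ) ∞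
        (fun p : BStretchedProduct n X => q₂ p.blowDown.2) p :=
      ContMDiffAt.comp (g := q₂) p (hs₂.contMDiffAt (hU₂.mem_nhds h₂)) hb₂.contMDiffAt
    have f₁ := d₁.mul (c₁.contMDiffAt hn)
    have f₂ := d₂.mul (c₂.contMDiffAt hn)
    -- One entry of `homOf` is 1 and the other nonnegative in a projective chart. The preferred
    -- chart over C × C is never the product chart, where both entries could vanish.
    have hden : q₁ p.blowDown.1 * (k.homOf (p.coords k e₁ e₂)).1 +
        q₂ p.blowDown.2 * (k.homOf (p.coords k e₁ e₂)).2 ≠ 0 := by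
      have a₁ := hp₁ _ h₁
      have a₂ := hp₂ _ h₂
      have n₁ : 0 ≤ (p.coords k e₁ e₂).1.1 0 := (p.coords k e₁ e₂).1.2
      have n₂ : 0 ≤ (p.coords k e₁ e₂).2.1 0 := (p.coords k e₁ e₂).2.2
      cases hk : k with
      | product =>
        rw [hk] at hps
        exact absurd (sameBoundaryComponent_of_mem hx hy) hps.2.2
      | left =>
        rw [hk] at n₁
        refine ne_of_gt (add_pos_of_nonneg_of_pos (mul_nonneg a₁.le n₁) (mul_pos a₂ one_pos))
      | right =>
        rw [hk] at n₂
        refine ne_of_gt (add_pos_of_pos_of_nonneg (mul_pos a₁ one_pos) (mul_nonneg a₂.le n₂))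
    refine ((f₁.sub f₂).div₀ (f₁.add f₂) hden).congr_of_eventuallyEq ?_
    filter_upwards [hn, hb₁.continuous.continuousAt.eventually (hU₁.mem_nhds h₁),
      hb₂.continuous.continuousAt.eventually (hU₂.mem_nhds h₂)] with r hr hr₁ hr₂
    obtain ⟨-, ⟨t, ht, hh⟩, -⟩ := coords_spec he₁ he₂ k r hr
    rw [BStretchedProduct.tau, hhom r hr₁ hr₂, hh]
    -- The factor t between `hom` and `homOf` depends on the chosen ray vector and is not known to
    -- vary smoothly; it cancels because τ is homogeneous of degree zero.
    simp only [Prod.smul_fst, Prod.smul_snd, smul_eq_mul, mul_left_comm _ t]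
    rw [← mul_sub, ← mul_add, mul_div_mul_left _ _ ht.ne']
    rfl
  · have f₁ := hρ.contMDiff.comp hb₁
    have f₂ := hρ.contMDiff.comp hb₂
    refine ((f₁.sub f₂).contMDiffAt.div₀ (f₁.add f₂).contMDiffAt h0).congr_of_eventuallyEq ?_
    -- Being off C × C is an open condition, and there τ is the quotient pulled back by the
    -- blow-down map, even on the front faces of other components.
    filter_upwards [(f₁.add f₂).continuous.continuousAt.eventually_ne h0] with r hr
    rw [BStretchedProduct.tau, hρ.hom_eq r hr]
    rfl

/-- The homogeneous coordinates of a point of `Γ(X)` given by a defining function are positive, and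
the dilation factor is their quotient. -/
theorem IsDefiningFunction.hom_toStretched (hρ : IsDefiningFunction n ρ (boundaryComponent C))
    (γ : BGroupoid n X) :
    0 < (γ.toStretched.hom ρ ρ).1 ∧ 0 < (γ.toStretched.hom ρ ρ).2 ∧
    γ.dilation ρ ρ = (γ.toStretched.hom ρ ρ).1 / (γ.toStretched.hom ρ ρ).2 := by
  have hpos : ∀ {x}, x ∉ boundaryComponent C → 0 < ρ x := fun hx =>
    lt_of_le_of_ne (hρ.nonneg _) fun h => hx ((hρ.eq_zero_iff _).1 h.symm)
  cases γ with
  | interior x y hx hy =>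
    rw [← (𝓡∂ n).compl_boundary] at hx hy
    exact ⟨hpos fun h => hx (boundary_of_mem_boundaryComponent h),
      hpos fun h => hy (boundary_of_mem_boundaryComponent h), rfl⟩
  | boundary x y hs α hα =>
    by_cases hx : x ∈ boundaryComponent C
    · have hy := hs.mem_iff.1 hx
      have he₁ := chart_mem_atlas (EuclideanHalfSpace n) x
      have he₂ := chart_mem_atlas (EuclideanHalfSpace n) y
      obtain ⟨U₁, U₂, ⟨-, h₁⟩, ⟨-, h₂⟩, q₁, q₂, ⟨-, hp₁⟩, ⟨-, hp₂⟩, hhom, hdil⟩ :=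
        hρ.exists_hom_eq he₁ he₂ hx (mem_chart_source _ x) hy (mem_chart_source _ y)
      obtain ⟨g₁, g₂, g⟩ := BStretch.hom_toStretched he₁ he₂ (.boundary x y hs α hα)
        (mem_chart_source _ x) (mem_chart_source _ y)
      rw [hhom (BGroupoid.boundary x y hs α hα).toStretched h₁ h₂,
        hdil (.boundary x y hs α hα) h₁ h₂, g]
      exact ⟨mul_pos (hp₁ _ h₁) g₁, mul_pos (hp₂ _ h₂) g₂, div_mul_div_comm _ _ _ _⟩
    -- The isomorphism lies over another component, where ρ is positive at both ends. The leading
    -- coefficients are then values of ρ, whatever the normal vectors, and the dilation factor is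
    -- ρ(x) / ρ(y).
    · have hx' := hpos hx
      have hy' := hpos fun h => hx (hs.mem_iff.2 h)
      have h : (BGroupoid.boundary x y hs α hα).toStretched.hom ρ ρ = (ρ x, ρ y) :=
        hρ.hom_eq _ (add_pos hx' hy').ne'
      rw [h]
      refine ⟨hx', hy', ?_⟩
      change leadingCoeff n ρ x _ / leadingCoeff n ρ y _ = _
      rw [leadingCoeff_of_ne hx'.ne', leadingCoeff_of_ne hy'.ne']

theorem tanh_half_log {t : ℝ} (ht : 0 < t) : Real.tanh (Real.log t / 2) = (t - 1) / (t + 1) := by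
  have h2 : Real.exp (Real.log t / 2) ^ 2 = t := by
    rw [← Real.exp_nat_mul, Nat.cast_ofNat, mul_div_cancel₀ _ two_ne_zero, Real.exp_log ht]
  have h3 := Real.exp_pos (Real.log t / 2)
  rw [Real.tanh_eq_sinh_div_cosh, Real.sinh_eq, Real.cosh_eq, Real.exp_neg]
  -- With s = √t the claim becomes (s - s⁻¹) / (s + s⁻¹) = (s² - 1) / (s² + 1).
  set s := Real.exp (Real.log t / 2)
  rw [← h2]
  field_simp

/-- If a, b > 0 are the homogeneous coordinates of ρ, then φ = log (a / b), and (a - b) / (a + b) is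
(t - 1) / (t + 1) at t = a / b. -/
theorem IsDefiningFunction.tau_toStretched (hρ : IsDefiningFunction n ρ (boundaryComponent C))
    (γ : BGroupoid n X) :
    BStretchedProduct.tau ρ γ.toStretched = Real.tanh (BGroupoid.phi ρ γ / 2) := by
  obtain ⟨h1, h2, h⟩ := hρ.hom_toStretched γ
  rw [BGroupoid.phi, h, tanh_half_log (div_pos h1 h2), BStretchedProduct.tau]
  field_simp

/-! ### Γ(X) as the locus where every τ lies in ]-1, 1[ -/

/-- A nonnegative pair with quotient of difference and sum in the open interval is positive. -/
theorem pos_of_div_mem_Ioo {a b : ℝ} (ha : 0 ≤ a) (hb : 0 ≤ b) (hab : 0 < a ∨ 0 < b)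
    (h : (a - b) / (a + b) ∈ Ioo (-1 : ℝ) 1) : 0 < a ∧ 0 < b := by
  have hs : 0 < a + b := by rcases hab with h | h <;> positivity
  obtain ⟨h1, h2⟩ := h
  rw [lt_div_iff₀ hs] at h1
  rw [div_lt_iff₀ hs] at h2
  constructor <;> linarith

/-- On Γ(X) each τ is a hyperbolic tangent. Conversely, |τ| < 1 makes both homogeneous coordinates
positive as soon as they are not both zero, and this is what the blow-up guarantees: both vanish
only over C × C in `X × X`, which has been replaced by rays. -/
theorem range_toStretched_eq {ρ : BoundaryComponents n X → X → ℝ}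
    (hρ : ∀ C, IsDefiningFunction n (ρ C) (boundaryComponent C)) :
    range (BGroupoid.toStretched : BGroupoid n X → BStretchedProduct n X) =
      ⋂ C : BoundaryComponents n X, BStretchedProduct.tau (ρ C) ⁻¹' Ioo (-1) 1 := by
  apply Subset.antisymm
  · rintro _ ⟨γ, rfl⟩
    refine mem_iInter.2 fun C => ?_
    rw [mem_preimage, (hρ C).tau_toStretched]
    exact ⟨Real.neg_one_lt_tanh _, Real.tanh_lt_one _⟩
  · intro p hp
    rw [mem_iInter] at hp
    cases p with
    | off x y hn =>
      have key : ∀ C : BoundaryComponents n X, x ∉ boundaryComponent C ∧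
          y ∉ boundaryComponent C := by
        intro C
        have hxC := (hρ C).eq_zero_iff x
        have hyC := (hρ C).eq_zero_iff y
        have h : 0 < ρ C x ∧ 0 < ρ C y := by
          -- If ρ_C vanished at both x and y, both would lie in C and the point would not be off the
          -- front face.
          refine pos_of_div_mem_Ioo ((hρ C).nonneg x) ((hρ C).nonneg y) ?_ (hp C)
          by_contra! h
          exact hn (sameBoundaryComponent_of_mem
            (hxC.1 (le_antisymm h.1 ((hρ C).nonneg x))) (hyC.1 (le_antisymm h.2 ((hρ C).nonneg y))))
        exact ⟨fun hx => h.1.ne' (hxC.2 hx), fun hy => h.2.ne' (hyC.2 hy)⟩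
      refine ⟨.interior x y ?_ ?_, rfl⟩
      · rw [← (𝓡∂ n).compl_boundary]
        -- A boundary point would lie in its own component, so avoiding every component means being
        -- interior.
        exact fun hx => (key _).1 (mem_boundaryComponent_iff.2 ⟨hx, rfl⟩)
      · rw [← (𝓡∂ n).compl_boundary]
        exact fun hy => (key _).2 (mem_boundaryComponent_iff.2 ⟨hy, rfl⟩)
    | front x y hs R =>
      set p : BStretchedProduct n X := .front x y hs R with hpd
      -- On the front face the condition for the common component of x and y is enough.
      set C : BoundaryComponents n X := ConnectedComponents.mk ⟨x, hs.1⟩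
      have hx : x ∈ boundaryComponent C := mem_boundaryComponent_iff.2 ⟨hs.1, rfl⟩
      have hy := hs.mem_iff.1 hx
      have hps := p.mem_chartSource_kindAt
      have he₁ := chart_mem_atlas (EuclideanHalfSpace n) p.blowDown.1
      have he₂ := chart_mem_atlas (EuclideanHalfSpace n) p.blowDown.2
      obtain ⟨U₁, U₂, ⟨-, h₁⟩, ⟨-, h₂⟩, q₁, q₂, ⟨-, hp₁⟩, ⟨-, hp₂⟩, hhom, -⟩ :=
        (hρ C).exists_hom_eq he₁ he₂ hx hps.1 hy hps.2.1
      obtain ⟨n₁, n₂⟩ := hom_nonneg he₁ he₂ p hps.1 hps.2.1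
      have a₁ : 0 < q₁ p.blowDown.1 := hp₁ _ h₁
      have a₂ : 0 < q₂ p.blowDown.2 := hp₂ _ h₂
      rw [mem_range_toStretched_iff he₁ he₂ p hps.1 hps.2.1]
      have h := hp C
      rw [mem_preimage, BStretchedProduct.tau, hhom p h₁ h₂] at h
      have := pos_of_div_mem_Ioo (mul_nonneg a₁.le n₁) (mul_nonneg a₂.le n₂) ?_ h
      · exact ⟨pos_of_mul_pos_right this.1 a₁.le, pos_of_mul_pos_right this.2 a₂.le⟩
      · obtain ⟨-, -, hk⟩ := hps
        -- The kind of the preferred chart says which homogeneous coordinate is positive: h₂ for the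
        -- left chart and h₁ for the right one.
        cases hkk : p.kindAt with
        | product => rw [hkk] at hk; exact absurd hs hk
        | left => rw [hkk] at hk; exact Or.inr (mul_pos a₂ hk)
        | right => rw [hkk] at hk; exact Or.inl (mul_pos a₁ hk)

end DefiningFunctions

end BStretch

/-! ### The theorem -/

/-- When the boundary is nonempty and connected, the intersection runs over a single component and
is one preimage. When the boundary is empty, the intersection is all of `X_b^2`. -/
theorem mainTheorem2 (n : ℕ) [NeZero n] (X : Type*) [TopologicalSpace X] [T2Space X]
    [SecondCountableTopology X] [ChartedSpace (EuclideanHalfSpace n) X]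
    [IsManifold (𝓡∂ n) ∞ X] :
    (Topology.IsOpenEmbedding
        (BStretch.BGroupoid.toStretched :
          BStretch.BGroupoid n X → BStretch.BStretchedProduct n X) ∧
      IsLocalDiffeomorph ((𝓡∂ n).prod (𝓡∂ n)) ((𝓡∂ n).prod (𝓡∂ n)) ∞
        (BStretch.BGroupoid.toStretched :
          BStretch.BGroupoid n X → BStretch.BStretchedProduct n X)) ∧
    (Set.range (BStretch.BGroupoid.toStretched :
        BStretch.BGroupoid n X → BStretch.BStretchedProduct n X))ᶜ =
      BStretch.leftBoundary n X ∪ BStretch.rightBoundary n X ∧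
    (∀ (C : BStretch.BoundaryComponents n X) (ρ : X → ℝ),
      BStretch.IsDefiningFunction n ρ (BStretch.boundaryComponent C) →
        ContMDiff ((𝓡∂ n).prod (𝓡∂ n)) 𝓘(ℝ, ℝ) ∞
          (BStretch.BStretchedProduct.tau ρ : BStretch.BStretchedProduct n X → ℝ) ∧
        ∀ γ : BStretch.BGroupoid n X,
          BStretch.BStretchedProduct.tau ρ γ.toStretched =
            Real.tanh (BStretch.BGroupoid.phi ρ γ / 2)) ∧
    ∀ ρ : BStretch.BoundaryComponents n X → X → ℝ,
      (∀ C, BStretch.IsDefiningFunction n (ρ C) (BStretch.boundaryComponent C)) →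
        Set.range (BStretch.BGroupoid.toStretched :
            BStretch.BGroupoid n X → BStretch.BStretchedProduct n X) =
          ⋂ C : BStretch.BoundaryComponents n X,
            BStretch.BStretchedProduct.tau (ρ C) ⁻¹' Set.Ioo (-1) 1 :=
  ⟨⟨BStretch.BGroupoid.isOpenEmbedding_toStretched,
      BStretch.BGroupoid.isLocalDiffeomorph_toStretched⟩,
    BStretch.compl_range_toStretched n X,
    fun _ _ hρ => ⟨hρ.contMDiff_tau, hρ.tau_toStretched⟩,
    fun _ hρ => BStretch.range_toStretched_eq hρ⟩
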